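/- Let $d\ge 2$, and let $\gamma=\frac{2d}{d-2}$ if $d>2$, while $\gamma>2$ is any number if $d=2$. Let $\mu\in(0,1]$, $\mu_1,\mu_2>0$, $\beta\ge 0$, and set $q=\frac{2d}{d+2}$ and $\varrho=\frac1{4(1+\beta^2)}$. Then there is a constant $N=N(d,\mu,\mu_1,\mu_2,\gamma,\beta)$ such that the following holds. Let $\Omega\subset\mathbb R^d$ be a bounded open set (for instance a bounded domain) and $R_0\in(0,1]$, such that for every $x_0\in\partial\Omega$ and $r\in(0,R_0]$ there are a coordinate system $x=(x_1,x')$ and a Lipschitz function $\varphi:\mathbb R^{d-1}\to\mathbb R$ with $$\Omega\cap B_r(x_0)=\{x\in B_r(x_0):x_1>\varphi(x')\},\qquad |\varphi(y')-\varphi(x')|\le\beta|y'-x'|\ \text{ for } x',y'\in B_r'(x_0').$$ Let $A_{ij}(x,z)$, $a_i(x,z)$, $b(x,z,\xi)$ ($1\le i,j\le d$) be Carathéodory functions of $x\in\Omega$, $z\in\mathbb R$, $\xi\in\mathbb R^d$ (measurable in $x$ for all $(z,\xi)$, continuous in $(z,\xi)$ for almost all $x$) such that, for almost all $x\in\Omega$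 and all $z\in\mathbb R$, $\xi\in\mathbb R^d$, $$|A_{ij}(x,z)|\le\mu^{-1},\qquad \sum_{i,j}A_{ij}(x,z)\xi_i\xi_j\ge\mu|\xi|^2,$$ $$|a_i(x,z)|\le\mu_1\big(|z|^{\gamma/2}+f(x)\big),\qquad |b(x,z,\xi)|\le\mu_2\big(|\xi|^{2(1-1/\gamma)}+|z|^{\gamma-1}+g(x)\big),$$ where $f\in L_2(\Omega)$ and $g\in L_{\gamma/(\gamma-1)}(\Omega)$. Let $u\in W^1_2(\Omega)$ be a weak solution of the conormal derivative problem for $-D_i(A_{ij}(x,u)D_ju+a_i(x,u))=b(x,u,\nabla u)$ in $\Omega$, that is, $$\int_\Omega \sum_i\Big(\sum_jA_{ij}(x,u)D_ju+a_i(x,u)\Big)D_i\phi\,dx=\int_\Omega b(x,u,\nabla u)\,\phi\,dx\qquad\text{for all }\phi\in W^1_2(\Omega).$$ Then $u\in L_\gamma(\Omega)$, and for every $R\in(0,R_0]$ and every $x_0$ such that either $B_R(x_0)\subset\Omega$ or $x_0\in\partial\Omega$, writing $\Omega_r(x_0)=\Omega\cap B_r(x_0)$, $F=|g|^{\frac12\frac{\gamma}{\gamma-1}}$,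 and $\langle h\rangle_E=\frac1{|E|}\int_E h\,dx$ for averages, $$\begin{aligned} \big\langle|\nabla u|^2+|u|^\gamma\big\rangle_{\Omega_{\varrho R}(x_0)}\le{}& N\Big(\big\langle|\nabla u|^q+|u|^{\gamma q/2}\big\rangle_{\Omega_R(x_0)}\Big)^{2/q}+N\big\langle|f|^2+|F|^2\big\rangle_{\Omega_R(x_0)}\\ &+N R^{d\gamma(\frac1\gamma-\frac12)+\gamma}\Big(\int_{\Omega_R(x_0)}|\nabla u|^2\,dx\Big)^{\frac\gamma2-1}\big\langle|\nabla u|^2\big\rangle_{\Omega_R(x_0)}. \end{aligned}$$ -/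

import Mathlib

open MeasureTheory Set
open scoped ENNReal NNReal ContDiff

/-- `ℝ^d` with its Euclidean norm. -/
abbrev RSpace (d : ℕ) : Type := EuclideanSpace ℝ (Fin d)

/-- The exponent `γ`: it is `2d/(d-2)` if `d > 2`, and any number bigger than `2` if `d = 2`. -/
def IsGammaExponent (d : ℕ) (γ : ℝ) : Prop :=
  (2 < d ∧ γ = 2 * (d : ℝ) / ((d : ℝ) - 2)) ∨ (d = 2 ∧ 2 < γ)

/-- The Lipschitz condition on `Ω` with constants `β` and `R₀`. A coordinate system is given by
the direction `e` of its first axis: `x₁` is `⟪e, x⟫`, and `x'` is the orthogonal projection of `x`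
on the hyperplane `e^⊥`, a Euclidean space of dimension `d - 1`. (Moving the origin, or choosing
the remaining axes in `e^⊥`, only changes the function `φ` by a constant or by an isometry.) -/
def LipschitzBoundary {d : ℕ} (Ω : Set (RSpace d)) (β R₀ : ℝ) : Prop :=
  ∀ x₀ ∈ frontier Ω, ∀ r : ℝ, 0 < r → r ≤ R₀ →
    ∃ (e : RSpace d) (φ : (ℝ ∙ e)ᗮ → ℝ),
      ‖e‖ = 1 ∧ (∃ K : ℝ≥0, LipschitzWith K φ) ∧
      Ω ∩ Metric.ball x₀ r =
        {x | x ∈ Metric.ball x₀ r ∧ φ ((ℝ ∙ e)ᗮ.orthogonalProjectionOnto x) < inner ℝ e x} ∧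
      ∀ x' ∈ Metric.ball ((ℝ ∙ e)ᗮ.orthogonalProjectionOnto x₀) r,
        ∀ y' ∈ Metric.ball ((ℝ ∙ e)ᗮ.orthogonalProjectionOnto x₀) r,
          |φ y' - φ x'| ≤ β * ‖y' - x'‖

/-- `Du` is the weak gradient of `u` in `Ω`. -/
def IsWeakGradient {d : ℕ} (Ω : Set (RSpace d)) (u : RSpace d → ℝ) (Du : RSpace d → RSpace d) :
    Prop :=
  ∀ φ : RSpace d → ℝ, ContDiff ℝ ∞ φ → HasCompactSupport φ → tsupport φ ⊆ Ω →
    ∀ i : Fin d,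
      ∫ x in Ω, u x * fderiv ℝ φ x (EuclideanSpace.single i 1) = - ∫ x in Ω, Du x i * φ x

/-- `u` belongs to the Sobolev space `W^1_2(Ω)`, with (weak) gradient `Du`. -/
structure IsSobolev {d : ℕ} (Ω : Set (RSpace d)) (u : RSpace d → ℝ) (Du : RSpace d → RSpace d) :
    Prop where
  memLp : MemLp u 2 (volume.restrict Ω)
  memLp_grad : MemLp Du 2 (volume.restrict Ω)
  weakGradient : IsWeakGradient Ω u Du

/-- The nonlinear terms `A_{ij}(x,z)`, `a_i(x,z)`, `b(x,z,ξ)` of the equation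
`-D_i(A_{ij}(x,u) D_j u + a_i(x,u)) = b(x,u,∇u)`. -/
structure Coefficients (d : ℕ) where
  A : Fin d → Fin d → RSpace d → ℝ → ℝ
  a : Fin d → RSpace d → ℝ → ℝ
  b : RSpace d → ℝ → RSpace d → ℝ

namespace Coefficients

variable {d : ℕ}

/-- The terms are of Carathéodory type: (Lebesgue) measurable in `x` for all `(z, ξ)`, continuous
in `(z, ξ)` for almost all `x`. -/
structure IsCaratheodory (c : Coefficients d) (Ω : Set (RSpace d)) : Prop where
  measurable_A : ∀ i j z, AEMeasurable (fun x => c.A i j x z) (volume.restrict Ω)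
  measurable_a : ∀ i z, AEMeasurable (fun x => c.a i x z) (volume.restrict Ω)
  measurable_b : ∀ z ξ, AEMeasurable (fun x => c.b x z ξ) (volume.restrict Ω)
  continuous_A : ∀ i j, ∀ᵐ x ∂volume.restrict Ω, Continuous (c.A i j x)
  continuous_a : ∀ i, ∀ᵐ x ∂volume.restrict Ω, Continuous (c.a i x)
  continuous_b : ∀ᵐ x ∂volume.restrict Ω, Continuous (fun p : ℝ × RSpace d => c.b x p.1 p.2)

/-- The leading coefficients are bounded and uniformly elliptic with constant `μ`. -/
structure IsElliptic (c : Coefficients d) (Ω : Set (RSpace d)) (μ : ℝ) : Prop where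
  bounded : ∀ᵐ x ∂volume.restrict Ω, ∀ z i j, |c.A i j x z| ≤ μ⁻¹
  elliptic : ∀ᵐ x ∂volume.restrict Ω, ∀ z, ∀ ξ : RSpace d,
    μ * ‖ξ‖ ^ 2 ≤ ∑ i, ∑ j, c.A i j x z * ξ i * ξ j

/-- The controlled growth conditions. -/
structure ControlledGrowth (c : Coefficients d) (Ω : Set (RSpace d)) (γ μ₁ μ₂ : ℝ)
    (f g : RSpace d → ℝ) : Prop where
  growth_a : ∀ᵐ x ∂volume.restrict Ω, ∀ z i, |c.a i x z| ≤ μ₁ * (|z| ^ (γ / 2) + f x)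
  growth_b : ∀ᵐ x ∂volume.restrict Ω, ∀ z, ∀ ξ : RSpace d,
    |c.b x z ξ| ≤ μ₂ * (‖ξ‖ ^ (2 * (1 - 1 / γ)) + |z| ^ (γ - 1) + g x)

/-- `u ∈ W^1_2(Ω)`, with gradient `Du`, is a weak solution of the conormal derivative problem
in `Ω`: the test functions range over all of `W^1_2(Ω)`. -/
structure IsWeakSolution (c : Coefficients d) (Ω : Set (RSpace d)) (u : RSpace d → ℝ)
    (Du : RSpace d → RSpace d) : Prop where
  sobolev : IsSobolev Ω u Du
  equation : ∀ (φ : RSpace d → ℝ) (Dφ : RSpace d → RSpace d), IsSobolev Ω φ Dφ →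
    ∫ x in Ω, ∑ i, ((∑ j, c.A i j x (u x) * Du x j) + c.a i x (u x)) * Dφ x i =
      ∫ x in Ω, c.b x (u x) (Du x) * φ x

end Coefficients

/-! ### Jensen's inequality for lower Lebesgue integrals -/

/-! The estimate is a reverse Hölder inequality of Caccioppoli type. The conormal problem allows the
test function η²(u − k), with η a cutoff and k a constant, on balls that meet the boundary.
Ellipticity and Young's inequality absorb all gradient terms; controlled growth is what leaves only
|u − k|²/r², |u − k|^γ, |u|^γ, f² and F² on the right (`exists_pointwise_caccioppoli_const`,
`exists_caccioppoli_const`).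

Let k be a mean value of u. The Sobolev conjugate of q is 2, so the Sobolev–Poincaré inequality
turns |u − k|² into the average of |∇u|^q to the power 2/q. The conjugate of dγ/(d+γ) ≤ 2 is γ, so
the same inequality and Hölder bound the integral of |u − k|^γ by a power of R times (∫|∇u|²)^{γ/2},
the last term of the estimate. Finally |u|^γ splits into |u − k|^γ and |k|^γ, and Jensen bounds
|k|^γ by the average of |u|^{γq/2} to the power 2/q. `exists_reverse_holder_const` assembles this.

The main work is Sobolev–Poincaré up to the boundary with constants that see Ω only through β. The
only geometry used is `ConeCondition`: inside B_R(x₀), translating a point of Ω by a vector of a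
fixed cone does not leave Ω. It is trivial for balls inside Ω and follows from the graph
representation at boundary points, so both cases are treated at once. The cone serves three times. A
mollifier shifted into it averages over points of Ω only (`ConeCondition.exists_smooth_approx`).
Some ball is joined to every point of Ω near x₀ by segments inside Ω, which gives
`ConeCondition.poincare`. Rays in d independent cone directions stay in Ω until they leave the ball,
so Gagliardo's argument works for functions that vanish near the sphere but not on ∂Ω
(`exists_sobolev_const_of_contDiff`).

With m = 1 + β² the radii are nested as R/(4m) = ϱR for the conclusion, R/(3m) for Caccioppoli,
R/(2m) for the cutoff in Sobolev's inequality, and R for the gradient in Poincaré's. Membership of u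
in L_γ follows from the local inequality and compactness of the closure of Ω. -/

theorem lintegral_rpow_le_of_isProbabilityMeasure {α : Type*} [MeasurableSpace α] (ν : Measure α)
    [IsProbabilityMeasure ν] {f : α → ℝ≥0∞} (hf : AEMeasurable f ν) {p : ℝ} (hp : 1 ≤ p) :
    (∫⁻ x, f x ∂ν) ^ p ≤ ∫⁻ x, f x ^ p ∂ν := by
  have h := eLpNorm'_le_eLpNorm'_of_exponent_le zero_lt_one hp ν hf.aestronglyMeasurable
  simp only [eLpNorm', enorm_eq_self, ENNReal.rpow_one, div_one] at h
  calc (∫⁻ x, f x ∂ν) ^ p ≤ ((∫⁻ x, f x ^ p ∂ν) ^ (1 / p)) ^ p := by gcongr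
    _ = ∫⁻ x, f x ^ p ∂ν := by
      rw [← ENNReal.rpow_mul, one_div, inv_mul_cancel₀ (by positivity), ENNReal.rpow_one]

theorem laverage_rpow_le {α : Type*} [MeasurableSpace α] (ν : Measure α) [IsFiniteMeasure ν]
    [NeZero ν] {f : α → ℝ≥0∞} (hf : AEMeasurable f ν) {p : ℝ} (hp : 1 ≤ p) :
    (⨍⁻ x, f x ∂ν) ^ p ≤ ⨍⁻ x, f x ^ p ∂ν := by
  have : IsProbabilityMeasure ((ν univ)⁻¹ • ν) := inferInstance
  exact lintegral_rpow_le_of_isProbabilityMeasure _ (hf.smul_measure _) hp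

/-! ### Cones and the cone condition -/

/-- `v` lies in the closed cone around the direction `e` whose boundary has slope `β`. -/
def InCone {d : ℕ} (β : ℝ) (e v : RSpace d) : Prop :=
  β * ‖v - (inner ℝ e v : ℝ) • e‖ ≤ inner ℝ e v

/-- Within the ball `B_R(x₀)`, the set `Ω` is stable under translations by vectors of the cone
around the unit vector `e`. -/
structure ConeCondition {d : ℕ} (Ω : Set (RSpace d)) (x₀ : RSpace d) (R β : ℝ) (e : RSpace d) :
    Prop where
  norm_eq : ‖e‖ = 1
  add_mem : ∀ x ∈ Ω, x ∈ Metric.ball x₀ R → ∀ v, InCone β e v → x + v ∈ Metric.ball x₀ R →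
    x + v ∈ Ω

section Cone

variable {d : ℕ} {Ω : Set (RSpace d)} {x₀ e : RSpace d} {R β : ℝ}

theorem norm_sub_inner_smul_le (he : ‖e‖ = 1) (z : RSpace d) :
    ‖z - (inner ℝ e z : ℝ) • e‖ ≤ ‖z‖ := by
  have h : ‖z - (inner ℝ e z : ℝ) • e‖ ^ 2 = ‖z‖ ^ 2 - (inner ℝ e z : ℝ) ^ 2 := by
    rw [norm_sub_sq_real, norm_smul, he, inner_smul_right, real_inner_comm]
    simp only [Real.norm_eq_abs, mul_one, sq_abs]
    ring
  refine le_of_sq_le_sq ?_ (norm_nonneg _)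
  rw [h]
  nlinarith [sq_nonneg (inner ℝ e z : ℝ)]

/-- The axial component is at least t − ‖z‖ ≥ β‖z‖, while the transversal component is at most ‖z‖.
Every later membership in the cone is produced from this criterion. -/
theorem inCone_smul_add (he : ‖e‖ = 1) (hβ : 0 ≤ β) {t : ℝ} {z : RSpace d}
    (h : (1 + β) * ‖z‖ ≤ t) : InCone β e (t • e + z) := by
  have hin : (inner ℝ e (t • e + z) : ℝ) = t + inner ℝ e z := by
    rw [inner_add_right, inner_smul_right, real_inner_self_eq_norm_sq, he]; ring
  have hz : -‖z‖ ≤ (inner ℝ e z : ℝ) := by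
    have := abs_real_inner_le_norm e z
    rw [he, one_mul] at this
    exact (abs_le.1 this).1
  unfold InCone
  rw [hin, show t • e + z - (t + (inner ℝ e z : ℝ)) • e = z - (inner ℝ e z : ℝ) • e by module]
  have := mul_le_mul_of_nonneg_left (norm_sub_inner_smul_le he z) hβ
  nlinarith

theorem InCone.smul {v : RSpace d} (h : InCone β e v) {t : ℝ} (ht : 0 ≤ t) :
    InCone β e (t • v) := by
  unfold InCone at *
  rw [inner_smul_right, mul_smul, ← smul_sub, norm_smul, Real.norm_of_nonneg ht]
  nlinarith [mul_le_mul_of_nonneg_left h ht]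

theorem ConeCondition.mono (h : ConeCondition Ω x₀ R β e) {r : ℝ} (hr : r ≤ R) :
    ConeCondition Ω x₀ r β e :=
  ⟨h.norm_eq, fun x hx hxr v hv hxv => h.add_mem x hx (Metric.ball_subset_ball hr hxr) v hv
    (Metric.ball_subset_ball hr hxv)⟩

theorem exists_coneCondition_of_ball_subset (hd : 2 ≤ d) (h : Metric.ball x₀ R ⊆ Ω) :
    ∃ e, ConeCondition Ω x₀ R β e :=
  ⟨EuclideanSpace.single ⟨0, by omega⟩ 1, by simp, fun _ _ _ _ _ hv => h hv⟩

/-- Moving by v raises the graph function by at most β|v'|, and a vector of the cone climbs at least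
that much along the axis. Hence a point above the graph stays above it. -/
theorem LipschitzBoundary.exists_coneCondition {R₀ : ℝ} (h : LipschitzBoundary Ω β R₀)
    (hx₀ : x₀ ∈ frontier Ω) (hR : 0 < R) (hR₀ : R ≤ R₀) :
    ∃ e, ConeCondition Ω x₀ R β e := by
  obtain ⟨e, φ, he, -, hΩ, hφ⟩ := h x₀ hx₀ R hR hR₀
  refine ⟨e, he, fun x hx hxR v hv hxv => ?_⟩
  set P := (ℝ ∙ e)ᗮ.orthogonalProjectionOnto
  have hball : ∀ y ∈ Metric.ball x₀ R, P y ∈ Metric.ball (P x₀) R := fun y hy => by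
    rw [mem_ball_iff_norm] at hy ⊢
    rw [← map_sub]
    exact ((ℝ ∙ e)ᗮ.norm_orthogonalProjectionOnto_apply_le _).trans_lt hy
  have hPv : ‖P v‖ = ‖v - (inner ℝ e v : ℝ) • e‖ := by
    change ‖(P v : RSpace d)‖ = _
    congr 1
    change (ℝ ∙ e)ᗮ.starProjection v = _
    rw [Submodule.starProjection_orthogonal_val, Submodule.starProjection_singleton, he]
    simp
  have h1 := hφ (P x) (hball x hxR) (P (x + v)) (hball _ hxv)
  rw [map_add, add_sub_cancel_left, hPv] at h1
  have h2 : x ∈ Ω ∩ Metric.ball x₀ R := ⟨hx, hxR⟩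
  rw [hΩ] at h2
  have h3 : x + v ∈ {x | x ∈ Metric.ball x₀ R ∧ φ (P x) < inner ℝ e x} := by
    refine ⟨hxv, ?_⟩
    rw [map_add, inner_add_right]
    have := h2.2
    have h4 := (abs_le.1 h1).2
    unfold InCone at hv
    linarith
  rw [← hΩ] at h3
  exact h3.1

/-- The radius, relative to `R`, of the ball from which the points of `Ω` near `x₀` are seen. -/
noncomputable def viewRadius (β : ℝ) : ℝ := 1 / (8 * (2 + β))

theorem viewRadius_pos (hβ : 0 ≤ β) : 0 < viewRadius β := by unfold viewRadius; positivity

/-- The centre of the ball from which the points of `Ω` near `x₀` are seen. -/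
noncomputable def viewCenter (x₀ e : RSpace d) (R β : ℝ) : RSpace d :=
  x₀ + ((1 + β) * (viewRadius β * R + R / (2 * (1 + β ^ 2)))) • e

/-- A ball inside `Ω` from which the points of `Ω` near `x₀` are seen. -/
def viewBall (x₀ e : RSpace d) (R β : ℝ) : Set (RSpace d) :=
  Metric.ball (viewCenter x₀ e R β) (viewRadius β * R)

theorem half_div_one_add_sq_le (hR : 0 ≤ R) : R / (2 * (1 + β ^ 2)) ≤ R / 2 := by
  apply div_le_div_of_nonneg_left hR <;> nlinarith [sq_nonneg β]

/-- The view radius is chosen so that (2 + β) times it is 1/8; the other part of the displacement is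
at most 5/8, because 4(1 + β) ≤ 5(1 + β²). -/
theorem viewBall_subset_ball (he : ‖e‖ = 1) (hβ : 0 ≤ β) (hR : 0 ≤ R) :
    viewBall x₀ e R β ⊆ Metric.ball x₀ (3 / 4 * R) := by
  apply Metric.ball_subset_ball'
  have hκ := viewRadius_pos hβ
  rw [viewCenter, dist_self_add_left, norm_smul, he, mul_one, Real.norm_of_nonneg (by positivity)]
  have h1 : (2 + β) * viewRadius β = 1 / 8 := by unfold viewRadius; field_simp
  have h2 : (1 + β) * (R / (2 * (1 + β ^ 2))) ≤ 5 / 8 * R := by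
    rw [← mul_div_assoc, div_le_iff₀ (by positivity)]
    nlinarith [mul_nonneg hR (sq_nonneg (β - 2 / 5)), mul_nonneg hR (sq_nonneg β)]
  calc viewRadius β * R + (1 + β) * (viewRadius β * R + R / (2 * (1 + β ^ 2)))
      = (2 + β) * viewRadius β * R + (1 + β) * (R / (2 * (1 + β ^ 2))) := by ring
    _ ≤ 1 / 8 * R + 5 / 8 * R := by rw [h1]; gcongr
    _ = 3 / 4 * R := by ring

/-- The view centre is lifted along `e` by 1 + β times the sum of the two radii. So y − x is that
multiple of `e` plus an error no longer than the sum, hence in the cone; its multiples by t keep x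
inside Ω, and convexity keeps the segment in the ball. -/
theorem ConeCondition.segment_mem (h : ConeCondition Ω x₀ R β e) (hβ : 0 ≤ β) (hR : 0 < R)
    {x y : RSpace d} (hx : x ∈ Ω ∩ Metric.ball x₀ (R / (2 * (1 + β ^ 2))))
    (hy : y ∈ viewBall x₀ e R β) {t : ℝ} (ht : t ∈ Icc (0 : ℝ) 1) :
    x + t • (y - x) ∈ Ω ∩ Metric.ball x₀ (3 / 4 * R) := by
  have hκ := viewRadius_pos hβ
  have hxR : x ∈ Metric.ball x₀ (3 / 4 * R) :=
    Metric.ball_subset_ball ((half_div_one_add_sq_le hR.le).trans (by linarith)) hx.2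
  have hseg : x + t • (y - x) ∈ Metric.ball x₀ (3 / 4 * R) :=
    (convex_ball x₀ _).add_smul_sub_mem hxR (viewBall_subset_ball h.norm_eq hβ hR.le hy) ht
  have hsub : Metric.ball x₀ (3 / 4 * R) ⊆ Metric.ball x₀ R :=
    Metric.ball_subset_ball (by linarith)
  refine ⟨h.add_mem x hx.1 (hsub hxR) _ (InCone.smul ?_ ht.1) (hsub hseg), hseg⟩
  set τ := (1 + β) * (viewRadius β * R + R / (2 * (1 + β ^ 2))) with hτ
  have : y - x = τ • e + ((y - viewCenter x₀ e R β) - (x - x₀)) := by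
    rw [viewCenter]; module
  rw [this]
  apply inCone_smul_add h.norm_eq hβ
  rw [hτ]
  gcongr
  refine (norm_sub_le _ _).trans (add_le_add ?_ ?_)
  · exact (mem_ball_iff_norm.1 hy).le
  · exact (mem_ball_iff_norm.1 hx.2).le

theorem ConeCondition.viewBall_subset (h : ConeCondition Ω x₀ R β e) (hβ : 0 ≤ β) (hR : 0 < R)
    (hx₀ : x₀ ∈ closure Ω) : viewBall x₀ e R β ⊆ Ω ∩ Metric.ball x₀ (3 / 4 * R) := by
  obtain ⟨x, hx, hx'⟩ := Metric.mem_closure_iff.1 hx₀ (R / (2 * (1 + β ^ 2))) (by positivity)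
  intro y hy
  have := h.segment_mem hβ hR (x := x) (y := y) ⟨hx, by rwa [Metric.mem_ball, dist_comm]⟩ hy
    (t := 1) (by simp)
  simpa using this

end Cone

theorem volume_ball_le_mul_volume_viewBall {d : ℕ} (x₀ e : RSpace d) {R β : ℝ} (hβ : 0 ≤ β) :
    volume (Metric.ball x₀ R) ≤
      ENNReal.ofReal ((viewRadius β)⁻¹ ^ d) * volume (viewBall x₀ e R β) := by
  have hκ := viewRadius_pos hβ
  rw [viewBall, Measure.addHaar_ball_mul_of_pos _ _ hκ, ← mul_assoc, finrank_euclideanSpace_fin,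
    ← ENNReal.ofReal_mul (by positivity), ← mul_pow, inv_mul_cancel₀ hκ.ne', one_pow,
    ENNReal.ofReal_one, one_mul, Measure.addHaar_ball_center, Measure.addHaar_ball_center]

/-! ### Approximation by smooth functions up to the boundary -/

section Approximation

open Filter Topology Metric
open scoped Convolution

/-- Averaging over translations does not increase an L^p norm: Jensen, then Tonelli, then
translation invariance. Only translations that carry `S'` into `S` occur. -/
theorem lintegral_lintegral_sub_rpow_le {d : ℕ} (ν : Measure (RSpace d)) [IsProbabilityMeasure ν]
    {S S' : Set (RSpace d)} (hS : MeasurableSet S)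
    (h : ∀ᵐ z ∂ν, ∀ x ∈ S', x - z ∈ S) {f : RSpace d → ℝ≥0∞} (hf : Measurable f)
    {p : ℝ} (hp : 1 ≤ p) :
    ∫⁻ x in S', (∫⁻ z, f (x - z) ∂ν) ^ p ≤ ∫⁻ x in S, f x ^ p := by
  calc ∫⁻ x in S', (∫⁻ z, f (x - z) ∂ν) ^ p
      ≤ ∫⁻ x in S', ∫⁻ z, f (x - z) ^ p ∂ν := by
        gcongr with x
        exact lintegral_rpow_le_of_isProbabilityMeasure ν (by fun_prop) hp
    _ = ∫⁻ z, (∫⁻ x in S', f (x - z) ^ p) ∂ν :=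
        lintegral_lintegral_swap (Measurable.aemeasurable (by fun_prop))
    _ ≤ ∫⁻ _z, (∫⁻ x in S, f x ^ p) ∂ν := by
        apply lintegral_mono_ae
        filter_upwards [h] with z hz
        calc ∫⁻ x in S', f (x - z) ^ p
            ≤ ∫⁻ x in (fun x => x - z) ⁻¹' S, f (x - z) ^ p := lintegral_mono_set hz
          _ = ∫⁻ x in S, f x ^ p :=
              (measurePreserving_sub_right volume z).setLIntegral_comp_preimage hS
                (f := fun x => f x ^ p) (by fun_prop)
    _ = ∫⁻ x in S, f x ^ p := by simp

variable {d : ℕ} {Ω : Set (RSpace d)} {x₀ e : RSpace d} {R R' β : ℝ}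

/-- A bump function of radius `ε` in the cone of direction `-e`. -/
noncomputable def shiftedBump (β : ℝ) (e : RSpace d) (ε : ℝ) (hε : 0 < ε) :
    ContDiffBump (-(((1 + β) * ε) • e)) where
  rIn := ε / 2
  rOut := ε
  rIn_pos := by positivity
  rIn_lt_rOut := by linarith

/-- Convolution of `u` with the shifted bump function. -/
noncomputable def shiftedMollify (β : ℝ) (e : RSpace d) (ε : ℝ) (hε : 0 < ε) (u : RSpace d → ℝ) :
    RSpace d → ℝ :=
  (shiftedBump β e ε hε).normed volume ⋆[ContinuousLinearMap.lsmul ℝ ℝ, volume] u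

/-- Points z of the support of the bump satisfy −z = (1 + β)ε e + z' with |z'| ≤ ε, a cone vector of
length at most (2 + β)ε. Mollifying near ∂Ω therefore needs no extension of u. -/
theorem ConeCondition.sub_mem (h : ConeCondition Ω x₀ R β e) (hβ : 0 ≤ β) {ε : ℝ}
    (hε : R' + (2 + β) * ε < R) {x z : RSpace d} (hε0 : 0 < ε)
    (hx : x ∈ Ω ∩ ball x₀ R') (hz : z ∈ closedBall (-(((1 + β) * ε) • e)) ε) :
    x - z ∈ Ω ∩ ball x₀ R := by
  set z' := -((((1 + β) * ε) • e) + z) with hz'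
  have hzn : ‖z'‖ ≤ ε := by
    rw [mem_closedBall_iff_norm] at hz
    have hzz : z' = -(z - -(((1 + β) * ε) • e)) := by rw [hz']; module
    rwa [hzz, norm_neg]
  have hxz : x - z = x + (((1 + β) * ε) • e + z') := by rw [hz']; module
  have hxR := mem_ball_iff_norm.1 hx.2
  have hball : x - z ∈ ball x₀ R := by
    rw [mem_ball_iff_norm, hxz]
    calc ‖x + (((1 + β) * ε) • e + z') - x₀‖
        = ‖(x - x₀) + (((1 + β) * ε) • e + z')‖ := by congr 1; module
      _ ≤ ‖x - x₀‖ + (‖((1 + β) * ε) • e‖ + ‖z'‖) :=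
        (norm_add_le _ _).trans (by gcongr; exact norm_add_le _ _)
      _ = ‖x - x₀‖ + ((1 + β) * ε + ‖z'‖) := by
        rw [norm_smul, h.norm_eq, mul_one, Real.norm_of_nonneg (by positivity)]
      _ < R := by linarith
  refine ⟨?_, hball⟩
  rw [hxz] at hball ⊢
  have hR'R : R' ≤ R := by nlinarith
  exact h.add_mem x hx.1 (ball_subset_ball hR'R hx.2) _
    (inCone_smul_add h.norm_eq hβ (by gcongr)) hball

/-- The probability measure whose density is the shifted bump function. -/
noncomputable def shiftedMeasure (β : ℝ) (e : RSpace d) (ε : ℝ) (hε : 0 < ε) :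
    Measure (RSpace d) :=
  volume.withDensity fun z => ENNReal.ofReal ((shiftedBump β e ε hε).normed volume z)

instance (ε : ℝ) (hε : 0 < ε) : IsProbabilityMeasure (shiftedMeasure β e ε hε) := by
  constructor
  rw [shiftedMeasure, withDensity_apply _ MeasurableSet.univ, Measure.restrict_univ,
    ← ofReal_integral_eq_lintegral_ofReal (ContDiffBump.integrable_normed _)
      (ae_of_all _ fun z => ContDiffBump.nonneg_normed _ z), ContDiffBump.integral_normed,
    ENNReal.ofReal_one]

theorem ae_shiftedMeasure_mem {ε : ℝ} (hε : 0 < ε) :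
    ∀ᵐ z ∂(shiftedMeasure β e ε hε), z ∈ closedBall (-(((1 + β) * ε) • e)) ε := by
  rw [shiftedMeasure, ae_withDensity_iff (by
    exact (ContDiffBump.continuous_normed _).measurable.ennreal_ofReal)]
  refine ae_of_all _ fun z hz => ?_
  by_contra hzb
  apply hz
  have : z ∉ Function.support ((shiftedBump β e ε hε).normed volume) := by
    rw [ContDiffBump.support_normed_eq]
    exact fun h => hzb (ball_subset_closedBall h)
  rw [Function.notMem_support.1 this, ENNReal.ofReal_zero]

theorem enorm_integral_shiftedBump_smul_le {F : Type*} [NormedAddCommGroup F] [NormedSpace ℝ F]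
    {ε : ℝ} (hε : 0 < ε) (f : RSpace d → F) :
    ‖∫ z, (shiftedBump β e ε hε).normed volume z • f z‖ₑ ≤
      ∫⁻ z, ‖f z‖ₑ ∂(shiftedMeasure β e ε hε) := by
  refine (enorm_integral_le_lintegral_enorm _).trans ?_
  rw [shiftedMeasure, lintegral_withDensity_eq_lintegral_mul_non_measurable _
    (ContDiffBump.continuous_normed _).measurable.ennreal_ofReal
    (ae_of_all _ fun _ => ENNReal.ofReal_lt_top)]
  gcongr with z
  rw [enorm_smul, Real.enorm_of_nonneg (ContDiffBump.nonneg_normed _ _)]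
  rfl

theorem contDiff_shiftedMollify {ε : ℝ} (hε : 0 < ε) {u : RSpace d → ℝ}
    (hu : LocallyIntegrable u volume) : ContDiff ℝ 1 (shiftedMollify β e ε hε u) :=
  (ContDiffBump.hasCompactSupport_normed _).contDiff_convolution_left (n := 1) _
    (ContDiffBump.contDiff_normed _) hu

theorem fderiv_shiftedMollify_apply {ε : ℝ} (hε : 0 < ε) {u : RSpace d → ℝ}
    (hu : LocallyIntegrable u volume) (x w : RSpace d) :
    fderiv ℝ (shiftedMollify β e ε hε u) x w =
      ∫ y, u y * fderiv ℝ ((shiftedBump β e ε hε).normed volume) (x - y) w := by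
  have hc := (shiftedBump β e ε hε).hasCompactSupport_normed (μ := volume)
  have hs : ContDiff ℝ 1 ((shiftedBump β e ε hε).normed volume) := ContDiffBump.contDiff_normed _
  rw [shiftedMollify, (hc.hasFDerivAt_convolution_left _ hs hu x).fderiv, convolution_eq_swap,
    ContinuousLinearMap.integral_apply]
  · simp [ContinuousLinearMap.precompL_apply, mul_comm]
  · have := ((hc.fderiv ℝ).convolutionExists_left
      ((ContinuousLinearMap.lsmul ℝ ℝ : ℝ →L[ℝ] ℝ →L[ℝ] ℝ).precompL (RSpace d))
      (hs.continuous_fderiv one_ne_zero) hu x).integrable_swap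
    exact this

/-- The kernel has integral 1, so subtracting a constant commutes with mollification; on its support
the extension of u by zero is u itself. -/
theorem ConeCondition.enorm_shiftedMollify_sub_le (h : ConeCondition Ω x₀ R β e) (hβ : 0 ≤ β)
    {ε : ℝ} (hε : R' + (2 + β) * ε < R) (hε0 : 0 < ε) {u : RSpace d → ℝ} (hu : IntegrableOn u Ω)
    (hΩ : IsOpen Ω) (c : ℝ) {x : RSpace d} (hx : x ∈ Ω ∩ ball x₀ R') :
    ‖shiftedMollify β e ε hε0 (Ω.indicator u) x - c‖ₑ ≤
      ∫⁻ z, ‖u (x - z) - c‖ₑ ∂(shiftedMeasure β e ε hε0) := by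
  have hui : LocallyIntegrable (Ω.indicator u) volume :=
    ((integrable_indicator_iff hΩ.measurableSet).2 hu).locallyIntegrable
  have hint : Integrable
      (fun z => (shiftedBump β e ε hε0).normed volume z • Ω.indicator u (x - z)) := ((ContDiffBump.hasCompactSupport_normed (μ := volume)
    (shiftedBump β e ε hε0)).convolutionExists_left
      (ContinuousLinearMap.lsmul ℝ ℝ : ℝ →L[ℝ] ℝ →L[ℝ] ℝ)
      (ContDiffBump.continuous_normed _) hui x).integrable
  have : shiftedMollify β e ε hε0 (Ω.indicator u) x - c =
      ∫ z, (shiftedBump β e ε hε0).normed volume z • (Ω.indicator u (x - z) - c) := by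
    simp_rw [smul_sub]
    rw [integral_sub hint ((ContDiffBump.integrable_normed _).smul_const c),
      ContDiffBump.integral_normed_smul]
    rfl
  rw [this]
  refine (enorm_integral_shiftedBump_smul_le hε0 _).trans (le_of_eq (lintegral_congr_ae ?_))
  filter_upwards [ae_shiftedMeasure_mem hε0] with z hz
  rw [indicator_of_mem (h.sub_mem hβ hε hε0 hx hz).1]

/-- The function y ↦ k(x − y) has compact support inside Ω even for x near ∂Ω, so it is an
admissible test function for the weak gradient. Hence the gradient of the mollification is the
mollification of Du. -/
theorem ConeCondition.enorm_fderiv_shiftedMollify_le (h : ConeCondition Ω x₀ R β e) (hβ : 0 ≤ β)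
    {ε : ℝ} (hε : R' + (2 + β) * ε < R) (hε0 : 0 < ε) {u : RSpace d → ℝ} {Du : RSpace d → RSpace d}
    (hu : IntegrableOn u Ω) (hDu : IntegrableOn Du Ω) (hw : IsWeakGradient Ω u Du)
    (hΩ : IsOpen Ω) {x : RSpace d} (hx : x ∈ Ω ∩ ball x₀ R') :
    ‖fderiv ℝ (shiftedMollify β e ε hε0 (Ω.indicator u)) x‖ₑ ≤
      ∫⁻ z, ‖Du (x - z)‖ₑ ∂(shiftedMeasure β e ε hε0) := by
  have hui : LocallyIntegrable (Ω.indicator u) volume :=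
    ((integrable_indicator_iff hΩ.measurableSet).2 hu).locallyIntegrable
  have hDui : LocallyIntegrable (Ω.indicator Du) volume :=
    ((integrable_indicator_iff hΩ.measurableSet).2 hDu).locallyIntegrable
  set k := (shiftedBump β e ε hε0).normed volume with hk
  have hkc : HasCompactSupport k := ContDiffBump.hasCompactSupport_normed _
  have hks : ContDiff ℝ ∞ k := ContDiffBump.contDiff_normed _
  set G := ∫ z, k z • Ω.indicator Du (x - z) with hG
  have hint : Integrable (fun z => k z • Ω.indicator Du (x - z)) :=
    (hkc.convolutionExists_left (ContinuousLinearMap.lsmul ℝ ℝ : ℝ →L[ℝ] RSpace d →L[ℝ] RSpace d)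
      hks.continuous hDui x).integrable
  have hφc : HasCompactSupport fun y => k (x - y) :=
    hkc.comp_homeomorph (Homeomorph.subLeft x)
  have hφs : ContDiff ℝ ∞ fun y => k (x - y) := hks.comp (contDiff_const.sub contDiff_id)
  have hφΩ : tsupport (fun y => k (x - y)) ⊆ Ω := by
    intro y hy
    have h1 : x - y ∈ tsupport k :=
      tsupport_comp_subset_preimage k (f := fun y => x - y) (by fun_prop) hy
    rw [hk, ContDiffBump.tsupport_normed_eq] at h1
    simpa using (h.sub_mem hβ hε hε0 hx h1).1
  have hderiv : ∀ y w, fderiv ℝ (fun y => k (x - y)) y w = - fderiv ℝ k (x - y) w := by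
    intro y w
    have := ((hks.differentiable (by simp) (x - y)).hasFDerivAt.comp y
      ((hasFDerivAt_const x y).sub (hasFDerivAt_id y))).fderiv
    change fderiv ℝ (fun y => k (x - y)) y = _ at this
    rw [this]
    simp
  have hcoord : ∀ i, fderiv ℝ (shiftedMollify β e ε hε0 (Ω.indicator u)) x
      (EuclideanSpace.single i 1) = G i := by
    intro i
    have h1 := hw _ hφs hφc hφΩ i
    simp_rw [hderiv, mul_neg, integral_neg, neg_inj] at h1
    have h2 : G i = ∫ z, k z * Ω.indicator Du (x - z) i := by
      rw [hG]
      exact ((EuclideanSpace.proj i : RSpace d →L[ℝ] ℝ).integral_comp_comm hint).symm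
    rw [fderiv_shiftedMollify_apply hε0 hui, h2,
      ← integral_sub_left_eq_self (fun z => k z * Ω.indicator Du (x - z) i) volume x]
    simp_rw [sub_sub_cancel]
    convert h1 using 1
    · rw [← integral_indicator hΩ.measurableSet]
      congr 1 with y
      by_cases hy : y ∈ Ω <;> simp [hy, hk]
    · rw [← integral_indicator hΩ.measurableSet]
      congr 1 with y
      by_cases hy : y ∈ Ω <;> simp [hy, mul_comm]
  have hfd : fderiv ℝ (shiftedMollify β e ε hε0 (Ω.indicator u)) x = innerSL ℝ G := by
    apply ContinuousLinearMap.coe_injective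
    apply (EuclideanSpace.basisFun (Fin d) ℝ).toBasis.ext
    intro i
    simp [hcoord, EuclideanSpace.inner_single_right]
  have hn : ‖fderiv ℝ (shiftedMollify β e ε hε0 (Ω.indicator u)) x‖ₑ = ‖G‖ₑ := by
    rw [hfd, ← ofReal_norm, innerSL_apply_norm, ofReal_norm]
  rw [hn]
  refine (enorm_integral_shiftedBump_smul_le hε0 _).trans (le_of_eq (lintegral_congr_ae ?_))
  filter_upwards [ae_shiftedMeasure_mem hε0] with z hz
  rw [indicator_of_mem (h.sub_mem hβ hε hε0 hx hz).1]

/-- The averages run over balls of radius ε centred at distance (1 + β)ε from x. Lebesgue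
differentiation allows such off-centre balls because x stays within a fixed multiple of the radius
from the centre. -/
theorem ae_tendsto_shiftedMollify (hβ : 0 ≤ β) (he : ‖e‖ = 1) {u : RSpace d → ℝ}
    (hu : LocallyIntegrable u volume) {ε : ℕ → ℝ} (hε : ∀ n, 0 < ε n)
    (hε' : Tendsto ε atTop (𝓝 0)) :
    ∀ᵐ x, Tendsto (fun n => shiftedMollify β e (ε n) (hε n) u x) atTop (𝓝 (u x)) := by
  filter_upwards [IsUnifLocDoublingMeasure.ae_tendsto_average_norm_sub volume hu (2 + β)]
    with x hx
  have h1 := hx (fun n => x + ((1 + β) * ε n) • e) ε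
    (tendsto_nhdsWithin_iff.2 ⟨hε', Eventually.of_forall hε⟩) (Eventually.of_forall fun n => by
      rw [mem_closedBall, dist_self_add_right, norm_smul, he, mul_one,
        Real.norm_of_nonneg (by have := hε n; positivity)]
      nlinarith [hε n])
  simp only [shiftedMollify, convolution_eq_swap, ContinuousLinearMap.lsmul_apply]
  apply tendsto_integral_smul_of_tendsto_average_norm_sub (2 ^ (Module.finrank ℝ (RSpace d))) h1
  · filter_upwards with i using hu.integrableOn_isCompact (isCompact_closedBall _ _)
  · apply tendsto_const_nhds.congr (fun i ↦ ?_)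
    rw [integral_sub_left_eq_self (fun z => (shiftedBump β e (ε i) (hε i)).normed volume z),
      ContDiffBump.integral_normed]
  · filter_upwards with i
    intro y hy
    have : x - y ∈ Function.support ((shiftedBump β e (ε i) (hε i)).normed volume) := hy
    rw [ContDiffBump.support_normed_eq, mem_ball_iff_norm] at this
    rw [mem_closedBall_iff_norm, ← norm_neg]
    refine le_trans (le_of_eq ?_) this.le
    congr 1
    module
  · filter_upwards with i y
    rw [abs_of_nonneg (ContDiffBump.nonneg_normed _ _)]
    refine (ContDiffBump.normed_le_div_measure_closedBall_rOut _ _ 2 ?_ _).trans (le_of_eq ?_)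
    · exact (mul_div_cancel₀ (ε i) two_ne_zero).ge
    · rw [Measure.addHaar_real_closedBall_center, Measure.addHaar_real_closedBall_center volume (x + _)]
      rfl

/-- Under the cone condition, weakly differentiable functions are almost everywhere limits of
functions of class `C¹` whose `L^p` norms, and those of the gradients, are controlled. -/
theorem ConeCondition.exists_smooth_approx (h : ConeCondition Ω x₀ R β e) (hβ : 0 ≤ β)
    (hΩ : IsOpen Ω) {u : RSpace d → ℝ} {Du : RSpace d → RSpace d} (hum : Measurable u)
    (hDum : Measurable Du) (hu : IntegrableOn u Ω) (hDu : IntegrableOn Du Ω)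
    (hw : IsWeakGradient Ω u Du) (hR : R' < R) :
    ∃ v : ℕ → RSpace d → ℝ, (∀ n, ContDiff ℝ 1 (v n)) ∧
      (∀ᵐ x ∂volume.restrict (Ω ∩ ball x₀ R'), Tendsto (fun n => v n x) atTop (𝓝 (u x))) ∧
      ∀ n, ∀ p : ℝ, 1 ≤ p →
        (∀ c, ∫⁻ x in Ω ∩ ball x₀ R', ‖v n x - c‖ₑ ^ p ≤ ∫⁻ x in Ω ∩ ball x₀ R, ‖u x - c‖ₑ ^ p) ∧
        ∫⁻ x in Ω ∩ ball x₀ R', ‖fderiv ℝ (v n) x‖ₑ ^ p ≤ ∫⁻ x in Ω ∩ ball x₀ R, ‖Du x‖ₑ ^ p := by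
  have hui : LocallyIntegrable (Ω.indicator u) volume :=
    ((integrable_indicator_iff hΩ.measurableSet).2 hu).locallyIntegrable
  set a := (R - R') / (2 + β) with ha
  have ha0 : 0 < a := div_pos (by linarith) (by linarith)
  -- The shift 2 in the denominator makes every ε n strictly smaller than a, as the strict
  -- inequality below requires.
  let ε : ℕ → ℝ := fun n => a * (1 / ((n : ℝ) + 2))
  have hε0 : ∀ n, 0 < ε n := fun n => by positivity
  have hεlim : Tendsto ε atTop (𝓝 0) := by
    have := ((tendsto_const_div_atTop_nhds_zero_nat (1 : ℝ)).comp (tendsto_add_atTop_nat 2)).const_mul a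
    simpa [ε, Function.comp_def] using this
  have hεlt : ∀ n, R' + (2 + β) * ε n < R := fun n => by
    have h1 : (1 : ℝ) / ((n : ℝ) + 2) < 1 := by
      rw [div_lt_one (by positivity)]
      have : (0 : ℝ) ≤ n := n.cast_nonneg
      linarith
    have h2 : (2 + β) * a = R - R' := by rw [ha]; field_simp
    calc R' + (2 + β) * ε n = R' + (R - R') * (1 / ((n : ℝ) + 2)) := by
          rw [← h2]; simp only [ε]; ring
      _ < R := by nlinarith
  have hS : MeasurableSet (Ω ∩ ball x₀ R) := (hΩ.inter isOpen_ball).measurableSet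
  have hS' : MeasurableSet (Ω ∩ ball x₀ R') := (hΩ.inter isOpen_ball).measurableSet
  have hν : ∀ n, ∀ᵐ z ∂(shiftedMeasure β e (ε n) (hε0 n)), ∀ x ∈ Ω ∩ ball x₀ R',
      x - z ∈ Ω ∩ ball x₀ R := fun n => by
    filter_upwards [ae_shiftedMeasure_mem (hε0 n)] with z hz x hx
    exact h.sub_mem hβ (hεlt n) (hε0 n) hx hz
  refine ⟨fun n => shiftedMollify β e (ε n) (hε0 n) (Ω.indicator u),
    fun n => contDiff_shiftedMollify _ hui, ?_, fun n p hp => ⟨fun c => ?_, ?_⟩⟩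
  · filter_upwards [ae_restrict_of_ae (ae_tendsto_shiftedMollify hβ h.norm_eq hui hε0 hεlim),
      ae_restrict_mem hS'] with x hx hxS
    rwa [indicator_of_mem hxS.1] at hx
  · refine le_trans (setLIntegral_mono' hS' fun x hx => ?_)
      (lintegral_lintegral_sub_rpow_le _ hS (hν n) (f := fun x => ‖u x - c‖ₑ) (by fun_prop) hp)
    gcongr
    exact h.enorm_shiftedMollify_sub_le hβ (hεlt n) (hε0 n) hu hΩ c hx
  · refine le_trans (setLIntegral_mono' hS' fun x hx => ?_)
      (lintegral_lintegral_sub_rpow_le _ hS (hν n) (f := fun x => ‖Du x‖ₑ) (by fun_prop) hp)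
    gcongr
    exact h.enorm_fderiv_shiftedMollify_le hβ (hεlt n) (hε0 n) hu hDu hw hΩ hx

end Approximation

/-! ### Poincaré's inequality -/

section Poincare

open Filter Topology Metric

variable {d : ℕ}

theorem lintegral_comp_add_smul (f : RSpace d → ℝ≥0∞) (hf : Measurable f) (a : RSpace d) {t : ℝ}
    (ht : t ≠ 0) : ∫⁻ y, f (a + t • y) = ENNReal.ofReal |(t ^ d)⁻¹| * ∫⁻ y, f y := by
  have h1 : ∫⁻ y, f (a + t • y) = ∫⁻ y, f (a + y) ∂(Measure.map (t • ·) volume) := by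
    rw [lintegral_map (by fun_prop) (by fun_prop)]
  rw [h1, Measure.map_addHaar_smul _ ht, lintegral_smul_measure, lintegral_add_left_eq_self,
    finrank_euclideanSpace_fin, smul_eq_mul]

theorem lintegral_comp_add_smul_le (f : RSpace d → ℝ≥0∞) (hf : Measurable f) (a : RSpace d) {t : ℝ}
    (ht : 1 / 2 ≤ t) : ∫⁻ y, f (a + t • y) ≤ 2 ^ d * ∫⁻ y, f y := by
  rw [lintegral_comp_add_smul f hf a (by positivity)]
  gcongr
  rw [abs_of_nonneg (by positivity), ← inv_pow, ENNReal.ofReal_pow (by positivity)]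
  gcongr
  rw [← ENNReal.ofReal_ofNat 2]
  apply ENNReal.ofReal_le_ofReal
  rw [inv_le_comm₀ (by positivity) (by positivity)]
  linarith

/-- The substitution y ↦ x + t(y − x) has Jacobian t^d and x ↦ x + t(y − x) has Jacobian (1 − t)^d.
One of t and 1 − t is at least 1/2, so integrating first in the corresponding variable costs at most
2^d. -/
theorem lintegral_lintegral_segment_le (G : RSpace d → ℝ≥0∞) (hG : Measurable G)
    (S B : Set (RSpace d)) {t : ℝ} :
    ∫⁻ x in S, ∫⁻ y in B, G (x + t • (y - x)) ≤
      2 ^ d * max (volume S) (volume B) * ∫⁻ y, G y := by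
  rcases le_total (1 / 2) t with ht | ht
  · calc ∫⁻ x in S, ∫⁻ y in B, G (x + t • (y - x))
        ≤ ∫⁻ x in S, ∫⁻ y, G ((x - t • x) + t • y) := by
          refine lintegral_mono fun x => ?_
          refine (lintegral_mono' Measure.restrict_le_self le_rfl).trans
            (le_of_eq (lintegral_congr fun y => ?_))
          congr 1
          module
      _ ≤ ∫⁻ _x in S, 2 ^ d * ∫⁻ y, G y := by
          gcongr with x
          exact lintegral_comp_add_smul_le G hG _ ht
      _ = 2 ^ d * volume S * ∫⁻ y, G y := by
          rw [setLIntegral_const]; ring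
      _ ≤ _ := by gcongr; exact le_max_left _ _
  · calc ∫⁻ x in S, ∫⁻ y in B, G (x + t • (y - x))
        = ∫⁻ y in B, ∫⁻ x in S, G (x + t • (y - x)) :=
          lintegral_lintegral_swap (Measurable.aemeasurable (by fun_prop))
      _ ≤ ∫⁻ y in B, ∫⁻ x, G (t • y + (1 - t) • x) := by
          refine lintegral_mono fun y => ?_
          refine (lintegral_mono' Measure.restrict_le_self le_rfl).trans
            (le_of_eq (lintegral_congr fun x => ?_))
          congr 1
          module
      _ ≤ ∫⁻ _y in B, 2 ^ d * ∫⁻ x, G x := by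
          gcongr with y
          exact lintegral_comp_add_smul_le G hG _ (by linarith)
      _ = 2 ^ d * volume B * ∫⁻ y, G y := by
          rw [setLIntegral_const]; ring
      _ ≤ _ := by gcongr; exact le_max_right _ _

theorem enorm_sub_le_lintegral_segment {v : RSpace d → ℝ} (hv : ContDiff ℝ 1 v) (x y : RSpace d) :
    ‖v x - v y‖ₑ ≤ ‖y - x‖ₑ * ∫⁻ t in Ioc (0 : ℝ) 1, ‖fderiv ℝ v (x + t • (y - x))‖ₑ := by
  have hd : ∀ t : ℝ, HasDerivAt (fun t : ℝ => v (x + t • (y - x)))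
      (fderiv ℝ v (x + t • (y - x)) (y - x)) t := fun t => by
    have h1 : HasDerivAt (fun t : ℝ => x + t • (y - x)) (y - x) t := by
      simpa using ((hasDerivAt_id t).smul_const (y - x)).const_add x
    exact (hv.differentiable one_ne_zero _).hasFDerivAt.comp_hasDerivAt t h1
  have hcf := hv.continuous_fderiv one_ne_zero
  have hcont : Continuous fun t : ℝ => fderiv ℝ v (x + t • (y - x)) (y - x) :=
    (hcf.comp (by fun_prop)).clm_apply continuous_const
  have hint := intervalIntegral.integral_eq_sub_of_hasDerivAt (a := 0) (b := 1) (fun t _ => hd t)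
    (hcont.intervalIntegrable _ _)
  simp only [one_smul, add_sub_cancel, zero_smul, add_zero] at hint
  rw [← enorm_neg, neg_sub, ← hint, intervalIntegral.integral_of_le zero_le_one]
  refine (enorm_integral_le_lintegral_enorm _).trans ?_
  rw [← lintegral_const_mul' _ _ enorm_ne_top]
  gcongr with t
  rw [mul_comm]
  exact ContinuousLinearMap.le_opENorm _ _

/-- The difference v(x) − v(y) is the integral of the derivative along the segment, of length at
most 2R. Jensen in t and Tonelli leave, for each t, the double integral over segment points. -/
theorem lintegral_lintegral_sub_rpow_le_of_segment {S S' B : Set (RSpace d)} {x₀ : RSpace d}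
    {R : ℝ} (hS : MeasurableSet S) (hS' : MeasurableSet S') (hB : MeasurableSet B)
    (hS'R : S' ⊆ ball x₀ R) (hBR : B ⊆ ball x₀ R)
    (hseg : ∀ x ∈ S', ∀ y ∈ B, ∀ t ∈ Icc (0 : ℝ) 1, x + t • (y - x) ∈ S)
    {v : RSpace d → ℝ} (hv : ContDiff ℝ 1 v) {p : ℝ} (hp : 1 ≤ p) :
    ∫⁻ x in S', ∫⁻ y in B, ‖v x - v y‖ₑ ^ p ≤
      ENNReal.ofReal (2 * R) ^ p * (2 ^ d * volume (ball x₀ R)) *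
        ∫⁻ x in S, ‖fderiv ℝ v x‖ₑ ^ p := by
  have hcf := hv.continuous_fderiv one_ne_zero
  have hp0 : 0 ≤ p := by linarith
  set G : RSpace d → ℝ≥0∞ := S.indicator fun x => ‖fderiv ℝ v x‖ₑ ^ p with hG
  have hGm : Measurable G := Measurable.indicator (by fun_prop) hS
  have hprob : IsProbabilityMeasure (volume.restrict (Ioc (0 : ℝ) 1)) := ⟨by simp⟩
  have hpt : ∀ x ∈ S', ∀ y ∈ B, ‖v x - v y‖ₑ ^ p ≤
      ENNReal.ofReal (2 * R) ^ p * ∫⁻ t in Ioc (0 : ℝ) 1, G (x + t • (y - x)) := by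
    intro x hx y hy
    have hdist : ‖y - x‖ₑ ≤ ENNReal.ofReal (2 * R) := by
      rw [← ofReal_norm]
      apply ENNReal.ofReal_le_ofReal
      have h1 := mem_ball_iff_norm.1 (hS'R hx)
      have h2 := mem_ball_iff_norm.1 (hBR hy)
      calc ‖y - x‖ = ‖(y - x₀) - (x - x₀)‖ := by congr 1; module
        _ ≤ ‖y - x₀‖ + ‖x - x₀‖ := norm_sub_le _ _
        _ ≤ 2 * R := by linarith
    calc ‖v x - v y‖ₑ ^ p
        ≤ (ENNReal.ofReal (2 * R) *
            ∫⁻ t in Ioc (0 : ℝ) 1, ‖fderiv ℝ v (x + t • (y - x))‖ₑ) ^ p := by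
          gcongr
          refine (enorm_sub_le_lintegral_segment hv x y).trans ?_
          gcongr
      _ ≤ ENNReal.ofReal (2 * R) ^ p *
            ∫⁻ t in Ioc (0 : ℝ) 1, ‖fderiv ℝ v (x + t • (y - x))‖ₑ ^ p := by
          rw [ENNReal.mul_rpow_of_nonneg _ _ hp0]
          gcongr
          have hc2 : Continuous fun t : ℝ => fderiv ℝ v (x + t • (y - x)) :=
            hcf.comp (by fun_prop)
          exact lintegral_rpow_le_of_isProbabilityMeasure _ hc2.enorm.measurable.aemeasurable hp
      _ = _ := by
          congr 1
          refine setLIntegral_congr_fun measurableSet_Ioc fun t ht => ?_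
          rw [hG, indicator_of_mem (hseg x hx y hy t (Ioc_subset_Icc_self ht))]
  calc ∫⁻ x in S', ∫⁻ y in B, ‖v x - v y‖ₑ ^ p
      ≤ ∫⁻ x in S', ∫⁻ y in B, ENNReal.ofReal (2 * R) ^ p *
          ∫⁻ t in Ioc (0 : ℝ) 1, G (x + t • (y - x)) :=
        setLIntegral_mono' hS' fun x hx => setLIntegral_mono' hB fun y hy => hpt x hx y hy
    _ = ENNReal.ofReal (2 * R) ^ p *
          ∫⁻ x in S', ∫⁻ y in B, ∫⁻ t in Ioc (0 : ℝ) 1, G (x + t • (y - x)) := by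
        have hfin : ENNReal.ofReal (2 * R) ^ p ≠ ⊤ :=
          ENNReal.rpow_ne_top_of_nonneg hp0 ENNReal.ofReal_ne_top
        simp_rw [lintegral_const_mul' _ _ hfin]
    _ = ENNReal.ofReal (2 * R) ^ p *
          ∫⁻ t in Ioc (0 : ℝ) 1, ∫⁻ x in S', ∫⁻ y in B, G (x + t • (y - x)) := by
        congr 1
        rw [lintegral_lintegral_swap (f := fun (t : ℝ) (x : RSpace d) =>
          ∫⁻ y in B, G (x + t • (y - x)))]
        · refine lintegral_congr fun x => ?_
          exact lintegral_lintegral_swap (Measurable.aemeasurable (by fun_prop))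
        · refine Measurable.aemeasurable ?_
          refine Measurable.lintegral_prod_right' (f := fun q : (ℝ × RSpace d) × RSpace d =>
            G (q.1.2 + q.1.1 • (q.2 - q.1.2))) (by fun_prop)
    _ ≤ ENNReal.ofReal (2 * R) ^ p *
          ∫⁻ _t in Ioc (0 : ℝ) 1, 2 ^ d * volume (ball x₀ R) * ∫⁻ y, G y := by
        gcongr with t
        refine (lintegral_lintegral_segment_le G hGm S' B).trans ?_
        gcongr
        exact max_le (measure_mono hS'R) (measure_mono hBR)
    _ = _ := by
        rw [setLIntegral_const, hG, lintegral_indicator hS]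
        simp [mul_assoc]

variable {Ω : Set (RSpace d)} {x₀ e : RSpace d} {R β : ℝ}

/-- The mean value of `u` over the ball from which the points of `Ω` near `x₀` are seen. -/
noncomputable def viewAverage (x₀ e : RSpace d) (R β : ℝ) (u : RSpace d → ℝ) : ℝ :=
  ⨍ y in viewBall x₀ e R β, u y

theorem volume_viewBall_pos (hβ : 0 ≤ β) (hR : 0 < R) : 0 < volume (viewBall x₀ e R β) :=
  measure_ball_pos _ _ (mul_pos (viewRadius_pos hβ) hR)

theorem enorm_sub_viewAverage_rpow_le (hβ : 0 ≤ β) (hR : 0 < R) {u : RSpace d → ℝ}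
    (hu : IntegrableOn u (viewBall x₀ e R β)) (a : ℝ) {p : ℝ} (hp : 1 ≤ p) :
    ‖a - viewAverage x₀ e R β u‖ₑ ^ p ≤ ⨍⁻ y in viewBall x₀ e R β, ‖a - u y‖ₑ ^ p ∂volume := by
  have hpos := volume_viewBall_pos (x₀ := x₀) (e := e) hβ hR
  have hne : NeZero (volume.restrict (viewBall x₀ e R β)) :=
    ⟨by rw [Ne, Measure.restrict_eq_zero]; exact hpos.ne'⟩
  have hfin : IsFiniteMeasure (volume.restrict (viewBall x₀ e R β)) :=
    ⟨by rw [Measure.restrict_apply_univ]; exact measure_ball_lt_top⟩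
  have h1 : a - viewAverage x₀ e R β u = ⨍ y in viewBall x₀ e R β, (a - u y) := by
    have : IsProbabilityMeasure ((volume.restrict (viewBall x₀ e R β) univ)⁻¹ •
      volume.restrict (viewBall x₀ e R β)) := inferInstance
    rw [viewAverage, average, average, integral_sub (integrable_const a) hu.to_average,
      integral_const, probReal_univ, one_smul]
  calc ‖a - viewAverage x₀ e R β u‖ₑ ^ p
      ≤ (⨍⁻ y in viewBall x₀ e R β, ‖a - u y‖ₑ ∂volume) ^ p := by
        rw [h1]
        gcongr
        exact enorm_integral_le_lintegral_enorm _
    _ ≤ _ := laverage_rpow_le _ (by have := hu.aemeasurable; fun_prop) hp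

/-- **Poincaré's inequality** under the cone condition. -/
theorem ConeCondition.poincare (h : ConeCondition Ω x₀ R β e) (hβ : 0 ≤ β) (hR : 0 < R)
    (hx₀ : x₀ ∈ closure Ω)
    (hΩ : IsOpen Ω) {u : RSpace d → ℝ} {Du : RSpace d → RSpace d} (hum : Measurable u)
    (hDum : Measurable Du) (hu : IntegrableOn u Ω) (hDu : IntegrableOn Du Ω)
    (hw : IsWeakGradient Ω u Du) {p : ℝ} (hp : 1 ≤ p) :
    ∫⁻ x in Ω ∩ ball x₀ (R / (2 * (1 + β ^ 2))), ‖u x - viewAverage x₀ e R β u‖ₑ ^ p ≤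
      ENNReal.ofReal (2 * R) ^ p * (2 ^ d * ENNReal.ofReal ((viewRadius β)⁻¹ ^ d)) *
        ∫⁻ x in Ω ∩ ball x₀ R, ‖Du x‖ₑ ^ p := by
  -- The radius 3R/4 contains the view ball and all the segments, and leaves room for the mollifier
  -- inside B_R.
  obtain ⟨v, hv, hlim, hbd⟩ := h.exists_smooth_approx hβ hΩ hum hDum hu hDu hw
    (R' := 3 / 4 * R) (by linarith)
  set S' := Ω ∩ ball x₀ (R / (2 * (1 + β ^ 2))) with hS'
  set B := viewBall x₀ e R β with hB
  have hS'm : MeasurableSet S' := (hΩ.inter isOpen_ball).measurableSet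
  have hBm : MeasurableSet B := isOpen_ball.measurableSet
  have hS'S : S' ⊆ Ω ∩ ball x₀ (3 / 4 * R) := by
    refine inter_subset_inter_right _ (ball_subset_ball ?_)
    exact (half_div_one_add_sq_le hR.le).trans (by linarith)
  have hBS := h.viewBall_subset hβ hR hx₀
  have hRR : ball x₀ (3 / 4 * R) ⊆ ball x₀ R := ball_subset_ball (by linarith)
  have hlimS' := ae_restrict_of_ae_restrict_of_subset hS'S hlim
  have hlimB := ae_restrict_of_ae_restrict_of_subset hBS hlim
  have hBpos := volume_viewBall_pos (x₀ := x₀) (e := e) hβ hR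
  have hBtop : volume B ≠ ⊤ := measure_ball_lt_top.ne
  have hvc : ∀ n, Continuous (v n) := fun n => (hv n).continuous
  -- Fatou's lemma, once in y and once in x, carries the bound for smooth functions over to u.
  have hdouble : ∫⁻ x in S', ∫⁻ y in B, ‖u x - u y‖ₑ ^ p ≤
      ENNReal.ofReal (2 * R) ^ p * (2 ^ d * volume (ball x₀ R)) *
        ∫⁻ x in Ω ∩ ball x₀ R, ‖Du x‖ₑ ^ p := by
    calc ∫⁻ x in S', ∫⁻ y in B, ‖u x - u y‖ₑ ^ p
        ≤ ∫⁻ x in S', liminf (fun n => ∫⁻ y in B, ‖v n x - v n y‖ₑ ^ p) atTop := by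
          apply lintegral_mono_ae
          filter_upwards [hlimS'] with x hx
          refine le_trans (lintegral_mono_ae ?_)
            (lintegral_liminf_le fun n => by have := hvc n; fun_prop)
          filter_upwards [hlimB] with y hy
          refine le_of_eq (Tendsto.liminf_eq ?_).symm
          exact ((ENNReal.continuous_rpow_const.comp continuous_enorm).tendsto _).comp (hx.sub hy)
      _ ≤ liminf (fun n => ∫⁻ x in S', ∫⁻ y in B, ‖v n x - v n y‖ₑ ^ p) atTop :=
          lintegral_liminf_le fun n => by
            have := hvc n
            exact Measurable.lintegral_prod_right' (f := fun q : RSpace d × RSpace d =>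
              ‖v n q.1 - v n q.2‖ₑ ^ p) (by fun_prop)
      _ ≤ _ := by
          refine liminf_le_of_frequently_le' (Frequently.of_forall fun n => ?_)
          refine (lintegral_lintegral_sub_rpow_le_of_segment
            (hΩ.inter isOpen_ball).measurableSet hS'm hBm ((hS'S.trans inter_subset_right).trans hRR)
            ((hBS.trans inter_subset_right).trans hRR)
            (fun x hx y hy t ht => h.segment_mem hβ hR hx hy ht) (hv n) hp).trans ?_
          exact mul_le_mul_right (hbd n p hp).2 _
  calc ∫⁻ x in S', ‖u x - viewAverage x₀ e R β u‖ₑ ^ p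
      ≤ ∫⁻ x in S', (volume B)⁻¹ * ∫⁻ y in B, ‖u x - u y‖ₑ ^ p := by
        gcongr with x
        refine (enorm_sub_viewAverage_rpow_le hβ hR
          (hu.mono_set (hBS.trans inter_subset_left)) (u x) hp).trans (le_of_eq ?_)
        rw [setLAverage_eq, ENNReal.div_eq_inv_mul]
    _ = (volume B)⁻¹ * ∫⁻ x in S', ∫⁻ y in B, ‖u x - u y‖ₑ ^ p :=
        lintegral_const_mul' _ _ (ENNReal.inv_ne_top.2 hBpos.ne')
    _ ≤ (volume B)⁻¹ * (ENNReal.ofReal (2 * R) ^ p *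
          (2 ^ d * (ENNReal.ofReal ((viewRadius β)⁻¹ ^ d) * volume B)) *
            ∫⁻ x in Ω ∩ ball x₀ R, ‖Du x‖ₑ ^ p) := by
        gcongr
        refine hdouble.trans ?_
        gcongr
        exact volume_ball_le_mul_volume_viewBall x₀ e hβ
    _ = (volume B)⁻¹ * volume B * (ENNReal.ofReal (2 * R) ^ p *
          (2 ^ d * ENNReal.ofReal ((viewRadius β)⁻¹ ^ d)) *
            ∫⁻ x in Ω ∩ ball x₀ R, ‖Du x‖ₑ ^ p) := by ring
    _ = _ := by rw [ENNReal.inv_mul_cancel hBpos.ne' hBtop, one_mul]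

end Poincare

/-! ### Sobolev's inequality for smooth functions under the cone condition -/

section Sobolev

open Filter Topology Metric

variable {d : ℕ}

/-- The linear map on `ℝ^d` sending the `i`-th basis vector `eᵢ` to `e₀ + τ eᵢ`. -/
noncomputable def shearMap (d : ℕ) (i₀ : Fin d) (τ : ℝ) : (Fin d → ℝ) →ₗ[ℝ] (Fin d → ℝ) :=
  τ • LinearMap.id + (∑ i, LinearMap.proj i : (Fin d → ℝ) →ₗ[ℝ] ℝ).smulRight (Pi.single i₀ 1)

theorem shearMap_single (i₀ : Fin d) (τ : ℝ) (i : Fin d) :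
    shearMap d i₀ τ (Pi.single i 1) = Pi.single i₀ 1 + τ • Pi.single i 1 := by
  simp [shearMap, add_comm]

/-- For a kernel vector, the coordinates other than `i₀` vanish; then the sum of coordinates is the
`i₀`-th one, which satisfies (τ + 1)x = 0. -/
theorem det_shearMap_ne_zero (i₀ : Fin d) {τ : ℝ} (hτ : 0 < τ) :
    LinearMap.det (shearMap d i₀ τ) ≠ 0 := by
  intro h0
  refine (LinearMap.bot_lt_ker_of_det_eq_zero h0).ne' ?_
  rw [LinearMap.ker_eq_bot']
  intro x hx
  have h1 : ∀ k, τ * x k + (∑ i, x i) * (Pi.single i₀ (1 : ℝ) : Fin d → ℝ) k = 0 := fun k => by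
    simpa [shearMap] using congrFun hx k
  have h2 : ∀ k, k ≠ i₀ → x k = 0 := fun k hk => by
    have := h1 k
    rw [Pi.single_eq_of_ne hk] at this
    simpa [hτ.ne'] using this
  have h3 : ∑ i, x i = x i₀ := Finset.sum_eq_single_of_mem i₀ (Finset.mem_univ _) fun k _ => h2 k
  have h4 : x i₀ = 0 := by
    have := h1 i₀
    rw [h3, Pi.single_eq_same, mul_one, ← add_one_mul] at this
    exact (mul_eq_zero.1 this).resolve_left (by positivity)
  ext k
  by_cases hk : k = i₀
  · rw [hk, h4]; rfl
  · exact h2 k hk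

/-- A frame of `d` vectors in the cone around `e`; the volume it spans depends on `d`, `β` only. -/
theorem exists_cone_frame (hd : 2 ≤ d) {β : ℝ} (hβ : 0 ≤ β) :
    ∃ K : ℝ≥0, K ≠ 0 ∧ ∀ e : RSpace d, ‖e‖ = 1 → ∃ T : (Fin d → ℝ) →ₗ[ℝ] RSpace d,
      (∀ i, InCone β e (T (Pi.single i 1)) ∧ ‖T (Pi.single i 1)‖ ≤ 2 ∧ T (Pi.single i 1) ≠ 0) ∧
      ∀ G : RSpace d → ℝ≥0∞, Measurable G → ∫⁻ y, G (T y) = K * ∫⁻ x, G x := by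
  let i₀ : Fin d := ⟨0, by omega⟩
  -- The largest perturbation of a unit vector `e` that `inCone_smul_add` tolerates.
  set τ : ℝ := 1 / (1 + β) with hτ
  have hτ0 : 0 < τ := by positivity
  have hτ1 : τ ≤ 1 := by rw [hτ, div_le_one (by positivity)]; linarith
  have hdet := det_shearMap_ne_zero i₀ hτ0
  refine ⟨Real.toNNReal |(LinearMap.det (shearMap d i₀ τ))⁻¹|, ?_, fun e he => ?_⟩
  · simpa using hdet
  -- Completing `e` to an orthonormal basis reduces to a fixed shear followed by an isometry, so the
  -- volume factor does not depend on `e`.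
  obtain ⟨b, hb⟩ := Orthonormal.exists_orthonormalBasis_extension_of_card_eq (𝕜 := ℝ)
    (E := RSpace d) (ι := Fin d) (by simp) (v := fun _ => e) (s := {i₀})
    (by
      rw [orthonormal_iff_ite]
      rintro ⟨i, rfl⟩ ⟨j, rfl⟩
      simp [he])
  have hbe : b i₀ = e := hb i₀ rfl
  let J : (Fin d → ℝ) →ₗ[ℝ] RSpace d :=
    b.repr.symm.toLinearEquiv.toLinearMap ∘ₗ (WithLp.linearEquiv 2 ℝ (Fin d → ℝ)).symm.toLinearMap
  have hJ : ∀ i, J (Pi.single i 1) = b i := fun i => by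
    have : (WithLp.linearEquiv 2 ℝ (Fin d → ℝ)).symm (Pi.single i 1) =
      EuclideanSpace.single i (1 : ℝ) := rfl
    simp [J, this]
  have hJm : MeasurePreserving (J : (Fin d → ℝ) → RSpace d) volume volume :=
    (b.measurePreserving_repr_symm).comp
      (PiLp.volume_preserving_toLp (Fin d))
  have hTe : ∀ i, (J ∘ₗ shearMap d i₀ τ) (Pi.single i 1) = (1 : ℝ) • e + τ • b i := fun i => by
    rw [LinearMap.comp_apply, shearMap_single, map_add, map_smul, hJ, hJ, hbe, one_smul]
  refine ⟨J ∘ₗ shearMap d i₀ τ, fun i => ?_, fun G hG => ?_⟩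
  · have hτb : ‖τ • b i‖ = τ := by
      rw [norm_smul, b.norm_eq_one, mul_one, Real.norm_of_nonneg hτ0.le]
    rw [hTe]
    refine ⟨inCone_smul_add he hβ ?_, ?_, ?_⟩
    · rw [hτb, hτ, mul_one_div_cancel (by positivity)]
    · refine (norm_add_le _ _).trans ?_
      rw [hτb, one_smul, he]
      linarith
    · intro h0
      have h1 : (1 : ℝ) • e + τ • b i = J (shearMap d i₀ τ (Pi.single i 1)) := (hTe i).symm
      have hinj : Function.Injective (J ∘ₗ shearMap d i₀ τ) := by
        have hs : Function.Injective (shearMap d i₀ τ) := by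
          exact (LinearMap.equivOfDetNeZero _ hdet).injective
        exact (b.repr.symm.injective.comp (WithLp.linearEquiv 2 ℝ (Fin d → ℝ)).symm.injective).comp hs
      have h2 := hinj (a₁ := Pi.single i 1) (a₂ := 0) (by rw [hTe, h0, map_zero])
      have := congrFun h2 i
      simp at this
  · calc ∫⁻ y, G ((J ∘ₗ shearMap d i₀ τ) y)
        = ∫⁻ y, G (J y) ∂(Measure.map (shearMap d i₀ τ) volume) := by
          exact (lintegral_map (hG.comp hJm.measurable)
            (LinearMap.continuous_of_finiteDimensional (shearMap d i₀ τ)).measurable).symm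
      _ = ENNReal.ofReal |(LinearMap.det (shearMap d i₀ τ))⁻¹| * ∫⁻ y, G (J y) := by
          rw [Real.map_linearMap_volume_pi_eq_smul_volume_pi hdet, lintegral_smul_measure,
            smul_eq_mul]
      _ = _ := by
          rw [hJm.lintegral_comp hG]
          rfl

/-- The grid-lines lemma for a frame of `d` directions. -/
theorem lintegral_rpow_le_of_le_lintegral_line (hd : 2 ≤ d) {K : ℝ≥0}
    {T : (Fin d → ℝ) →ₗ[ℝ] RSpace d}
    (hT : ∀ G : RSpace d → ℝ≥0∞, Measurable G → ∫⁻ y, G (T y) = K * ∫⁻ x, G x)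
    {h F : RSpace d → ℝ≥0∞} (hh : Measurable h) (hF : Measurable F)
    (hhF : ∀ x i, h x ≤ ∫⁻ t : ℝ, F (x + t • T (Pi.single i 1))) :
    K * ∫⁻ x, h x ^ ((d : ℝ) / (d - 1)) ≤ (K * ∫⁻ x, F x) ^ ((d : ℝ) / (d - 1)) := by
  have hd' : (2 : ℝ) ≤ d := by exact_mod_cast hd
  have hconj : Real.HolderConjugate (Fintype.card (Fin d)) ((d : ℝ) / (d - 1)) := by
    rw [Fintype.card_fin, Real.holderConjugate_iff]
    refine ⟨by linarith, ?_⟩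
    field_simp
    ring
  have hTm : Measurable T := (LinearMap.continuous_of_finiteDimensional T).measurable
  rw [← hT _ (hh.pow_const _), ← hT _ hF]
  refine le_trans ?_ (lintegral_prod_lintegral_pow_le (fun _ => volume) hconj (hF.comp hTm))
  refine lintegral_mono fun y => ?_
  calc h (T y) ^ ((d : ℝ) / (d - 1)) = ∏ _i : Fin d, h (T y) ^ ((1 : ℝ) / (d - 1)) := by
        rw [Finset.prod_const, Finset.card_fin, ← ENNReal.rpow_natCast, ← ENNReal.rpow_mul]
        congr 1
        ring
    _ ≤ _ := by
        rw [Fintype.card_fin]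
        gcongr with i
        · apply div_nonneg <;> linarith
        refine (hhF (T y) i).trans (le_of_eq ?_)
        -- Translating t by y i turns the line through y into the line on which the i-th coordinate
        -- is replaced by t.
        rw [← lintegral_sub_right_eq_self _ (y i)]
        refine lintegral_congr fun t => ?_
        congr 1
        rw [← map_smul, ← map_add]
        congr 1
        ext k
        by_cases hk : k = i
        · subst hk; simp
        · simp [hk]

/-- Fundamental theorem of calculus for |f|^s, which is C¹ when s > 1. The case s = 1 is treated
apart, since |f| need not be differentiable; it is needed because q = 1 when d = 2. -/
theorem enorm_rpow_le_lintegral_Iic {f : ℝ → ℝ} (hf : ContDiff ℝ 1 f) (hfc : HasCompactSupport f)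
    {s : ℝ} (hs : 1 ≤ s) (a : ℝ) :
    ‖f a‖ₑ ^ s ≤ ∫⁻ t in Iic a, ENNReal.ofReal s * ‖f t‖ₑ ^ (s - 1) * ‖deriv f t‖ₑ := by
  rcases hs.eq_or_lt with rfl | hs
  · simpa using hfc.enorm_le_lintegral_Ici_deriv hf a
  have hs0 : 0 < s := by linarith
  have hc : HasCompactSupport fun t => ‖f t‖ ^ s :=
    hfc.comp_left (g := fun z : ℝ => ‖z‖ ^ s) (by simp [hs0.ne'])
  refine le_trans (le_of_eq ?_) ((hc.enorm_le_lintegral_Ici_deriv (hf.norm_rpow hs) a).trans ?_)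
  · rw [Real.enorm_rpow_of_nonneg (norm_nonneg _) hs0.le, enorm_norm]
  · refine lintegral_mono fun t => ?_
    have h := norm_fderiv_norm_rpow_le (hf.differentiable one_ne_zero) (x := t) hs
    rw [← norm_deriv_eq_norm_fderiv, ← norm_deriv_eq_norm_fderiv] at h
    rw [← ofReal_norm]
    refine (ENNReal.ofReal_le_ofReal h).trans (le_of_eq ?_)
    rw [ENNReal.ofReal_mul (by positivity), ENNReal.ofReal_mul (by positivity),
      ← ENNReal.ofReal_rpow_of_nonneg (norm_nonneg _) (by linarith), ofReal_norm, ofReal_norm]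

variable {Ω : Set (RSpace d)} {x₀ e : RSpace d} {R β : ℝ}

/-- The half-line from x in direction v remains in Ω as long as it is in the ball, and outside the
ball w and its derivative vanish. So w need not vanish on ∂Ω. The factor 2 comes from ‖v‖ ≤ 2. -/
theorem ConeCondition.le_lintegral_line (h : ConeCondition Ω x₀ R β e) {w : RSpace d → ℝ}
    (hw : ContDiff ℝ 1 w) (hwR : tsupport w ⊆ ball x₀ R) {s : ℝ} (hs : 1 ≤ s) {v : RSpace d}
    (hv : InCone β e v) (hv2 : ‖v‖ ≤ 2) (hv0 : v ≠ 0) (x : RSpace d) :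
    (Ω ∩ ball x₀ R).indicator (fun x => ‖w x‖ₑ ^ s) x ≤
      ∫⁻ t : ℝ, (Ω ∩ ball x₀ R).indicator
        (fun x => ENNReal.ofReal (2 * s) * (‖w x‖ₑ ^ (s - 1) * ‖fderiv ℝ w x‖ₑ)) (x + t • v) := by
  by_cases hx : x ∈ Ω ∩ ball x₀ R
  swap
  · rw [indicator_of_notMem hx]; exact zero_le
  have hwc : HasCompactSupport w :=
    Metric.isCompact_of_isClosed_isBounded (isClosed_tsupport w) (isBounded_ball.subset hwR)
  rw [indicator_of_mem hx]
  set f : ℝ → ℝ := fun t => w (x + (-t) • v) with hf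
  have hfs : ContDiff ℝ 1 f := hw.comp (by fun_prop)
  have hfc : HasCompactSupport f := by
    apply hwc.comp_isClosedEmbedding
    exact (Homeomorph.addLeft x).isClosedEmbedding.comp
      ((isClosedEmbedding_smul_left hv0).comp (Homeomorph.neg ℝ).isClosedEmbedding)
  have hfd : ∀ t, deriv f t = fderiv ℝ w (x + (-t) • v) (-v) := fun t => by
    have h1 : HasDerivAt (fun t : ℝ => x + (-t) • v) (-v) t := by
      simpa using ((hasDerivAt_id t).neg.smul_const v).const_add x
    exact ((hw.differentiable one_ne_zero _).hasFDerivAt.comp_hasDerivAt t h1).deriv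
  have h0 := enorm_rpow_le_lintegral_Iic hfs hfc hs 0
  have hf0 : f 0 = w x := by simp [hf]
  rw [hf0] at h0
  refine h0.trans ?_
  rw [← lintegral_neg_eq_self (μ := volume) (fun t : ℝ => (Ω ∩ ball x₀ R).indicator _ (x + t • v))]
  refine le_trans (setLIntegral_mono' measurableSet_Iic fun t ht => ?_)
    (lintegral_mono' Measure.restrict_le_self le_rfl)
  rw [hfd]
  by_cases hb : x + (-t) • v ∈ ball x₀ R
  · have hΩ : x + (-t) • v ∈ Ω := h.add_mem x hx.1 hx.2 _ (hv.smul (by simpa using ht)) hb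
    have hm : x + (-t) • v ∈ Ω ∩ ball x₀ R := ⟨hΩ, hb⟩
    rw [indicator_of_mem hm]
    calc ENNReal.ofReal s * ‖f t‖ₑ ^ (s - 1) * ‖fderiv ℝ w (x + (-t) • v) (-v)‖ₑ
        ≤ ENNReal.ofReal s * ‖f t‖ₑ ^ (s - 1) * (‖fderiv ℝ w (x + (-t) • v)‖ₑ * 2) := by
          gcongr
          refine (ContinuousLinearMap.le_opENorm _ _).trans ?_
          gcongr
          rw [enorm_neg, ← ofReal_norm]
          exact (ENNReal.ofReal_le_ofReal hv2).trans_eq (ENNReal.ofReal_ofNat 2)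
      _ = _ := by
          rw [ENNReal.ofReal_mul (by norm_num), ENNReal.ofReal_ofNat]
          ring
  · rw [fderiv_of_notMem_tsupport ℝ (fun hm => hb (hwR hm))]
    simp

/-- Absorption of a power of the quantity being estimated; dividing is legitimate because M is
finite. -/
theorem ENNReal.rpow_one_sub_le_of_le_mul_rpow {M B : ℝ≥0∞} {a : ℝ} (ha1 : a < 1)
    (hM : M ≠ ⊤) (h : M ≤ B * M ^ a) : M ^ (1 - a) ≤ B := by
  rcases eq_or_ne M 0 with rfl | hM0
  · rw [ENNReal.zero_rpow_of_pos (by linarith)]; exact zero_le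
  rw [ENNReal.rpow_sub _ _ hM0 hM, ENNReal.rpow_one]
  exact ENNReal.div_le_of_le_mul h

/-- Sobolev's inequality up to the boundary for functions of class `C¹`. -/
theorem exists_sobolev_const_of_contDiff (hd : 2 ≤ d) {β : ℝ} (hβ : 0 ≤ β) {p r : ℝ} (hp : 1 ≤ p)
    (hpd : p < d) (hr : r = d * p / (d - p)) :
    ∃ C : ℝ≥0, ∀ (Ω : Set (RSpace d)) (x₀ e : RSpace d) (R : ℝ), IsOpen Ω →
      ConeCondition Ω x₀ R β e → ∀ w : RSpace d → ℝ, ContDiff ℝ 1 w → tsupport w ⊆ ball x₀ R →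
      ∫⁻ x in Ω ∩ ball x₀ R, ‖w x‖ₑ ^ r ≤
        C * (∫⁻ x in Ω ∩ ball x₀ R, ‖fderiv ℝ w x‖ₑ ^ p) ^ (r / p) := by
  obtain ⟨K, hK0, hK⟩ := exists_cone_frame hd hβ
  have hd' : (2 : ℝ) ≤ d := by exact_mod_cast hd
  have hp0 : 0 < p := by linarith
  have hdp : 0 < (d : ℝ) - p := by linarith
  have hd1 : 0 < (d : ℝ) - 1 := by linarith
  set d' : ℝ := d / (d - 1) with hd'def
  have hd'0 : 0 < d' := by positivity
  -- Applying the grid-lines lemma to |w|^s produces the exponent r = s d/(d − 1) on the left, and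
  -- for p > 1 also (s − 1)p' = r in Hölder's inequality, so M occurs on both sides.
  set s : ℝ := p * (d - 1) / (d - p) with hs
  have hs1 : 1 ≤ s := by rw [hs, le_div_iff₀ hdp]; nlinarith
  have hr0 : 0 < r := by rw [hr]; positivity
  have hsr : s * d' = r := by rw [hs, hd'def, hr]; field_simp
  set a : ℝ := (1 - 1 / p) * d' with ha
  have h1a : 1 - a = (d - p) / (p * (d - 1)) := by rw [ha, hd'def]; field_simp; ring
  have h1a0 : 0 < 1 - a := by rw [h1a]; positivity
  set C₁ : ℝ≥0∞ := (K : ℝ≥0∞)⁻¹ * (K * ENNReal.ofReal (2 * s)) ^ d' with hC₁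
  have hKE : (K : ℝ≥0∞) ≠ 0 := by simpa using hK0
  have hC₁top : C₁ ^ (1 / (1 - a)) ≠ ⊤ := by
    refine ENNReal.rpow_ne_top_of_nonneg (by positivity) (ENNReal.mul_ne_top ?_ ?_)
    · exact ENNReal.inv_ne_top.2 hKE
    · exact ENNReal.rpow_ne_top_of_nonneg hd'0.le
        (ENNReal.mul_ne_top ENNReal.coe_ne_top ENNReal.ofReal_ne_top)
  refine ⟨(C₁ ^ (1 / (1 - a))).toNNReal, fun Ω x₀ e R hΩ h w hw hwR => ?_⟩
  rw [ENNReal.coe_toNNReal hC₁top]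
  obtain ⟨T, hT, hTint⟩ := hK e h.norm_eq
  have hSm : MeasurableSet (Ω ∩ ball x₀ R) := (hΩ.inter isOpen_ball).measurableSet
  have hwc : HasCompactSupport w :=
    Metric.isCompact_of_isClosed_isBounded (isClosed_tsupport w) (isBounded_ball.subset hwR)
  have hwm : Measurable w := hw.continuous.measurable
  have hdm : Measurable fun x => ‖fderiv ℝ w x‖ₑ :=
    (hw.continuous_fderiv one_ne_zero).enorm.measurable
  set M := ∫⁻ x in Ω ∩ ball x₀ R, ‖w x‖ₑ ^ r with hM
  set P := ∫⁻ x in Ω ∩ ball x₀ R, ‖fderiv ℝ w x‖ₑ ^ p with hP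
  have hMtop : M ≠ ⊤ := by
    obtain ⟨c, hc⟩ := hw.continuous.bounded_above_of_compact_support hwc
    refine ne_top_of_le_ne_top (b := ENNReal.ofReal c ^ r * volume (ball x₀ R))
      (ENNReal.mul_ne_top (ENNReal.rpow_ne_top_of_nonneg hr0.le ENNReal.ofReal_ne_top)
        measure_ball_lt_top.ne) ?_
    calc M ≤ ∫⁻ _x in Ω ∩ ball x₀ R, ENNReal.ofReal c ^ r := by
          rw [hM]
          refine lintegral_mono fun x => ?_
          gcongr
          rw [← ofReal_norm]
          exact ENNReal.ofReal_le_ofReal (hc x)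
      _ ≤ _ := by
          rw [setLIntegral_const]
          gcongr
          exact inter_subset_right
  have hgrid := lintegral_rpow_le_of_le_lintegral_line hd hTint
    (h := (Ω ∩ ball x₀ R).indicator (fun x => ‖w x‖ₑ ^ s))
    (F := (Ω ∩ ball x₀ R).indicator
        (fun x => ENNReal.ofReal (2 * s) * (‖w x‖ₑ ^ (s - 1) * ‖fderiv ℝ w x‖ₑ)))
    (Measurable.indicator (by fun_prop) hSm) (Measurable.indicator (by fun_prop) hSm)
    (fun x i => h.le_lintegral_line hw hwR hs1 (hT i).1 (hT i).2.1 (hT i).2.2 x)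
  have hL : ∫⁻ x, (Ω ∩ ball x₀ R).indicator (fun x => ‖w x‖ₑ ^ s) x ^ d' = M := by
    rw [hM, ← lintegral_indicator hSm]
    refine lintegral_congr fun x => ?_
    by_cases hx : x ∈ Ω ∩ ball x₀ R
    · rw [indicator_of_mem hx, indicator_of_mem hx, ← ENNReal.rpow_mul, hsr]
    · rw [indicator_of_notMem hx, indicator_of_notMem hx, ENNReal.zero_rpow_of_pos hd'0]
  have hHolder : ∫⁻ x in Ω ∩ ball x₀ R, ‖w x‖ₑ ^ (s - 1) * ‖fderiv ℝ w x‖ₑ ≤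
      M ^ (1 - 1 / p) * P ^ (1 / p) := by
    rcases hp.eq_or_lt with rfl | hp1
    · have : s - 1 = 0 := by rw [hs]; field_simp; ring
      simp [this, hP]
    · have hpq := (Real.HolderConjugate.conjExponent hp1).symm
      have hq : 1 / Real.conjExponent p = 1 - 1 / p := by
        rw [one_div, one_div, (Real.HolderConjugate.conjExponent hp1).one_sub_inv]
      have hsq : (s - 1) * Real.conjExponent p = r := by
        rw [Real.conjExponent, hs, hr]
        have : p - 1 ≠ 0 := by linarith
        field_simp
        ring
      have := ENNReal.lintegral_mul_le_Lp_mul_Lq (volume.restrict (Ω ∩ ball x₀ R)) hpq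
        (f := fun x => ‖w x‖ₑ ^ (s - 1)) (g := fun x => ‖fderiv ℝ w x‖ₑ) (by fun_prop)
        hdm.aemeasurable
      simp_rw [← ENNReal.rpow_mul, hsq, hq] at this
      exact this
  rw [hL, lintegral_indicator hSm, lintegral_const_mul' _ _ ENNReal.ofReal_ne_top] at hgrid
  have hmain : M ≤ C₁ * P ^ (d' / p) * M ^ a := by
    calc M = (K : ℝ≥0∞)⁻¹ * (K * M) := by
          rw [← mul_assoc, ENNReal.inv_mul_cancel hKE ENNReal.coe_ne_top, one_mul]
      _ ≤ (K : ℝ≥0∞)⁻¹ * (K * (ENNReal.ofReal (2 * s) * (M ^ (1 - 1 / p) * P ^ (1 / p)))) ^ d' := by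
          gcongr
          exact hgrid.trans (by gcongr)
      _ = _ := by
          rw [hC₁, ← mul_assoc (K : ℝ≥0∞), ENNReal.mul_rpow_of_nonneg _ _ hd'0.le,
            ENNReal.mul_rpow_of_nonneg _ _ hd'0.le,
            ENNReal.mul_rpow_of_nonneg (M ^ _) _ hd'0.le, ← ENNReal.rpow_mul, ← ENNReal.rpow_mul, ← ha,
            one_div_mul_eq_div]
          ring
  have h2 := ENNReal.rpow_one_sub_le_of_le_mul_rpow (by linarith) hMtop hmain
  calc M = (M ^ (1 - a)) ^ (1 / (1 - a)) := by
        rw [← ENNReal.rpow_mul, mul_one_div_cancel h1a0.ne', ENNReal.rpow_one]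
    _ ≤ (C₁ * P ^ (d' / p)) ^ (1 / (1 - a)) := by gcongr
    _ = C₁ ^ (1 / (1 - a)) * P ^ (r / p) := by
        rw [ENNReal.mul_rpow_of_nonneg _ _ (by positivity), ← ENNReal.rpow_mul]
        congr 2
        rw [h1a, hd'def, hr]
        field_simp

end Sobolev

/-! ### The Sobolev–Poincaré inequality -/

section SobolevPoincare

open Filter Topology Metric

variable {d : ℕ}

/-- Smooth cutoff functions with a gradient bound that scales. -/
theorem exists_cutoff_bound (d : ℕ) : ∃ M : ℝ≥0, ∀ (x₀ : RSpace d) (l : ℝ), 0 < l →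
    ∃ η : RSpace d → ℝ, ContDiff ℝ ∞ η ∧ (∀ x, 0 ≤ η x ∧ η x ≤ 1) ∧ (∀ x ∈ ball x₀ l, η x = 1) ∧
      tsupport η ⊆ closedBall x₀ (5 / 4 * l) ∧ ∀ x, ‖fderiv ℝ η x‖ ≤ M / l := by
  let b : ContDiffBump (0 : RSpace d) := ⟨1, 5 / 4, by norm_num, by norm_num⟩
  have hb : ContDiff ℝ ∞ b := b.contDiff
  obtain ⟨M, hM⟩ := (hb.continuous_fderiv (by simp)).bounded_above_of_compact_support
    (b.hasCompactSupport.fderiv ℝ)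
  have hM0 : 0 ≤ M := (norm_nonneg _).trans (hM 0)
  refine ⟨⟨M, hM0⟩, fun x₀ l hl => ⟨fun x => b (l⁻¹ • (x - x₀)), ?_, ?_, ?_, ?_, ?_⟩⟩
  · exact hb.comp (by fun_prop)
  · exact fun x => ⟨b.nonneg, b.le_one⟩
  · intro x hx
    apply b.one_of_mem_closedBall
    rw [mem_closedBall_zero_iff, norm_smul, Real.norm_of_nonneg (by positivity), inv_mul_le_iff₀ hl]
    exact (mem_ball_iff_norm.1 hx).le.trans_eq (mul_one l).symm
  · intro x hx
    have h1 : l⁻¹ • (x - x₀) ∈ tsupport b :=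
      tsupport_comp_subset_preimage b (f := fun x => l⁻¹ • (x - x₀)) (by fun_prop) hx
    rw [b.tsupport_eq, mem_closedBall_zero_iff, norm_smul, Real.norm_of_nonneg (by positivity),
      inv_mul_le_iff₀ hl] at h1
    rw [mem_closedBall_iff_norm, mul_comm]
    exact h1
  · intro x
    have h1 : HasFDerivAt (fun x : RSpace d => l⁻¹ • (x - x₀))
        (l⁻¹ • ContinuousLinearMap.id ℝ (RSpace d)) x :=
      ((hasFDerivAt_id x).sub_const x₀).const_smul l⁻¹
    have h2 := ((hb.differentiable (by simp) (l⁻¹ • (x - x₀))).hasFDerivAt.comp x h1).fderiv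
    change ‖fderiv ℝ ((b : RSpace d → ℝ) ∘ fun x => l⁻¹ • (x - x₀)) x‖ ≤ _
    rw [h2, ContinuousLinearMap.comp_smul, ContinuousLinearMap.comp_id, norm_smul,
      Real.norm_of_nonneg (by positivity), inv_mul_eq_div]
    exact div_le_div_of_nonneg_right (hM _) hl.le

/-- Sobolev's inequality up to the boundary for weakly differentiable functions. -/
theorem exists_sobolev_const (hd : 2 ≤ d) {β : ℝ} (hβ : 0 ≤ β) {p r : ℝ} (hp : 1 ≤ p)
    (hpd : p < d) (hr : r = d * p / (d - p)) :
    ∃ C : ℝ≥0, ∀ (Ω : Set (RSpace d)) (x₀ e : RSpace d) (l : ℝ), IsOpen Ω → 0 < l →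
      ConeCondition Ω x₀ (3 / 2 * l) β e → ∀ (u : RSpace d → ℝ) (Du : RSpace d → RSpace d),
      Measurable u → Measurable Du → IntegrableOn u Ω → IntegrableOn Du Ω →
      IsWeakGradient Ω u Du → ∀ c : ℝ,
      ∫⁻ x in Ω ∩ ball x₀ l, ‖u x - c‖ₑ ^ r ≤
        C * ((∫⁻ x in Ω ∩ ball x₀ (3 / 2 * l), ‖Du x‖ₑ ^ p) +
          ENNReal.ofReal (1 / l) ^ p *
            ∫⁻ x in Ω ∩ ball x₀ (3 / 2 * l), ‖u x - c‖ₑ ^ p) ^ (r / p) := by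
  obtain ⟨C, hC⟩ := exists_sobolev_const_of_contDiff hd hβ hp hpd hr
  obtain ⟨M, hM⟩ := exists_cutoff_bound d
  have hp0 : 0 < p := by linarith
  have hdp : 0 < (d : ℝ) - p := by linarith
  have hr0 : 0 < r := by
    rw [hr]
    have : (0 : ℝ) < d := by linarith
    positivity
  set A : ℝ≥0∞ := 2 ^ (p - 1) * max 1 ((M : ℝ≥0∞) ^ p) with hA
  have hAtop : A ≠ ⊤ := by
    refine ENNReal.mul_ne_top (ENNReal.rpow_ne_top_of_nonneg (by linarith) (by simp)) ?_
    exact (max_lt ENNReal.one_lt_top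
      (ENNReal.rpow_lt_top_of_nonneg hp0.le ENNReal.coe_ne_top)).ne
  refine ⟨(C * A ^ (r / p)).toNNReal, fun Ω x₀ e l hΩ hl h u Du hum hDum hu hDu hw c => ?_⟩
  rw [ENNReal.coe_toNNReal (ENNReal.mul_ne_top ENNReal.coe_ne_top
    (ENNReal.rpow_ne_top_of_nonneg (by positivity) hAtop))]
  obtain ⟨η, hηs, hη01, hη1, hηsupp, hηM⟩ := hM x₀ l hl
  -- The radius 11l/8 lies between 5l/4, where the cutoff ends, and 3l/2, where u is controlled.
  obtain ⟨v, hv, hlim, hbd⟩ := h.exists_smooth_approx hβ hΩ hum hDum hu hDu hw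
    (R' := 11 / 8 * l) (by linarith)
  set Q := (∫⁻ x in Ω ∩ ball x₀ (3 / 2 * l), ‖Du x‖ₑ ^ p) +
    ENNReal.ofReal (1 / l) ^ p * ∫⁻ x in Ω ∩ ball x₀ (3 / 2 * l), ‖u x - c‖ₑ ^ p with hQ
  have hsub : Ω ∩ ball x₀ l ⊆ Ω ∩ ball x₀ (11 / 8 * l) :=
    inter_subset_inter_right _ (ball_subset_ball (by linarith))
  have hSm : MeasurableSet (Ω ∩ ball x₀ l) := (hΩ.inter isOpen_ball).measurableSet
  have hsmooth : ∀ n, ∫⁻ x in Ω ∩ ball x₀ l, ‖v n x - c‖ₑ ^ r ≤ C * A ^ (r / p) * Q ^ (r / p) := by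
    intro n
    set w : RSpace d → ℝ := fun x => η x * (v n x - c) with hwdef
    have hηs1 : ContDiff ℝ 1 η := hηs.of_le (by simp)
    have hws : ContDiff ℝ 1 w := hηs1.mul ((hv n).sub contDiff_const)
    have hwsupp : tsupport w ⊆ ball x₀ (11 / 8 * l) :=
      (tsupport_mul_subset_left.trans hηsupp).trans (closedBall_subset_ball (by linarith))
    have hfd : ∀ x, ‖fderiv ℝ w x‖ₑ ≤
        ‖fderiv ℝ (v n) x‖ₑ + M * ENNReal.ofReal (1 / l) * ‖v n x - c‖ₑ := by
      intro x
      have h1 : fderiv ℝ w x = η x • fderiv ℝ (v n) x + (v n x - c) • fderiv ℝ η x := by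
        have := ((hηs1.differentiable one_ne_zero x).hasFDerivAt.mul
          (((hv n).differentiable one_ne_zero x).hasFDerivAt.sub_const c)).fderiv
        exact this
      rw [h1]
      refine (enorm_add_le (η x • fderiv ℝ (v n) x) ((v n x - c) • fderiv ℝ η x)).trans
        (add_le_add ?_ ?_)
      · rw [enorm_smul]
        refine mul_le_of_le_one_left zero_le ?_
        rw [Real.enorm_of_nonneg (hη01 x).1]
        exact ENNReal.ofReal_le_one.2 (hη01 x).2
      · rw [enorm_smul, mul_comm]
        refine mul_le_mul_left ?_ _
        rw [← ofReal_norm, ← ENNReal.ofReal_coe_nnreal, ← ENNReal.ofReal_mul M.coe_nonneg, mul_one_div]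
        exact ENNReal.ofReal_le_ofReal (hηM x)
    have hgrad : ∫⁻ x in Ω ∩ ball x₀ (11 / 8 * l), ‖fderiv ℝ w x‖ₑ ^ p ≤ A * Q := by
      have hvm : Measurable (v n) := (hv n).continuous.measurable
      have hdm : Measurable fun x => ‖fderiv ℝ (v n) x‖ₑ :=
        ((hv n).continuous_fderiv one_ne_zero).enorm.measurable
      calc ∫⁻ x in Ω ∩ ball x₀ (11 / 8 * l), ‖fderiv ℝ w x‖ₑ ^ p
          ≤ ∫⁻ x in Ω ∩ ball x₀ (11 / 8 * l), A * (‖fderiv ℝ (v n) x‖ₑ ^ p +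
              ENNReal.ofReal (1 / l) ^ p * ‖v n x - c‖ₑ ^ p) := by
            refine lintegral_mono fun x => ?_
            calc ‖fderiv ℝ w x‖ₑ ^ p
                ≤ (‖fderiv ℝ (v n) x‖ₑ + M * ENNReal.ofReal (1 / l) * ‖v n x - c‖ₑ) ^ p := by
                  gcongr; exact hfd x
              _ ≤ 2 ^ (p - 1) * (‖fderiv ℝ (v n) x‖ₑ ^ p +
                    (M * ENNReal.ofReal (1 / l) * ‖v n x - c‖ₑ) ^ p) :=
                  ENNReal.rpow_add_le_mul_rpow_add_rpow _ _ hp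
              _ ≤ 2 ^ (p - 1) * (max 1 ((M : ℝ≥0∞) ^ p) * ‖fderiv ℝ (v n) x‖ₑ ^ p +
                    max 1 ((M : ℝ≥0∞) ^ p) *
                      (ENNReal.ofReal (1 / l) ^ p * ‖v n x - c‖ₑ ^ p)) := by
                  gcongr
                  · exact le_mul_of_one_le_left zero_le (le_max_left _ _)
                  · rw [ENNReal.mul_rpow_of_nonneg _ _ hp0.le,
                      ENNReal.mul_rpow_of_nonneg _ _ hp0.le, mul_assoc]
                    gcongr
                    exact le_max_right _ _
              _ = _ := by rw [hA]; ring
        _ = A * ((∫⁻ x in Ω ∩ ball x₀ (11 / 8 * l), ‖fderiv ℝ (v n) x‖ₑ ^ p) +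
              ENNReal.ofReal (1 / l) ^ p *
                ∫⁻ x in Ω ∩ ball x₀ (11 / 8 * l), ‖v n x - c‖ₑ ^ p) := by
            rw [lintegral_const_mul' _ _ hAtop, lintegral_add_left (by fun_prop),
              lintegral_const_mul' _ _
                (ENNReal.rpow_ne_top_of_nonneg hp0.le ENNReal.ofReal_ne_top)]
        _ ≤ A * Q := by
            rw [hQ]
            refine mul_le_mul_right (add_le_add (hbd n p hp).2
              (mul_le_mul_right ((hbd n p hp).1 c) _)) _
    calc ∫⁻ x in Ω ∩ ball x₀ l, ‖v n x - c‖ₑ ^ r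
        = ∫⁻ x in Ω ∩ ball x₀ l, ‖w x‖ₑ ^ r :=
          setLIntegral_congr_fun hSm fun x hx => by simp [hwdef, hη1 x hx.2]
      _ ≤ ∫⁻ x in Ω ∩ ball x₀ (11 / 8 * l), ‖w x‖ₑ ^ r := lintegral_mono_set hsub
      _ ≤ C * (∫⁻ x in Ω ∩ ball x₀ (11 / 8 * l), ‖fderiv ℝ w x‖ₑ ^ p) ^ (r / p) :=
          hC Ω x₀ e _ hΩ (h.mono (by linarith)) w hws hwsupp
      _ ≤ C * (A * Q) ^ (r / p) := by gcongr
      _ = _ := by rw [ENNReal.mul_rpow_of_nonneg _ _ (by positivity), mul_assoc]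
  calc ∫⁻ x in Ω ∩ ball x₀ l, ‖u x - c‖ₑ ^ r
      ≤ liminf (fun n => ∫⁻ x in Ω ∩ ball x₀ l, ‖v n x - c‖ₑ ^ r) atTop := by
        refine le_trans (lintegral_mono_ae ?_)
          (lintegral_liminf_le fun n => by have := (hv n).continuous; fun_prop)
        filter_upwards [ae_restrict_of_ae_restrict_of_subset hsub hlim] with x hx
        refine le_of_eq (Tendsto.liminf_eq ?_).symm
        exact ((ENNReal.continuous_rpow_const.comp continuous_enorm).tendsto _).comp
          (hx.sub tendsto_const_nhds)
    _ ≤ _ := liminf_le_of_frequently_le' (Frequently.of_forall hsmooth)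

/-- The Sobolev–Poincaré inequality for measurable functions. -/
theorem exists_sobolev_poincare_const_of_measurable (hd : 2 ≤ d) {β : ℝ} (hβ : 0 ≤ β) {p r : ℝ}
    (hp : 1 ≤ p) (hpd : p < d) (hr : r = d * p / (d - p)) :
    ∃ C : ℝ≥0, ∀ (Ω : Set (RSpace d)) (x₀ e : RSpace d) (R : ℝ), IsOpen Ω → 0 < R →
      x₀ ∈ closure Ω → ConeCondition Ω x₀ R β e →
      ∀ (u : RSpace d → ℝ) (Du : RSpace d → RSpace d),
      Measurable u → Measurable Du → IntegrableOn u Ω → IntegrableOn Du Ω →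
      IsWeakGradient Ω u Du →
      ∫⁻ x in Ω ∩ ball x₀ (R / (3 * (1 + β ^ 2))), ‖u x - viewAverage x₀ e R β u‖ₑ ^ r ≤
        C * (∫⁻ x in Ω ∩ ball x₀ R, ‖Du x‖ₑ ^ p) ^ (r / p) := by
  obtain ⟨C, hC⟩ := exists_sobolev_const hd hβ hp hpd hr
  have hp0 : 0 < p := by linarith
  have hdp : 0 < (d : ℝ) - p := by linarith
  have hr0 : 0 < r := by
    rw [hr]
    have : (0 : ℝ) < d := by linarith
    positivity
  set A : ℝ≥0∞ := 1 + ENNReal.ofReal (6 * (1 + β ^ 2)) ^ p *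
    (2 ^ d * ENNReal.ofReal ((viewRadius β)⁻¹ ^ d)) with hA
  have hAtop : A ≠ ⊤ := by
    refine ENNReal.add_ne_top.2 ⟨by simp, ENNReal.mul_ne_top
      (ENNReal.rpow_ne_top_of_nonneg hp0.le ENNReal.ofReal_ne_top)
      (ENNReal.mul_ne_top (by simp) ENNReal.ofReal_ne_top)⟩
  refine ⟨(C * A ^ (r / p)).toNNReal, fun Ω x₀ e R hΩ hR hx₀ h u Du hum hDum hu hDu hw => ?_⟩
  rw [ENNReal.coe_toNNReal (ENNReal.mul_ne_top ENNReal.coe_ne_top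
    (ENNReal.rpow_ne_top_of_nonneg (by positivity) hAtop))]
  -- The larger radius of Sobolev's inequality is exactly the radius on which Poincaré's inequality
  -- holds; the latter bounds the zeroth-order term, and 2R/l = 6(1 + β²).
  have hl : 3 / 2 * (R / (3 * (1 + β ^ 2))) = R / (2 * (1 + β ^ 2)) := by field_simp
  have hlR : R / (2 * (1 + β ^ 2)) ≤ R := (half_div_one_add_sq_le hR.le).trans (by linarith)
  set P := ∫⁻ x in Ω ∩ ball x₀ R, ‖Du x‖ₑ ^ p with hP
  refine (hC Ω x₀ e (R / (3 * (1 + β ^ 2))) hΩ (by positivity) (h.mono (by rw [hl]; exact hlR))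
    u Du hum hDum hu hDu hw _).trans ?_
  rw [mul_assoc, ← ENNReal.mul_rpow_of_nonneg _ _ (by positivity), hl]
  gcongr
  rw [hA, add_mul, one_mul]
  have hsub : Ω ∩ ball x₀ (R / (2 * (1 + β ^ 2))) ⊆ Ω ∩ ball x₀ R :=
    inter_subset_inter_right _ (ball_subset_ball hlR)
  refine add_le_add (lintegral_mono_set hsub) ?_
  refine (mul_le_mul_right (h.poincare hβ hR hx₀ hΩ hum hDum hu hDu hw hp) _).trans (le_of_eq ?_)
  rw [← mul_assoc, ← mul_assoc, ← ENNReal.mul_rpow_of_nonneg _ _ hp0.le,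
    ← ENNReal.ofReal_mul (by positivity)]
  congr 4
  field_simp
  norm_num

theorem IsWeakGradient.congr {Ω : Set (RSpace d)} {u u' : RSpace d → ℝ}
    {Du Du' : RSpace d → RSpace d} (h : IsWeakGradient Ω u Du)
    (hu : u =ᵐ[volume.restrict Ω] u') (hDu : Du =ᵐ[volume.restrict Ω] Du') :
    IsWeakGradient Ω u' Du' := fun φ hφ hφc hφΩ i => by
  have h1 := h φ hφ hφc hφΩ i
  rw [integral_congr_ae (f := fun x => u x * fderiv ℝ φ x (EuclideanSpace.single i 1))
    (g := fun x => u' x * fderiv ℝ φ x (EuclideanSpace.single i 1))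
    (hu.mono fun x hx => by simp only [hx]),
    integral_congr_ae (f := fun x => Du x i * φ x) (g := fun x => Du' x i * φ x) (hDu.mono fun x hx => by simp only [hx])] at h1
  exact h1

/-- The **Sobolev–Poincaré inequality** under the cone condition. -/
theorem exists_sobolev_poincare_const (hd : 2 ≤ d) {β : ℝ} (hβ : 0 ≤ β) {p r : ℝ}
    (hp : 1 ≤ p) (hpd : p < d) (hr : r = d * p / (d - p)) :
    ∃ C : ℝ≥0, ∀ (Ω : Set (RSpace d)) (x₀ e : RSpace d) (R : ℝ), IsOpen Ω →
      Bornology.IsBounded Ω → 0 < R → x₀ ∈ closure Ω → ConeCondition Ω x₀ R β e →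
      ∀ (u : RSpace d → ℝ) (Du : RSpace d → RSpace d), IsSobolev Ω u Du →
      ∫⁻ x in Ω ∩ ball x₀ (R / (3 * (1 + β ^ 2))), ‖u x - viewAverage x₀ e R β u‖ₑ ^ r ≤
        C * (∫⁻ x in Ω ∩ ball x₀ R, ‖Du x‖ₑ ^ p) ^ (r / p) := by
  obtain ⟨C, hC⟩ := exists_sobolev_poincare_const_of_measurable hd hβ hp hpd hr
  refine ⟨C, fun Ω x₀ e R hΩ hΩb hR hx₀ h u Du hs => ?_⟩
  have hfin : IsFiniteMeasure (volume.restrict Ω) :=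
    ⟨by rw [Measure.restrict_apply_univ]; exact hΩb.measure_lt_top⟩
  have hum := hs.memLp.aestronglyMeasurable
  have hDum := hs.memLp_grad.aestronglyMeasurable
  have hu' := hum.ae_eq_mk
  have hDu' := hDum.ae_eq_mk
  have hsub : ∀ r, Ω ∩ ball x₀ r ⊆ Ω := fun r => inter_subset_left
  have := hC Ω x₀ e R hΩ hR hx₀ h (hum.mk u) (hDum.mk Du) hum.stronglyMeasurable_mk.measurable
    hDum.stronglyMeasurable_mk.measurable
    ((integrable_congr hu').1 (hs.memLp.integrable one_le_two))
    ((integrable_congr hDu').1 (hs.memLp_grad.integrable one_le_two))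
    (hs.weakGradient.congr hu' hDu')
  have hav : viewAverage x₀ e R β (hum.mk u) = viewAverage x₀ e R β u := by
    exact average_congr (EventuallyEq.symm (ae_restrict_of_ae_restrict_of_subset
      ((h.viewBall_subset hβ hR hx₀).trans (hsub _)) hu'))
  have e1 : ∫⁻ x in Ω ∩ ball x₀ R, ‖hDum.mk Du x‖ₑ ^ p = ∫⁻ x in Ω ∩ ball x₀ R, ‖Du x‖ₑ ^ p :=
    lintegral_congr_ae ((ae_restrict_of_ae_restrict_of_subset (hsub _) hDu').mono
      fun x hx => by simp only [hx])
  rw [hav, e1] at this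
  refine le_trans (le_of_eq (lintegral_congr_ae ?_)) this
  exact (ae_restrict_of_ae_restrict_of_subset (hsub _) hu').mono fun x hx => by simp only [hx]

end SobolevPoincare

/-! ### The Sobolev embedding into `L_γ` -/

section GammaEmbedding

open Filter Topology Metric

variable {d : ℕ} {γ : ℝ}

theorem IsGammaExponent.two_lt (h : IsGammaExponent d γ) : 2 < γ := by
  rcases h with ⟨hd, rfl⟩ | ⟨-, h⟩
  · have : (2 : ℝ) < d := by exact_mod_cast hd
    rw [lt_div_iff₀ (by linarith)]
    linarith
  · exact h

theorem IsGammaExponent.sub_two_mul_le (h : IsGammaExponent d γ) : ((d : ℝ) - 2) * γ ≤ 2 * d := by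
  rcases h with ⟨hd, rfl⟩ | ⟨rfl, -⟩
  · have : (2 : ℝ) < d := by exact_mod_cast hd
    rw [mul_div_cancel₀ _ (by linarith)]
  · norm_num

/-- Hölder's inequality against the constant 1; the power of the measure produces the power of R in
the final estimate. -/
theorem lintegral_rpow_le_rpow_mul_measure {α : Type*} [MeasurableSpace α] (ν : Measure α)
    {f : α → ℝ≥0∞} (hf : AEMeasurable f ν) {p q : ℝ} (hp : 0 < p) (hpq : p ≤ q) :
    ∫⁻ x, f x ^ p ∂ν ≤ (∫⁻ x, f x ^ q ∂ν) ^ (p / q) * ν univ ^ (1 - p / q) := by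
  have hq : 0 < q := hp.trans_le hpq
  have h := eLpNorm'_le_eLpNorm'_mul_rpow_measure_univ hp hpq hf.aestronglyMeasurable
  simp only [eLpNorm', enorm_eq_self] at h
  calc ∫⁻ x, f x ^ p ∂ν = ((∫⁻ x, f x ^ p ∂ν) ^ (1 / p)) ^ p := by
        rw [← ENNReal.rpow_mul, one_div_mul_cancel hp.ne', ENNReal.rpow_one]
    _ ≤ ((∫⁻ x, f x ^ q ∂ν) ^ (1 / q) * ν univ ^ (1 / p - 1 / q)) ^ p := by gcongr
    _ = _ := by
        rw [ENNReal.mul_rpow_of_nonneg _ _ hp.le, ← ENNReal.rpow_mul, ← ENNReal.rpow_mul]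
        congr 2
        · ring
        · field_simp

theorem volume_ball_eq (x₀ : RSpace d) {R : ℝ} (hR : 0 < R) :
    volume (ball x₀ R) = ENNReal.ofReal (R ^ d) * volume (ball (0 : RSpace d) 1) := by
  rw [Measure.addHaar_ball_of_pos _ _ hR, finrank_euclideanSpace_fin]

/-- The Sobolev–Poincaré inequality for the exponents `2` and `γ`. -/
theorem exists_sobolev_poincare_gamma_const (hd : 2 ≤ d) (hγ : IsGammaExponent d γ) {β : ℝ}
    (hβ : 0 ≤ β) :
    ∃ C : ℝ≥0, ∀ (Ω : Set (RSpace d)) (x₀ e : RSpace d) (R : ℝ), IsOpen Ω →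
      Bornology.IsBounded Ω → 0 < R → x₀ ∈ closure Ω → ConeCondition Ω x₀ R β e →
      ∀ (u : RSpace d → ℝ) (Du : RSpace d → RSpace d), IsSobolev Ω u Du →
      ∫⁻ x in Ω ∩ ball x₀ (R / (3 * (1 + β ^ 2))), ‖u x - viewAverage x₀ e R β u‖ₑ ^ γ ≤
        C * ENNReal.ofReal (R ^ ((d : ℝ) * γ * (1 / γ - 1 / 2) + γ)) *
          (∫⁻ x in Ω ∩ ball x₀ R, ‖Du x‖ₑ ^ (2 : ℝ)) ^ (γ / 2) := by
  have hd' : (2 : ℝ) ≤ d := by exact_mod_cast hd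
  have hγ2 := hγ.two_lt
  have hγ0 : 0 < γ := by linarith
  have hdγ : 0 < (d : ℝ) + γ := by linarith
  -- The exponent whose Sobolev conjugate is γ. It is smaller than d even if d = 2, and p ≤ 2 is
  -- equivalent to (d − 2)γ ≤ 2d.
  set p : ℝ := d * γ / (d + γ) with hp
  have hp1 : 1 ≤ p := by rw [hp, le_div_iff₀ hdγ]; nlinarith
  have hp0 : 0 < p := by linarith
  have hp2 : p ≤ 2 := by rw [hp, div_le_iff₀ hdγ]; linarith [hγ.sub_two_mul_le]
  have hpd : p < d := by rw [hp, div_lt_iff₀ hdγ]; nlinarith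
  have hdp : (d : ℝ) - p = d ^ 2 / (d + γ) := by rw [hp]; field_simp; ring
  have hr : γ = d * p / (d - p) := by rw [hdp, hp]; field_simp
  obtain ⟨C, hC⟩ := exists_sobolev_poincare_const hd hβ hp1 hpd hr
  set V : ℝ≥0∞ := volume (ball (0 : RSpace d) 1) ^ ((1 - p / 2) * (γ / p)) with hV
  have hexp : 0 ≤ (1 - p / 2) * (γ / p) := mul_nonneg (by linarith) (by positivity)
  have hVtop : V ≠ ⊤ := ENNReal.rpow_ne_top_of_nonneg hexp measure_ball_lt_top.ne
  refine ⟨(C * V).toNNReal, fun Ω x₀ e R hΩ hΩb hR hx₀ h u Du hs => ?_⟩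
  rw [ENNReal.coe_toNNReal (ENNReal.mul_ne_top ENNReal.coe_ne_top hVtop)]
  have hsub : Ω ∩ ball x₀ R ⊆ Ω := inter_subset_left
  have hm : AEMeasurable (fun x => ‖Du x‖ₑ) (volume.restrict (Ω ∩ ball x₀ R)) :=
    (hs.memLp_grad.aestronglyMeasurable.mono_measure (Measure.restrict_mono_set _ hsub)).enorm
  calc _ ≤ C * (∫⁻ x in Ω ∩ ball x₀ R, ‖Du x‖ₑ ^ p) ^ (γ / p) :=
        hC Ω x₀ e R hΩ hΩb hR hx₀ h u Du hs
    _ ≤ C * ((∫⁻ x in Ω ∩ ball x₀ R, ‖Du x‖ₑ ^ (2 : ℝ)) ^ (p / 2) *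
          (ENNReal.ofReal (R ^ d) * volume (ball (0 : RSpace d) 1)) ^ (1 - p / 2)) ^ (γ / p) := by
        gcongr
        refine (lintegral_rpow_le_rpow_mul_measure _ hm hp0 hp2).trans ?_
        gcongr
        · linarith
        rw [Measure.restrict_apply_univ, ← volume_ball_eq x₀ hR]
        exact measure_mono inter_subset_right
    _ = _ := by
        have e1 : ENNReal.ofReal (R ^ d) ^ ((1 - p / 2) * (γ / p)) =
            ENNReal.ofReal (R ^ ((d : ℝ) * γ * (1 / γ - 1 / 2) + γ)) := by
          rw [ENNReal.ofReal_rpow_of_pos (by positivity), ← Real.rpow_natCast, ← Real.rpow_mul hR.le]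
          congr 2
          rw [hp]
          field_simp
          ring
        have e2 : p / 2 * (γ / p) = γ / 2 := by field_simp
        rw [ENNReal.mul_rpow_of_nonneg _ _ (by positivity), ← ENNReal.rpow_mul,
          ← ENNReal.rpow_mul, ENNReal.mul_rpow_of_nonneg _ _ hexp, e1, e2, hV]
        ring

theorem enorm_rpow_le_enorm_sub_rpow_add (hγ : 1 ≤ γ) (a c : ℝ) :
    ‖a‖ₑ ^ γ ≤ 2 ^ (γ - 1) * (‖a - c‖ₑ ^ γ + ‖c‖ₑ ^ γ) := by
  refine le_trans ?_ (ENNReal.rpow_add_le_mul_rpow_add_rpow _ _ hγ)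
  gcongr
  calc ‖a‖ₑ = ‖(a - c) + c‖ₑ := by rw [sub_add_cancel]
    _ ≤ _ := enorm_add_le _ _

theorem LipschitzBoundary.exists_coneCondition_of_mem_closure {Ω : Set (RSpace d)} {β R₀ : ℝ}
    (hL : LipschitzBoundary Ω β R₀) (hd : 2 ≤ d) (hΩ : IsOpen Ω) (hR₀ : 0 < R₀) {x : RSpace d}
    (hx : x ∈ closure Ω) : ∃ R > 0, ∃ e, ConeCondition Ω x R β e := by
  by_cases hxΩ : x ∈ Ω
  · obtain ⟨R, hR, hball⟩ := Metric.isOpen_iff.1 hΩ x hxΩ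
    exact ⟨R, hR, exists_coneCondition_of_ball_subset hd hball⟩
  · have hxf : x ∈ frontier Ω := by rw [hΩ.frontier_eq]; exact ⟨hx, hxΩ⟩
    exact ⟨R₀, hR₀, hL.exists_coneCondition hxf hR₀ le_rfl⟩

/-- Functions of class `W^1_2` in a bounded Lipschitz set belong to `L_γ`. -/
theorem IsSobolev.memLp_gamma (hd : 2 ≤ d) (hγ : IsGammaExponent d γ) {β R₀ : ℝ} (hβ : 0 ≤ β)
    {Ω : Set (RSpace d)} (hΩ : IsOpen Ω) (hΩb : Bornology.IsBounded Ω) (hR₀ : 0 < R₀)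
    (hL : LipschitzBoundary Ω β R₀) {u : RSpace d → ℝ} {Du : RSpace d → RSpace d}
    (hs : IsSobolev Ω u Du) : MemLp u (ENNReal.ofReal γ) (volume.restrict Ω) := by
  have hγ2 := hγ.two_lt
  have hγ0 : 0 < γ := by linarith
  obtain ⟨C, hC⟩ := exists_sobolev_poincare_gamma_const hd hγ hβ
  refine ⟨hs.memLp.aestronglyMeasurable, ?_⟩
  rw [eLpNorm_lt_top_iff_lintegral_rpow_enorm_lt_top (by simpa using hγ0) (by simp),
    ENNReal.toReal_ofReal hγ0.le]
  have hcpt : IsCompact (closure Ω) := hΩb.isCompact_closure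
  have key : ∫⁻ x in Ω ∩ closure Ω, ‖u x‖ₑ ^ γ < ⊤ := by
    -- Finiteness of the integral passes to subsets and finite unions, so it is enough to have it
    -- near each point of the compact closure.
    refine hcpt.induction_on (p := fun s => ∫⁻ x in Ω ∩ s, ‖u x‖ₑ ^ γ < ⊤) (by simp) ?_ ?_ ?_
    · exact fun s t hst ht => (lintegral_mono_set (inter_subset_inter_right _ hst)).trans_lt ht
    · intro s t hs' ht
      rw [inter_union_distrib_left]
      exact (lintegral_union_le _ _ _).trans_lt (ENNReal.add_lt_top.2 ⟨hs', ht⟩)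
    · intro x hx
      obtain ⟨R, hR, e, he⟩ := hL.exists_coneCondition_of_mem_closure hd hΩ hR₀ hx
      refine ⟨ball x (R / (3 * (1 + β ^ 2))),
        mem_nhdsWithin_of_mem_nhds (ball_mem_nhds _ (by positivity)), ?_⟩
      set c := viewAverage x e R β u
      have hD : ∫⁻ x in Ω ∩ ball x R, ‖Du x‖ₑ ^ (2 : ℝ) < ⊤ := by
        refine (lintegral_mono_set inter_subset_left).trans_lt ?_
        have := hs.memLp_grad.2
        rwa [eLpNorm_lt_top_iff_lintegral_rpow_enorm_lt_top (by simp) (by simp),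
          ENNReal.toReal_ofNat] at this
      have h1 := hC Ω x e R hΩ hΩb hR hx he u Du hs
      have hsm : AEMeasurable (fun y => ‖u y - c‖ₑ ^ γ)
          (volume.restrict (Ω ∩ ball x (R / (3 * (1 + β ^ 2))))) := by
        have := (hs.memLp.aestronglyMeasurable.mono_measure
          (Measure.restrict_mono_set volume (inter_subset_left
            (t := ball x (R / (3 * (1 + β ^ 2))))))).aemeasurable
        fun_prop
      calc ∫⁻ y in Ω ∩ ball x (R / (3 * (1 + β ^ 2))), ‖u y‖ₑ ^ γ
          ≤ ∫⁻ y in Ω ∩ ball x (R / (3 * (1 + β ^ 2))),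
              2 ^ (γ - 1) * (‖u y - c‖ₑ ^ γ + ‖c‖ₑ ^ γ) :=
            lintegral_mono fun y => enorm_rpow_le_enorm_sub_rpow_add (by linarith) _ _
        _ = 2 ^ (γ - 1) * ((∫⁻ y in Ω ∩ ball x (R / (3 * (1 + β ^ 2))), ‖u y - c‖ₑ ^ γ) +
              ‖c‖ₑ ^ γ * volume (Ω ∩ ball x (R / (3 * (1 + β ^ 2))))) := by
            rw [lintegral_const_mul' _ _ (ENNReal.rpow_ne_top_of_nonneg (by linarith) (by simp)),
              lintegral_add_left' hsm, setLIntegral_const]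
        _ < ⊤ := by
            refine ENNReal.mul_lt_top (ENNReal.rpow_lt_top_of_nonneg (by linarith) (by simp))
              (ENNReal.add_lt_top.2 ⟨h1.trans_lt ?_, ENNReal.mul_lt_top
                (ENNReal.rpow_lt_top_of_nonneg hγ0.le enorm_ne_top)
                ((measure_mono inter_subset_right).trans_lt measure_ball_lt_top)⟩)
            exact ENNReal.mul_lt_top (ENNReal.mul_lt_top ENNReal.coe_lt_top ENNReal.ofReal_lt_top)
              (ENNReal.rpow_lt_top_of_nonneg (by positivity) hD.ne)
  rwa [inter_eq_left.2 subset_closure] at key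

end GammaEmbedding

/-! ### Carathéodory functions and test functions -/

section TestFunctions

open Filter Topology Metric

/-- For a simple function the composition is glued from finitely many measurable pieces; continuity
in z then gives the general case as an almost everywhere limit of simple approximations. -/
theorem aemeasurable_comp_of_caratheodory {X Z : Type*} [MeasurableSpace X] {ν : Measure X}
    [MetricSpace Z] [SecondCountableTopology Z] [MeasurableSpace Z] [BorelSpace Z]
    {F : X → Z → ℝ} (hF : ∀ z, AEMeasurable (fun x => F x z) ν) (hFc : ∀ᵐ x ∂ν, Continuous (F x))
    {w : X → Z} (hw : AEMeasurable w ν) : AEMeasurable (fun x => F x (w x)) ν := by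
  set w' := hw.aestronglyMeasurable.mk w with hw'
  have hw'm : StronglyMeasurable w' := hw.aestronglyMeasurable.stronglyMeasurable_mk
  suffices h : AEMeasurable (fun x => F x (w' x)) ν by
    refine h.congr ?_
    filter_upwards [hw.aestronglyMeasurable.ae_eq_mk] with x hx
    rw [hw', ← hx]
  refine aemeasurable_of_tendsto_metrizable_ae atTop (f := fun n x => F x (hw'm.approx n x))
    (fun n => ?_) ?_
  · set s := hw'm.approx n
    have hcount : Countable (range s) := (s.finite_range.countable).to_subtype
    have hcover : (⋃ z : range s, s ⁻¹' {(z : Z)}) = univ :=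
      eq_univ_of_forall fun x => mem_iUnion.2 ⟨⟨s x, mem_range_self x⟩, rfl⟩
    rw [← Measure.restrict_univ (μ := ν), ← hcover, aemeasurable_iUnion_iff]
    intro z
    refine ((hF z).mono_measure Measure.restrict_le_self).congr ?_
    filter_upwards [ae_restrict_mem (s.measurableSet_preimage _)] with x hx
    rw [show s x = z from hx]
  · filter_upwards [hFc] with x hx
    exact (hx.tendsto _).comp (hw'm.tendsto_approx x)

variable {d : ℕ} {Ω : Set (RSpace d)}

theorem gradient_apply (ζ : RSpace d → ℝ) (x : RSpace d) (i : Fin d) :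
    gradient ζ x i = fderiv ℝ ζ x (EuclideanSpace.single i 1) := by
  rw [gradient, ← InnerProductSpace.toDual_symm_apply, EuclideanSpace.inner_single_right]
  simp

theorem norm_gradient_eq (ζ : RSpace d → ℝ) (x : RSpace d) : ‖gradient ζ x‖ = ‖fderiv ℝ ζ x‖ := by
  rw [gradient, LinearIsometryEquiv.norm_map]

theorem continuous_gradient {ζ : RSpace d → ℝ} (hζ : ContDiff ℝ ∞ ζ) : Continuous (gradient ζ) :=
  (InnerProductSpace.toDual ℝ (RSpace d)).symm.continuous.comp (hζ.continuous_fderiv (by simp))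

/-- Truncation of `u - k` by a smooth cutoff function. -/
theorem IsSobolev.cutoff_mul_sub (hΩb : Bornology.IsBounded Ω)
    {u : RSpace d → ℝ} {Du : RSpace d → RSpace d} (hs : IsSobolev Ω u Du) {ζ : RSpace d → ℝ}
    (hζ : ContDiff ℝ ∞ ζ) (hζc : HasCompactSupport ζ) (k : ℝ) :
    IsSobolev Ω (fun x => ζ x * (u x - k)) (fun x => ζ x • Du x + (u x - k) • gradient ζ x) := by
  have hfin : IsFiniteMeasure (volume.restrict Ω) :=
    ⟨by rw [Measure.restrict_apply_univ]; exact hΩb.measure_lt_top⟩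
  obtain ⟨B, hB⟩ := hζ.continuous.bounded_above_of_compact_support hζc
  obtain ⟨B', hB'⟩ := (hζ.continuous_fderiv (by simp)).bounded_above_of_compact_support
    (hζc.fderiv ℝ)
  have hζm : AEStronglyMeasurable ζ (volume.restrict Ω) := hζ.continuous.aestronglyMeasurable
  have hgm : AEStronglyMeasurable (gradient ζ) (volume.restrict Ω) :=
    (continuous_gradient hζ).aestronglyMeasurable
  have huk : MemLp (fun x => u x - k) 2 (volume.restrict Ω) := hs.memLp.sub (memLp_const k)
  refine ⟨?_, MemLp.add ?_ ?_, ?_⟩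
  · refine huk.of_le_mul (c := B) (hζm.mul huk.1) (ae_of_all _ fun x => ?_)
    rw [norm_mul]
    gcongr
    exact hB x
  · refine hs.memLp_grad.of_le_mul (c := B) (hζm.smul hs.memLp_grad.1) (ae_of_all _ fun x => ?_)
    rw [norm_smul]
    gcongr
    exact hB x
  · refine huk.of_le_mul (c := B') (huk.1.smul hgm) (ae_of_all _ fun x => ?_)
    rw [norm_smul, mul_comm, norm_gradient_eq]
    gcongr
    exact hB' x
  · intro φ hφ hφc hφΩ i
    set e : RSpace d := EuclideanSpace.single i 1
    have hφd : Continuous fun x => fderiv ℝ φ x e :=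
      (hφ.continuous_fderiv (by simp)).clm_apply continuous_const
    have hζd : Continuous fun x => fderiv ℝ ζ x e :=
      (hζ.continuous_fderiv (by simp)).clm_apply continuous_const
    have hui : Integrable u (volume.restrict Ω) := hs.memLp.integrable one_le_two
    have hDui : Integrable (fun x => Du x i) (volume.restrict Ω) :=
      (EuclideanSpace.proj i : RSpace d →L[ℝ] ℝ).integrable_comp
        (hs.memLp_grad.integrable one_le_two)
    have hprod : ∀ {F h : RSpace d → ℝ}, Integrable F (volume.restrict Ω) → Continuous h →
        HasCompactSupport h → Integrable (fun x => F x * h x) (volume.restrict Ω) := by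
      intro F h hF hh hhc
      obtain ⟨b, hb⟩ := hh.bounded_above_of_compact_support hhc
      exact hF.mul_bdd hh.aestronglyMeasurable (ae_of_all _ hb)
    have hcφ' : HasCompactSupport fun x => fderiv ℝ φ x e := hφc.fderiv_apply ℝ e
    -- Product rule: the weak gradient of u is tested with ζφ. The constant k is handled by
    -- classical integration by parts on the whole space, since φ is supported in Ω.
    have h1 := hs.weakGradient (fun x => ζ x * φ x) (hζ.mul hφ) hφc.mul_left
      (tsupport_mul_subset_right.trans hφΩ) i
    have hder : ∀ x, fderiv ℝ (fun x => ζ x * φ x) x e =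
        ζ x * fderiv ℝ φ x e + φ x * fderiv ℝ ζ x e := fun x => by
      have := ((hζ.differentiable (by simp) x).hasFDerivAt.mul
        (hφ.differentiable (by simp) x).hasFDerivAt).fderiv
      change fderiv ℝ (fun x => ζ x * φ x) x = _ at this
      rw [this]
      simp
    have hconst : ∫ x in Ω, ζ x * fderiv ℝ φ x e = - ∫ x in Ω, fderiv ℝ ζ x e * φ x := by
      have hφ0 : ∀ x ∉ Ω, φ x = 0 := fun x hx => image_eq_zero_of_notMem_tsupport fun h => hx (hφΩ h)
      have hφ0' : ∀ x ∉ Ω, fderiv ℝ φ x = 0 := fun x hx =>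
        fderiv_of_notMem_tsupport ℝ fun h => hx (hφΩ h)
      rw [setIntegral_eq_integral_of_forall_compl_eq_zero (fun x hx => by simp [hφ0' x hx]),
        setIntegral_eq_integral_of_forall_compl_eq_zero (fun x hx => by simp [hφ0 x hx])]
      exact integral_mul_fderiv_eq_neg_fderiv_mul_of_integrable
        ((hζd.mul hφ.continuous).integrable_of_hasCompactSupport hφc.mul_left)
        ((hζ.continuous.mul hφd).integrable_of_hasCompactSupport hcφ'.mul_left)
        ((hζ.continuous.mul hφ.continuous).integrable_of_hasCompactSupport hφc.mul_left)
        (fun x _ => hζ.differentiable (by simp) x) (fun x _ => hφ.differentiable (by simp) x)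
    have i1 : Integrable (fun x => u x * (ζ x * fderiv ℝ φ x e)) (volume.restrict Ω) :=
      hprod hui (hζ.continuous.mul hφd) hcφ'.mul_left
    have i2 : Integrable (fun x => u x * (φ x * fderiv ℝ ζ x e)) (volume.restrict Ω) :=
      hprod hui (hφ.continuous.mul hζd) hφc.mul_right
    have i3 : Integrable (fun x => k * (ζ x * fderiv ℝ φ x e)) (volume.restrict Ω) :=
      hprod (integrable_const k) (hζ.continuous.mul hφd) hcφ'.mul_left
    have i4 : Integrable (fun x => Du x i * (ζ x * φ x)) (volume.restrict Ω) :=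
      hprod hDui (hζ.continuous.mul hφ.continuous) hφc.mul_left
    have i5 : Integrable (fun x => k * (fderiv ℝ ζ x e * φ x)) (volume.restrict Ω) :=
      hprod (integrable_const k) (hζd.mul hφ.continuous) hφc.mul_left
    have i42 : Integrable (fun x => Du x i * (ζ x * φ x) + u x * (φ x * fderiv ℝ ζ x e))
        (volume.restrict Ω) := i4.add i2
    simp_rw [show (EuclideanSpace.single i 1 : RSpace d) = e from rfl, hder, mul_add] at h1
    rw [integral_add i1 i2] at h1
    calc ∫ x in Ω, ζ x * (u x - k) * fderiv ℝ φ x e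
        = ∫ x in Ω, (u x * (ζ x * fderiv ℝ φ x e) - k * (ζ x * fderiv ℝ φ x e)) := by
          congr 1 with x; ring
      _ = (∫ x in Ω, u x * (ζ x * fderiv ℝ φ x e)) - k * ∫ x in Ω, ζ x * fderiv ℝ φ x e := by
          rw [integral_sub i1 i3, integral_const_mul]
      _ = -((∫ x in Ω, Du x i * (ζ x * φ x)) + (∫ x in Ω, u x * (φ x * fderiv ℝ ζ x e)) -
            ∫ x in Ω, k * (fderiv ℝ ζ x e * φ x)) := by
          rw [hconst, integral_const_mul]; linarith
      _ = - ∫ x in Ω, (ζ x • Du x + (u x - k) • gradient ζ x) i * φ x := by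
          rw [← integral_add i4 i2, ← integral_sub i42 i5]
          congr 2 with x
          simp only [PiLp.add_apply, PiLp.smul_apply, smul_eq_mul, gradient_apply]
          change Du x i * (ζ x * φ x) + u x * (φ x * fderiv ℝ ζ x e) - k * (fderiv ℝ ζ x e * φ x) =
            (ζ x * Du x i + (u x - k) * fderiv ℝ ζ x e) * φ x
          ring

end TestFunctions

/-! ### The pointwise Caccioppoli inequality -/

section Pointwise

/-- Young's inequality with constant 1, by replacing the smaller of s and t by the larger. -/
theorem rpow_sub_one_mul_le {γ s t : ℝ} (hγ : 1 < γ) (hs : 0 ≤ s) (ht : 0 ≤ t) :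
    s ^ (γ - 1) * t ≤ s ^ γ + t ^ γ := by
  have hsγ := Real.rpow_nonneg hs γ
  have htγ := Real.rpow_nonneg ht γ
  have hadd : ∀ {y : ℝ}, 0 ≤ y → y ^ (γ - 1) * y = y ^ γ := fun {y} hy => by
    rw [← Real.rpow_add_one' hy (by linarith), sub_add_cancel]
  rcases le_total t s with h | h
  · calc s ^ (γ - 1) * t ≤ s ^ (γ - 1) * s := by gcongr
      _ = s ^ γ := hadd hs
      _ ≤ _ := by linarith
  · calc s ^ (γ - 1) * t ≤ t ^ (γ - 1) * t := by gcongr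
      _ = t ^ γ := hadd ht
      _ ≤ _ := by linarith

theorem mul_le_rpow_conj_add {γ s t : ℝ} (hγ : 1 < γ) (hs : 0 ≤ s) (ht : 0 ≤ t) :
    s * t ≤ s ^ (γ / (γ - 1)) + t ^ γ := by
  have h := rpow_sub_one_mul_le hγ (Real.rpow_nonneg hs (1 / (γ - 1))) ht
  rwa [← Real.rpow_mul hs, ← Real.rpow_mul hs, one_div_mul_cancel (by linarith), Real.rpow_one,
    one_div_mul_eq_div] at h

/-- The gradient growth 2(1 − 1/γ) is critical: with s = κX^{2/γ}, Young's inequality yields exactly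
X², and the free κ makes its coefficient small enough to absorb. -/
theorem rpow_mul_le_mul_sq_add {γ κ X t : ℝ} (hγ : 1 < γ) (hκ : 0 < κ) (hX : 0 ≤ X) (ht : 0 ≤ t) :
    X ^ (2 * (1 - 1 / γ)) * t ≤ κ * X ^ 2 + (κ ^ (γ - 1))⁻¹ * t ^ γ := by
  have hγ0 : 0 < γ := by linarith
  have hκ1 : 0 < κ ^ (γ - 1) := Real.rpow_pos_of_pos hκ _
  have h := rpow_sub_one_mul_le hγ (s := κ * X ^ (2 / γ)) (by positivity) ht
  have e1 : (κ * X ^ (2 / γ)) ^ (γ - 1) = κ ^ (γ - 1) * X ^ (2 * (1 - 1 / γ)) := by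
    rw [Real.mul_rpow hκ.le (by positivity), ← Real.rpow_mul hX]
    congr 2
    field_simp
  have e2 : (κ * X ^ (2 / γ)) ^ γ = κ ^ (γ - 1) * (κ * X ^ 2) := by
    rw [Real.mul_rpow hκ.le (by positivity), ← Real.rpow_mul hX, div_mul_cancel₀ _ hγ0.ne',
      Real.rpow_two, ← mul_assoc, ← Real.rpow_add_one hκ.ne', sub_add_cancel]
  rw [e1, e2] at h
  have h2 := mul_le_mul_of_nonneg_left h (inv_nonneg.2 hκ1.le)
  calc X ^ (2 * (1 - 1 / γ)) * t
      = (κ ^ (γ - 1))⁻¹ * (κ ^ (γ - 1) * X ^ (2 * (1 - 1 / γ)) * t) := by field_simp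
    _ ≤ (κ ^ (γ - 1))⁻¹ * (κ ^ (γ - 1) * (κ * X ^ 2) + t ^ γ) := h2
    _ = _ := by field_simp

theorem abs_sum_mul_le {d : ℕ} {α : ℝ} {a : Fin d → ℝ} (ha : ∀ i, |a i| ≤ α) (ξ : RSpace d) :
    |∑ i, a i * ξ i| ≤ d * α * ‖ξ‖ := by
  calc |∑ i, a i * ξ i| ≤ ∑ i, |a i * ξ i| := Finset.abs_sum_le_sum_abs _ _
    _ ≤ ∑ _i : Fin d, α * ‖ξ‖ := by
        refine Finset.sum_le_sum fun i _ => ?_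
        rw [abs_mul]
        exact mul_le_mul (ha i) (PiLp.norm_apply_le ξ i) (abs_nonneg _)
          ((abs_nonneg _).trans (ha i))
    _ = _ := by simp [mul_assoc]

/-- The bookkeeping of the absorption: ellipticity gives μ, the losses are μ/8, μ/8 and μ/4, and μ/2
remains. -/
theorem pointwise_combination {μ μ₂ Y s₁ s₂ s₃ s₄ B c₁ c₂ c₃ k₂ k₃ a₁ a₂ a₃ a₄ F : ℝ}
    (h₁ : μ * Y ≤ s₁) (h₂ : -(μ / 8 * Y + c₁ * a₁) ≤ s₂) (h₃ : -(μ / 8 * Y + c₂) ≤ s₃)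
    (h₄ : -(c₃ + a₁) ≤ s₄) (hB : B ≤ μ / 4 * Y + (k₃ * a₂ + μ₂ * a₃ + μ₂ * a₄))
    (hc : c₂ + c₃ ≤ k₂ * (a₃ + F)) (ha₁ : 0 ≤ a₁) (ha₂ : 0 ≤ a₂) (ha₃ : 0 ≤ a₃) (ha₄ : 0 ≤ a₄)
    (hF : 0 ≤ F) (hc₁ : 0 ≤ c₁) (hk₂ : 0 ≤ k₂) (hk₃ : μ₂ ≤ k₃) (hμ₂ : 0 ≤ μ₂) :
    μ / 2 * Y ≤ s₁ + s₂ + s₃ + s₄ - B + ((c₁ + 1) + k₂ + k₃) * (a₁ + a₂ + a₃ + F + a₄) := by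
  have u1 := mul_le_mul_of_nonneg_left
    (by linarith : a₁ ≤ a₁ + a₂ + a₃ + F + a₄) (by linarith : 0 ≤ c₁ + 1)
  have u2 := mul_le_mul_of_nonneg_left (by linarith : a₃ + F ≤ a₁ + a₂ + a₃ + F + a₄) hk₂
  have u3 := mul_le_mul_of_nonneg_left
    (by linarith : a₂ + a₃ + a₄ ≤ a₁ + a₂ + a₃ + F + a₄) (hμ₂.trans hk₃)
  have u4 := mul_le_mul_of_nonneg_right hk₃ ha₃
  have u5 := mul_le_mul_of_nonneg_right hk₃ ha₄
  linarith

/-- The pointwise inequality behind the Caccioppoli estimate for controlled growth. -/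
theorem exists_pointwise_caccioppoli_const (d : ℕ) {γ μ μ₁ μ₂ : ℝ} (hγ : 2 < γ) (hμ : 0 < μ)
    (hμ₂ : 0 < μ₂) :
    ∃ K : ℝ, 0 ≤ K ∧ ∀ (A : Fin d → Fin d → ℝ) (a : Fin d → ℝ) (b z k η fx gx : ℝ)
      (ξ G : RSpace d), 0 ≤ η → η ≤ 1 → (∀ i j, |A i j| ≤ μ⁻¹) →
      μ * ‖ξ‖ ^ 2 ≤ ∑ i, ∑ j, A i j * ξ i * ξ j → (∀ i, |a i| ≤ μ₁ * (|z| ^ (γ / 2) + fx)) →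
      |b| ≤ μ₂ * (‖ξ‖ ^ (2 * (1 - 1 / γ)) + |z| ^ (γ - 1) + gx) →
      μ / 2 * (η ^ 2 * ‖ξ‖ ^ 2) ≤
        (∑ i, ((∑ j, A i j * ξ j) + a i) * (η ^ 2 * ξ i + (z - k) * (2 * η * G i))) -
          b * (η ^ 2 * (z - k)) +
        K * (‖G‖ ^ 2 * |z - k| ^ 2 + |z - k| ^ γ + |z| ^ γ + fx ^ 2 + |gx| ^ (γ / (γ - 1))) := by
  -- Chosen so that the source term consumes μ₂κ = μ/4 of the ellipticity.
  set κ : ℝ := μ / (4 * μ₂) with hκ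
  have hκ0 : 0 < κ := by positivity
  set Kκ : ℝ := (κ ^ (γ - 1))⁻¹ with hKκ
  have hKκ0 : 0 ≤ Kκ := by positivity
  set L : ℝ := d * (d * μ⁻¹) with hL
  refine ⟨(8 / μ * L ^ 2 + 1) + ((2 / μ + 1) * d ^ 2 * (2 * μ₁ ^ 2)) + μ₂ * (Kκ + 2),
    by positivity, fun A a b z k η fx gx ξ G hη hη1 hA hell ha hb => ?_⟩
  set X := ‖ξ‖ with hX
  set m := ‖G‖ with hm
  set w := |z - k| with hw
  set α := μ₁ * (|z| ^ (γ / 2) + fx) with hα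
  have hX0 : 0 ≤ X := norm_nonneg _
  have hm0 : 0 ≤ m := norm_nonneg _
  have hw0 : 0 ≤ w := abs_nonneg _
  have hη2 : η ^ 2 ≤ 1 := by nlinarith
  have hη20 : 0 ≤ η ^ 2 := sq_nonneg _
  set S₁ := ∑ i, ∑ j, A i j * ξ i * ξ j with hS₁
  set S₂ := ∑ i, (∑ j, A i j * ξ j) * G i with hS₂
  set S₃ := ∑ i, a i * ξ i with hS₃
  set S₄ := ∑ i, a i * G i with hS₄
  have hsum : (∑ i, ((∑ j, A i j * ξ j) + a i) * (η ^ 2 * ξ i + (z - k) * (2 * η * G i))) =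
      η ^ 2 * S₁ + 2 * η * (z - k) * S₂ + η ^ 2 * S₃ + 2 * η * (z - k) * S₄ := by
    rw [hS₁, hS₂, hS₃, hS₄, Finset.mul_sum, Finset.mul_sum, Finset.mul_sum, Finset.mul_sum,
      ← Finset.sum_add_distrib, ← Finset.sum_add_distrib, ← Finset.sum_add_distrib]
    refine Finset.sum_congr rfl fun i _ => ?_
    have : ∑ j, A i j * ξ i * ξ j = (∑ j, A i j * ξ j) * ξ i := by
      rw [Finset.sum_mul]
      exact Finset.sum_congr rfl fun j _ => by ring
    rw [this]
    ring
  have h2 : |S₂| ≤ L * X * m := by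
    have := abs_sum_mul_le (a := fun i => ∑ j, A i j * ξ j) (α := d * μ⁻¹ * X)
      (fun i => abs_sum_mul_le (hA i) ξ) G
    calc |S₂| ≤ _ := this
      _ = L * X * m := by rw [hL]; ring
  have h3 : |S₃| ≤ d * α * X := abs_sum_mul_le ha ξ
  have h4 : |S₄| ≤ d * α * m := abs_sum_mul_le ha G
  have hα2 : α ^ 2 ≤ 2 * μ₁ ^ 2 * (|z| ^ γ + fx ^ 2) := by
    have e : (|z| ^ (γ / 2)) ^ 2 = |z| ^ γ := by
      rw [← Real.rpow_natCast, ← Real.rpow_mul (abs_nonneg _)]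
      congr 1
      push_cast
      ring
    rw [hα, mul_pow, ← e]
    nlinarith [mul_nonneg (sq_nonneg μ₁) (sq_nonneg (|z| ^ (γ / 2) - fx))]
  -- the four terms of the principal part
  have t2 : -(μ / 8 * (η ^ 2 * X ^ 2) + 8 / μ * L ^ 2 * (m ^ 2 * w ^ 2)) ≤
      2 * η * (z - k) * S₂ := by
    have hab : |2 * η * (z - k) * S₂| ≤ 2 * η * w * (L * X * m) := by
      rw [abs_mul, abs_mul, abs_of_nonneg (by positivity : 0 ≤ 2 * η)]
      gcongr
    have hsq : 2 * η * w * (L * X * m) ≤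
        μ / 8 * (η ^ 2 * X ^ 2) + 8 / μ * L ^ 2 * (m ^ 2 * w ^ 2) := by
      have := two_mul_le_add_sq (η * X * μ) (8 * (L * m * w))
      have e : μ / 8 * (η ^ 2 * X ^ 2) + 8 / μ * L ^ 2 * (m ^ 2 * w ^ 2) -
          2 * η * w * (L * X * m) =
          ((η * X * μ) ^ 2 + (8 * (L * m * w)) ^ 2 - 2 * (η * X * μ) * (8 * (L * m * w))) /
            (8 * μ) := by
        field_simp
      have h0 : 0 ≤ ((η * X * μ) ^ 2 + (8 * (L * m * w)) ^ 2 -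
          2 * (η * X * μ) * (8 * (L * m * w))) / (8 * μ) := by
        apply div_nonneg _ (by positivity)
        linarith
      linarith
    linarith [neg_abs_le (2 * η * (z - k) * S₂)]
  have t3 : -(μ / 8 * (η ^ 2 * X ^ 2) + 2 / μ * d ^ 2 * α ^ 2) ≤ η ^ 2 * S₃ := by
    have hab : |η ^ 2 * S₃| ≤ η ^ 2 * (d * α * X) := by
      rw [abs_mul, abs_of_nonneg hη20]
      gcongr
    have hsq : d * α * X ≤ μ / 8 * X ^ 2 + 2 / μ * d ^ 2 * α ^ 2 := by
      have e : μ / 8 * X ^ 2 + 2 / μ * d ^ 2 * α ^ 2 - d * α * X =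
          (μ * X - 4 * (d * α)) ^ 2 / (8 * μ) := by
        field_simp
        ring
      have h0 : 0 ≤ (μ * X - 4 * (d * α)) ^ 2 / (8 * μ) := by positivity
      linarith
    have h5 : η ^ 2 * (d * α * X) ≤ μ / 8 * (η ^ 2 * X ^ 2) + 2 / μ * d ^ 2 * α ^ 2 := by
      have h6 := mul_le_mul_of_nonneg_left hsq hη20
      have h7 : η ^ 2 * (2 / μ * d ^ 2 * α ^ 2) ≤ 1 * (2 / μ * d ^ 2 * α ^ 2) := by gcongr
      linarith
    linarith [neg_abs_le (η ^ 2 * S₃)]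
  have t4 : -(d ^ 2 * α ^ 2 + m ^ 2 * w ^ 2) ≤ 2 * η * (z - k) * S₄ := by
    have hα0 : 0 ≤ d * α * m := (abs_nonneg _).trans h4
    have hab : |2 * η * (z - k) * S₄| ≤ 2 * 1 * w * (d * α * m) := by
      rw [abs_mul, abs_mul, abs_of_nonneg (by positivity : 0 ≤ 2 * η)]
      gcongr
    linarith [neg_abs_le (2 * η * (z - k) * S₄), two_mul_le_add_sq (d * α) (m * w)]
  -- the right-hand side
  have t5 : b * (η ^ 2 * (z - k)) ≤ μ / 4 * (η ^ 2 * X ^ 2) +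
      μ₂ * ((Kκ + 2) * w ^ γ + |z| ^ γ + |gx| ^ (γ / (γ - 1))) := by
    have y1 := rpow_mul_le_mul_sq_add (by linarith : 1 < γ) hκ0 hX0 hw0
    have y2 := rpow_sub_one_mul_le (by linarith : 1 < γ) (abs_nonneg z) hw0
    have y3 := mul_le_rpow_conj_add (by linarith : 1 < γ) (abs_nonneg gx) hw0
    have hg : gx * w ≤ |gx| * w := by gcongr; exact le_abs_self gx
    have h5 : |b| * w ≤ μ₂ * (κ * X ^ 2 + (Kκ + 2) * w ^ γ + |z| ^ γ + |gx| ^ (γ / (γ - 1))) := by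
      calc |b| * w ≤ μ₂ * (X ^ (2 * (1 - 1 / γ)) + |z| ^ (γ - 1) + gx) * w := by gcongr
        _ = μ₂ * (X ^ (2 * (1 - 1 / γ)) * w + |z| ^ (γ - 1) * w + gx * w) := by ring
        _ ≤ _ := by
          refine mul_le_mul_of_nonneg_left ?_ hμ₂.le
          linarith
    calc b * (η ^ 2 * (z - k)) ≤ |b * (η ^ 2 * (z - k))| := le_abs_self _
      _ = η ^ 2 * (|b| * w) := by rw [abs_mul, abs_mul, abs_of_nonneg hη20]; ring
      _ ≤ η ^ 2 * (μ₂ * (κ * X ^ 2 + (Kκ + 2) * w ^ γ + |z| ^ γ + |gx| ^ (γ / (γ - 1)))) := by gcongr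
      _ = μ₂ * κ * (η ^ 2 * X ^ 2) +
          η ^ 2 * (μ₂ * ((Kκ + 2) * w ^ γ + |z| ^ γ + |gx| ^ (γ / (γ - 1)))) := by ring
      _ ≤ μ / 4 * (η ^ 2 * X ^ 2) +
          1 * (μ₂ * ((Kκ + 2) * w ^ γ + |z| ^ γ + |gx| ^ (γ / (γ - 1)))) := by
        have : μ₂ * κ = μ / 4 := by rw [hκ]; field_simp
        rw [this]
        gcongr
      _ = _ := by ring
  have t1 : μ * (η ^ 2 * X ^ 2) ≤ η ^ 2 * S₁ := by
    have := mul_le_mul_of_nonneg_left hell hη20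
    linarith
  rw [hsum]
  refine pointwise_combination t1 t2 t3 t4 (t5.trans_eq (by ring)) ?_ (by positivity)
    (by positivity) (by positivity) (by positivity) (sq_nonneg fx) (by positivity) (by positivity)
    ?_ hμ₂.le
  · have c1 : (0 : ℝ) ≤ (2 / μ + 1) * d ^ 2 := by positivity
    have := mul_le_mul_of_nonneg_left hα2 c1
    linarith
  · rw [mul_add]
    have := mul_nonneg hμ₂.le hKκ0
    linarith

end Pointwise

/-! ### The Caccioppoli inequality -/

section Caccioppoli

open Filter Topology Metric

variable {d : ℕ} {Ω : Set (RSpace d)} {γ μ μ₁ μ₂ : ℝ} {c : Coefficients d} {f g u : RSpace d → ℝ}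
  {Du : RSpace d → RSpace d}

theorem MemLp.integrable_abs_rpow {α : Type*} [MeasurableSpace α] {ν : Measure α} {h : α → ℝ}
    {p : ℝ} (hp : 0 < p) (hh : MemLp h (ENNReal.ofReal p) ν) :
    Integrable (fun x => |h x| ^ p) ν := by
  have := hh.integrable_norm_rpow (by simpa using hp) (by simp)
  rwa [ENNReal.toReal_ofReal hp.le] at this

/-- Integrability must be known before the pointwise inequality is integrated, since the weak
equation is an identity of Bochner integrals. Here both factors are in L²: |u|^{γ/2} is, because u
is in L_γ. -/
theorem Coefficients.ControlledGrowth.integrable_flux_mul (hγ : 2 < γ) (hμ₁ : 0 < μ₁)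
    (hcar : c.IsCaratheodory Ω) (hell : c.IsElliptic Ω μ) (hf : MemLp f 2 (volume.restrict Ω))
    (hgr : c.ControlledGrowth Ω γ μ₁ μ₂ f g) (hs : IsSobolev Ω u Du)
    (huγ : MemLp u (ENNReal.ofReal γ) (volume.restrict Ω)) {Dφ : RSpace d → RSpace d}
    (hDφ : MemLp Dφ 2 (volume.restrict Ω)) :
    Integrable (fun x => ∑ i, ((∑ j, c.A i j x (u x) * Du x j) + c.a i x (u x)) * Dφ x i)
      (volume.restrict Ω) := by
  have hum : AEMeasurable u (volume.restrict Ω) := hs.memLp.aestronglyMeasurable.aemeasurable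
  have hcoord : ∀ {F : RSpace d → RSpace d}, MemLp F 2 (volume.restrict Ω) → ∀ i,
      MemLp (fun x => F x i) 2 (volume.restrict Ω) := fun {F} hF i =>
    hF.of_le_mul (c := 1) ((EuclideanSpace.proj i : RSpace d →L[ℝ] ℝ).continuous.comp_aestronglyMeasurable hF.1)
      (ae_of_all _ fun x => by rw [one_mul]; exact PiLp.norm_apply_le (F x) i)
  have hu2 : MemLp (fun x => |u x| ^ (γ / 2)) 2 (volume.restrict Ω) := by
    refine (memLp_two_iff_integrable_sq (f := fun x => |u x| ^ (γ / 2))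
      (hum.norm.pow_const _).aestronglyMeasurable).2 ((MemLp.integrable_abs_rpow (by linarith) huγ).congr (ae_of_all _ fun x => ?_))
    simp only
    rw [← Real.rpow_natCast, ← Real.rpow_mul (abs_nonneg _)]
    congr 1
    push_cast
    ring
  refine integrable_finsetSum _ fun i _ => MemLp.integrable_mul (p := 2) (q := 2)
    (MemLp.add (memLp_finsetSum _ fun j _ => ?_) ?_) (hcoord hDφ i)
  · refine (hcoord hs.memLp_grad j).of_le_mul (c := μ⁻¹) ?_ ?_
    · exact (aemeasurable_comp_of_caratheodory (hcar.measurable_A i j) (hcar.continuous_A i j)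
        hum).aestronglyMeasurable.mul (hcoord hs.memLp_grad j).1
    · filter_upwards [hell.bounded] with x hx
      rw [norm_mul]
      gcongr
      exact hx (u x) i j
  · refine (hu2.add hf).of_le_mul (c := μ₁) ?_ ?_
    · exact (aemeasurable_comp_of_caratheodory (hcar.measurable_a i) (hcar.continuous_a i)
        hum).aestronglyMeasurable
    · filter_upwards [hgr.growth_a] with x hx
      refine (hx (u x) i).trans ?_
      gcongr
      exact le_abs_self _

/-- The growth of b pairs with φ in L_γ by the three Young inequalities, with κ = 1. This is where u
must already be known to lie in L_γ. -/
theorem Coefficients.ControlledGrowth.integrable_source_mul (hγ : 2 < γ) (hμ₂ : 0 < μ₂)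
    (hcar : c.IsCaratheodory Ω)
    (hg : MemLp g (ENNReal.ofReal (γ / (γ - 1))) (volume.restrict Ω))
    (hgr : c.ControlledGrowth Ω γ μ₁ μ₂ f g) (hs : IsSobolev Ω u Du)
    (huγ : MemLp u (ENNReal.ofReal γ) (volume.restrict Ω)) {φ : RSpace d → ℝ}
    (hφ : MemLp φ (ENNReal.ofReal γ) (volume.restrict Ω)) :
    Integrable (fun x => c.b x (u x) (Du x) * φ x) (volume.restrict Ω) := by
  have hγ1 : 1 < γ := by linarith
  have hum : AEMeasurable u (volume.restrict Ω) := hs.memLp.aestronglyMeasurable.aemeasurable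
  have hDum : AEMeasurable Du (volume.restrict Ω) :=
    hs.memLp_grad.aestronglyMeasurable.aemeasurable
  have hbm := aemeasurable_comp_of_caratheodory (F := fun x (p : ℝ × RSpace d) => c.b x p.1 p.2)
    (fun p => hcar.measurable_b p.1 p.2) hcar.continuous_b (hum.prodMk hDum)
  have iD : Integrable (fun x => ‖Du x‖ ^ 2) (volume.restrict Ω) := by
    simpa using hs.memLp_grad.integrable_norm_pow (by norm_num)
  have iφ := MemLp.integrable_abs_rpow (by linarith) hφ
  have iu := MemLp.integrable_abs_rpow (by linarith) huγ
  have ig := MemLp.integrable_abs_rpow (div_pos (by linarith) (by linarith)) hg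
  have hdom : Integrable (fun x => μ₂ * (‖Du x‖ ^ 2 + |u x| ^ γ + |g x| ^ (γ / (γ - 1)) +
      3 * |φ x| ^ γ)) (volume.restrict Ω) :=
    (((iD.add iu).add ig).add (iφ.const_mul 3)).const_mul μ₂
  refine hdom.mono' (hbm.aestronglyMeasurable.mul hφ.1) ?_
  filter_upwards [hgr.growth_b] with x hx
  have hφ0 := abs_nonneg (φ x)
  have y1 := rpow_mul_le_mul_sq_add hγ1 one_pos (norm_nonneg (Du x)) hφ0
  have y2 := rpow_sub_one_mul_le hγ1 (abs_nonneg (u x)) hφ0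
  have y3 := mul_le_rpow_conj_add hγ1 (abs_nonneg (g x)) hφ0
  rw [Real.one_rpow, inv_one, one_mul, one_mul] at y1
  have hgx : g x * |φ x| ≤ |g x| * |φ x| := by gcongr; exact le_abs_self _
  rw [Real.norm_eq_abs, abs_mul]
  calc |c.b x (u x) (Du x)| * |φ x|
      ≤ μ₂ * (‖Du x‖ ^ (2 * (1 - 1 / γ)) + |u x| ^ (γ - 1) + g x) * |φ x| := by
        gcongr; exact hx _ _
    _ = μ₂ * (‖Du x‖ ^ (2 * (1 - 1 / γ)) * |φ x| + |u x| ^ (γ - 1) * |φ x| + g x * |φ x|) := by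
        ring
    _ ≤ _ := by
        refine mul_le_mul_of_nonneg_left ?_ hμ₂.le
        linarith

theorem ofReal_abs_rpow_eq (a : ℝ) {p : ℝ} (hp : 0 ≤ p) :
    ENNReal.ofReal (|a| ^ p) = ‖a‖ₑ ^ p := by
  rw [← ENNReal.ofReal_rpow_of_nonneg (abs_nonneg a) hp, ← Real.norm_eq_abs, ofReal_norm]

theorem enorm_abs_rpow_half_sq (a : ℝ) {p : ℝ} (hp : 0 ≤ p) :
    ‖|a| ^ ((1 / 2) * p)‖ₑ ^ (2 : ℝ) = ‖a‖ₑ ^ p := by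
  rw [Real.enorm_rpow_of_nonneg (abs_nonneg a) (by positivity), ← ENNReal.rpow_mul,
    Real.enorm_abs]
  congr 1
  ring

/-- The **Caccioppoli inequality** for the conormal derivative problem with controlled growth. -/
theorem exists_caccioppoli_const (d : ℕ) {γ μ μ₁ μ₂ : ℝ} (hγ : 2 < γ) (hμ : 0 < μ)
    (hμ₁ : 0 < μ₁) (hμ₂ : 0 < μ₂) :
    ∃ K : ℝ≥0, ∀ (Ω : Set (RSpace d)), IsOpen Ω → Bornology.IsBounded Ω →
      ∀ (c : Coefficients d) (f g : RSpace d → ℝ),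
        c.IsCaratheodory Ω → c.IsElliptic Ω μ →
        MemLp f 2 (volume.restrict Ω) →
        MemLp g (ENNReal.ofReal (γ / (γ - 1))) (volume.restrict Ω) →
        c.ControlledGrowth Ω γ μ₁ μ₂ f g →
      ∀ (u : RSpace d → ℝ) (Du : RSpace d → RSpace d), c.IsWeakSolution Ω u Du →
        MemLp u (ENNReal.ofReal γ) (volume.restrict Ω) →
      ∀ (x₀ : RSpace d) (l : ℝ), 0 < l → ∀ k : ℝ,
        ∫⁻ x in Ω ∩ ball x₀ l, ‖Du x‖ₑ ^ (2 : ℝ) ≤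
          K * ∫⁻ x in Ω ∩ ball x₀ (4 / 3 * l),
            (ENNReal.ofReal (1 / l) ^ (2 : ℝ) * ‖u x - k‖ₑ ^ (2 : ℝ) + ‖u x - k‖ₑ ^ γ +
              ‖u x‖ₑ ^ γ + (‖f x‖ₑ ^ (2 : ℝ) +
                ‖|g x| ^ ((1 / 2) * (γ / (γ - 1)))‖ₑ ^ (2 : ℝ))) := by
  obtain ⟨K, hK0, hK⟩ := exists_pointwise_caccioppoli_const d (μ₁ := μ₁) hγ hμ hμ₂
  obtain ⟨M, hM⟩ := exists_cutoff_bound d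
  have hγ0 : 0 < γ := by linarith
  have hγ' : 0 < γ / (γ - 1) := div_pos hγ0 (by linarith)
  set C : ℝ := 2 / μ * K * (1 + (M : ℝ) ^ 2) with hC
  have hC0 : 0 ≤ C := by positivity
  refine ⟨C.toNNReal, fun Ω hΩ hΩb c f g hcar hell hf hg hgr u Du hsol huγ x₀ l hl k => ?_⟩
  have hs := hsol.sobolev
  have hfin : IsFiniteMeasure (volume.restrict Ω) :=
    ⟨by rw [Measure.restrict_apply_univ]; exact hΩb.measure_lt_top⟩
  obtain ⟨η, hηs, hη01, hη1, hηsupp, hηM⟩ := hM x₀ l hl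
  have hηc : HasCompactSupport η :=
    Metric.isCompact_of_isClosed_isBounded (isClosed_tsupport η) (isBounded_closedBall.subset hηsupp)
  set ζ : RSpace d → ℝ := fun x => η x ^ 2 with hζ
  have hζs : ContDiff ℝ ∞ ζ := hηs.pow 2
  have hζc : HasCompactSupport ζ := hηc.comp_left (g := fun t : ℝ => t ^ 2) (by simp)
  have hζ01 : ∀ x, 0 ≤ ζ x ∧ ζ x ≤ 1 := fun x => by
    have := hη01 x
    exact ⟨sq_nonneg _, by simp only [hζ]; nlinarith⟩
  have hgrad : ∀ x i, gradient ζ x i = 2 * η x * gradient η x i := fun x i => by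
    rw [gradient_apply, gradient_apply]
    have := ((hηs.differentiable (by simp) x).hasFDerivAt.pow 2).fderiv
    change fderiv ℝ ζ x = _ at this
    rw [this]
    simp
  have hφ := hs.cutoff_mul_sub hΩb hζs hζc k
  set φ : RSpace d → ℝ := fun x => ζ x * (u x - k) with hφdef
  set Dφ : RSpace d → RSpace d := fun x => ζ x • Du x + (u x - k) • gradient ζ x with hDφdef
  have hukγ : MemLp (fun x => u x - k) (ENNReal.ofReal γ) (volume.restrict Ω) :=
    huγ.sub (memLp_const k)
  have huk2 : MemLp (fun x => u x - k) 2 (volume.restrict Ω) := hs.memLp.sub (memLp_const k)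
  have hφγ : MemLp φ (ENNReal.ofReal γ) (volume.restrict Ω) := by
    refine hukγ.of_le_mul (c := 1) hφ.memLp.1 (ae_of_all _ fun x => ?_)
    rw [norm_mul]
    gcongr
    rw [Real.norm_of_nonneg (hζ01 x).1]
    exact (hζ01 x).2
  have iE := hgr.integrable_flux_mul hγ hμ₁ hcar hell hf hs huγ hφ.memLp_grad
  have iB := hgr.integrable_source_mul hγ hμ₂ hcar hg hs huγ hφγ
  have heq := hsol.equation φ Dφ hφ
  set E : RSpace d → ℝ :=
    fun x => ∑ i, ((∑ j, c.A i j x (u x) * Du x j) + c.a i x (u x)) * Dφ x i with hE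
  set H₀ : RSpace d → ℝ := fun x => (1 / l) ^ 2 * |u x - k| ^ 2 + |u x - k| ^ γ + |u x| ^ γ +
    (f x ^ 2 + |g x| ^ (γ / (γ - 1))) with hH₀
  have iH₀ : Integrable H₀ (volume.restrict Ω) := by
    refine Integrable.add (Integrable.add (Integrable.add (Integrable.const_mul ?_ _) ?_) ?_)
      (Integrable.add ?_ ?_)
    · simpa using huk2.integrable_norm_pow (by norm_num)
    · exact MemLp.integrable_abs_rpow hγ0 hukγ
    · exact MemLp.integrable_abs_rpow hγ0 huγ
    · exact hf.integrable_sq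
    · exact MemLp.integrable_abs_rpow hγ' hg
  have hH₀0 : ∀ x, 0 ≤ H₀ x := fun x => by simp only [hH₀]; positivity
  set S := ball x₀ (4 / 3 * l) with hS
  have hηS : ∀ x ∉ S, η x = 0 ∧ gradient η x = 0 := fun x hx => by
    have hx' : x ∉ tsupport η := fun h => hx (closedBall_subset_ball (by linarith) (hηsupp h))
    refine ⟨image_eq_zero_of_notMem_tsupport hx', ?_⟩
    rw [← norm_eq_zero, norm_gradient_eq, fderiv_of_notMem_tsupport ℝ hx', norm_zero]
  -- Inside `S` this is the pointwise inequality with |∇η| ≤ M/l; outside, η and the test function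
  -- vanish, so all terms are zero.
  have hpt : ∀ᵐ x ∂volume.restrict Ω, μ / 2 * (η x ^ 2 * ‖Du x‖ ^ 2) ≤
      E x - c.b x (u x) (Du x) * φ x + K * (1 + (M : ℝ) ^ 2) * S.indicator H₀ x := by
    filter_upwards [hell.bounded, hell.elliptic, hgr.growth_a, hgr.growth_b] with x hA hEl ha hb
    have hDφi : ∀ i, Dφ x i = η x ^ 2 * Du x i + (u x - k) * (2 * η x * gradient η x i) :=
      fun i => by
        simp only [hDφdef, hζ, PiLp.add_apply, PiLp.smul_apply, smul_eq_mul]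
        rw [← hgrad]
    by_cases hx : x ∈ S
    · rw [indicator_of_mem hx]
      have h1 := hK (fun i j => c.A i j x (u x)) (fun i => c.a i x (u x)) (c.b x (u x) (Du x))
        (u x) k (η x) (f x) (g x) (Du x) (gradient η x) (hη01 x).1 (hη01 x).2
        (fun i j => hA (u x) i j) (hEl (u x) (Du x)) (fun i => ha (u x) i) (hb (u x) (Du x))
      have h2 : E x = ∑ i, ((∑ j, c.A i j x (u x) * Du x j) + c.a i x (u x)) *
          (η x ^ 2 * Du x i + (u x - k) * (2 * η x * gradient η x i)) := by
        simp only [hE, hDφi]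
      rw [← h2] at h1
      refine h1.trans ?_
      simp only [hφdef, hζ]
      rw [mul_assoc K]
      gcongr
      have hG : ‖gradient η x‖ ^ 2 ≤ (M : ℝ) ^ 2 * (1 / l) ^ 2 := by
        rw [norm_gradient_eq, ← mul_pow, mul_one_div]
        gcongr
        exact hηM x
      have h3 := mul_le_mul_of_nonneg_right hG (sq_nonneg |u x - k|)
      have h4 : (M : ℝ) ^ 2 * ((1 / l) ^ 2 * |u x - k| ^ 2) ≤ (M : ℝ) ^ 2 * H₀ x := by
        gcongr
        simp only [hH₀]
        have : 0 ≤ |u x - k| ^ γ + |u x| ^ γ + (f x ^ 2 + |g x| ^ (γ / (γ - 1))) := by positivity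
        linarith
      have h5 : 0 ≤ (1 / l) ^ 2 * |u x - k| ^ 2 := by positivity
      simp only [hH₀] at h4 ⊢
      linarith
    · obtain ⟨hη0, hg0⟩ := hηS x hx
      have hE0 : E x = 0 := by simp [hE, hDφi, hη0]
      have hφ0 : φ x = 0 := by simp [hφdef, hζ, hη0]
      rw [indicator_of_notMem hx, hE0, hφ0, hη0]
      simp
  have hSm : MeasurableSet S := isOpen_ball.measurableSet
  have iD : Integrable (fun x => ‖Du x‖ ^ 2) (volume.restrict Ω) := by
    simpa using hs.memLp_grad.integrable_norm_pow (by norm_num)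
  have iηD : Integrable (fun x => η x ^ 2 * ‖Du x‖ ^ 2) (volume.restrict Ω) := by
    refine iD.bdd_mul (c := 1) hζs.continuous.aestronglyMeasurable (ae_of_all _ fun x => ?_)
    rw [Real.norm_of_nonneg (hζ01 x).1]
    exact (hζ01 x).2
  have iH : Integrable (fun x => K * (1 + (M : ℝ) ^ 2) * S.indicator H₀ x) (volume.restrict Ω) :=
    (iH₀.indicator hSm).const_mul _
  have hint := integral_mono_ae (iηD.const_mul (μ / 2)) ((iE.sub iB).add iH) hpt
  have hint2 : ∫ x in Ω, η x ^ 2 * ‖Du x‖ ^ 2 ≤ C * ∫ x in Ω, S.indicator H₀ x := by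
    -- The weak equation cancels the flux against the source and leaves only the error terms.
    have e1 : ∫ x in Ω, ((E - fun x => c.b x (u x) (Du x) * φ x : RSpace d → ℝ) +
        (fun x => K * (1 + (M : ℝ) ^ 2) * S.indicator H₀ x : RSpace d → ℝ)) x =
        K * (1 + (M : ℝ) ^ 2) * ∫ x in Ω, S.indicator H₀ x := by
      rw [integral_add' (iE.sub iB) iH, integral_sub' iE iB, heq, sub_self, zero_add,
        integral_const_mul]
    rw [integral_const_mul] at hint
    have h6 := mul_le_mul_of_nonneg_left (hint.trans_eq e1) (by positivity : 0 ≤ 2 / μ)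
    calc _ = 2 / μ * (μ / 2 * ∫ x in Ω, η x ^ 2 * ‖Du x‖ ^ 2) := by field_simp
      _ ≤ _ := h6
      _ = _ := by rw [hC]; ring
  have hΩl : Ω ∩ ball x₀ l ⊆ Ω := inter_subset_left
  calc ∫⁻ x in Ω ∩ ball x₀ l, ‖Du x‖ₑ ^ (2 : ℝ)
      = ∫⁻ x in Ω ∩ ball x₀ l, ENNReal.ofReal (η x ^ 2 * ‖Du x‖ ^ 2) := by
        refine setLIntegral_congr_fun (hΩ.inter isOpen_ball).measurableSet fun x hx => ?_
        rw [hη1 x hx.2, one_pow, one_mul, ENNReal.ofReal_pow (norm_nonneg _), ofReal_norm,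
          ENNReal.rpow_two]
    _ ≤ ∫⁻ x in Ω, ENNReal.ofReal (η x ^ 2 * ‖Du x‖ ^ 2) := lintegral_mono_set hΩl
    _ = ENNReal.ofReal (∫ x in Ω, η x ^ 2 * ‖Du x‖ ^ 2) :=
        (ofReal_integral_eq_lintegral_ofReal iηD (ae_of_all _ fun x => by positivity)).symm
    _ ≤ ENNReal.ofReal (C * ∫ x in Ω, S.indicator H₀ x) := ENNReal.ofReal_le_ofReal hint2
    _ = C.toNNReal * ∫⁻ x in Ω, ENNReal.ofReal (S.indicator H₀ x) := by
        rw [ENNReal.ofReal_mul hC0, ofReal_integral_eq_lintegral_ofReal (iH₀.indicator hSm)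
          (ae_of_all _ fun x => indicator_nonneg (fun y _ => hH₀0 y) x)]
        rfl
    _ = C.toNNReal * ∫⁻ x in Ω ∩ S, ENNReal.ofReal (H₀ x) := by
        congr 1
        rw [inter_comm, ← Measure.restrict_restrict hSm, ← lintegral_indicator hSm]
        refine lintegral_congr fun x => ?_
        by_cases hx : x ∈ S <;> simp [hx]
    _ = _ := by
        congr 1
        refine lintegral_congr fun x => ?_
        have n1 : 0 ≤ (1 / l) ^ 2 * |u x - k| ^ 2 := by positivity
        have n2 : 0 ≤ |u x - k| ^ γ := by positivity
        have n3 : 0 ≤ |u x| ^ γ := by positivity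
        have n4 : 0 ≤ |g x| ^ (γ / (γ - 1)) := by positivity
        simp only [hH₀]
        rw [ENNReal.ofReal_add (by positivity) (by positivity),
          ENNReal.ofReal_add (by positivity) n3, ENNReal.ofReal_add n1 n2,
          ENNReal.ofReal_add (sq_nonneg _) n4, ofReal_abs_rpow_eq _ hγ0.le,
          ofReal_abs_rpow_eq _ hγ0.le, ofReal_abs_rpow_eq _ hγ'.le,
          enorm_abs_rpow_half_sq _ hγ'.le, ENNReal.ofReal_mul (by positivity),
          ENNReal.ofReal_pow (by positivity), ← sq_abs (f x)]
        rw [← Real.rpow_two |u x - k|, ← Real.rpow_two |f x|,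
          ofReal_abs_rpow_eq _ zero_le_two, ofReal_abs_rpow_eq _ zero_le_two, ENNReal.rpow_two (ENNReal.ofReal _)]

end Caccioppoli

/-! ### The reverse Hölder inequality -/

section ReverseHolder

open Filter Topology Metric

variable {d : ℕ}

theorem ENNReal.div_le_mul_div_of_le_mul {x B V C : ℝ≥0∞} (hB0 : B ≠ 0) (hB : B ≠ ⊤) (hV0 : V ≠ 0)
    (hV : V ≠ ⊤) (h : V ≤ C * B) : x / B ≤ C * (x / V) := by
  calc x / B = x * V⁻¹ * V * B⁻¹ := by
        rw [mul_assoc x, ENNReal.inv_mul_cancel hV0 hV, mul_one, div_eq_mul_inv]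
    _ ≤ x * V⁻¹ * (C * B) * B⁻¹ := by gcongr
    _ = C * (x / V) * (B * B⁻¹) := by rw [div_eq_mul_inv]; ring
    _ = C * (x / V) := by rw [ENNReal.mul_inv_cancel hB0 hB, mul_one]

/-- The view ball at scale ϱR lies in Ω and has volume comparable to that of B_R. Hence averages
over all the sets involved are comparable. -/
theorem ConeCondition.volume_ball_le {Ω : Set (RSpace d)} {x₀ e : RSpace d} {R β ϱ : ℝ}
    (h : ConeCondition Ω x₀ R β e) (hβ : 0 ≤ β) (hR : 0 < R) (hx₀ : x₀ ∈ closure Ω) (hϱ : 0 < ϱ)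
    (hϱ1 : ϱ ≤ 1) :
    volume (ball x₀ R) ≤ ENNReal.ofReal ((ϱ⁻¹ * (viewRadius β)⁻¹) ^ d) *
      volume (Ω ∩ ball x₀ (ϱ * R)) := by
  have hκ := viewRadius_pos hβ
  have hϱR : 0 < ϱ * R := mul_pos hϱ hR
  have h1 : volume (ball x₀ R) = ENNReal.ofReal (ϱ⁻¹ ^ d) * volume (ball x₀ (ϱ * R)) := by
    rw [Measure.addHaar_ball_mul_of_pos _ _ hϱ, ← mul_assoc, finrank_euclideanSpace_fin,
      ← ENNReal.ofReal_mul (by positivity), ← mul_pow, inv_mul_cancel₀ hϱ.ne', one_pow,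
      ENNReal.ofReal_one, one_mul, Measure.addHaar_ball_center]
  rw [h1, mul_pow, ENNReal.ofReal_mul (by positivity), mul_assoc]
  gcongr
  refine (volume_ball_le_mul_volume_viewBall x₀ e hβ).trans ?_
  gcongr
  refine ((h.mono (by nlinarith)).viewBall_subset hβ hϱR hx₀).trans ?_
  exact inter_subset_inter_right _ (ball_subset_ball (by linarith))

theorem ConeCondition.enorm_viewAverage_rpow_le {Ω : Set (RSpace d)} {x₀ e : RSpace d} {R β : ℝ}
    (h : ConeCondition Ω x₀ R β e) (hβ : 0 ≤ β) (hR : 0 < R) (hx₀ : x₀ ∈ closure Ω)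
    {u : RSpace d → ℝ} (hu : IntegrableOn u Ω) {p : ℝ} (hp : 1 ≤ p) :
    ‖viewAverage x₀ e R β u‖ₑ ^ p ≤ ENNReal.ofReal ((viewRadius β)⁻¹ ^ d) *
      ⨍⁻ x in Ω ∩ ball x₀ R, ‖u x‖ₑ ^ p ∂volume := by
  have hsub : viewBall x₀ e R β ⊆ Ω ∩ ball x₀ R := (h.viewBall_subset hβ hR hx₀).trans
    (inter_subset_inter_right _ (ball_subset_ball (by linarith)))
  have hB := (volume_viewBall_pos (x₀ := x₀) (e := e) hβ hR)
  have h1 := enorm_sub_viewAverage_rpow_le (x₀ := x₀) (e := e) hβ hR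
    (hu.mono_set (hsub.trans inter_subset_left)) 0 hp
  simp only [zero_sub, enorm_neg] at h1
  refine h1.trans ?_
  rw [setLAverage_eq, setLAverage_eq]
  calc _ ≤ (∫⁻ x in Ω ∩ ball x₀ R, ‖u x‖ₑ ^ p) / volume (viewBall x₀ e R β) := by
        gcongr
    _ ≤ _ := by
        refine ENNReal.div_le_mul_div_of_le_mul hB.ne' measure_ball_lt_top.ne
          (hB.trans_le (measure_mono hsub)).ne'
          ((measure_mono inter_subset_right).trans_lt measure_ball_lt_top).ne ?_
        exact (measure_mono inter_subset_right).trans (volume_ball_le_mul_volume_viewBall x₀ e hβ)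

/-- The reverse Hölder inequality under the cone condition. -/
theorem exists_reverse_holder_const (hd : 2 ≤ d) {γ : ℝ} (hγ : IsGammaExponent d γ)
    {μ μ₁ μ₂ β : ℝ} (hμ : 0 < μ) (hμ₁ : 0 < μ₁) (hμ₂ : 0 < μ₂) (hβ : 0 ≤ β)
    {q ϱ : ℝ} (hq : q = 2 * (d : ℝ) / ((d : ℝ) + 2)) (hϱ : ϱ = 1 / (4 * (1 + β ^ 2))) :
    ∃ N : ℝ≥0, ∀ (Ω : Set (RSpace d)), IsOpen Ω → Bornology.IsBounded Ω →
      ∀ (c : Coefficients d) (f g : RSpace d → ℝ),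
        c.IsCaratheodory Ω → c.IsElliptic Ω μ →
        MemLp f 2 (volume.restrict Ω) →
        MemLp g (ENNReal.ofReal (γ / (γ - 1))) (volume.restrict Ω) →
        c.ControlledGrowth Ω γ μ₁ μ₂ f g →
      ∀ (u : RSpace d → ℝ) (Du : RSpace d → RSpace d), c.IsWeakSolution Ω u Du →
        MemLp u (ENNReal.ofReal γ) (volume.restrict Ω) →
      ∀ (R : ℝ) (x₀ e : RSpace d), 0 < R → x₀ ∈ closure Ω → ConeCondition Ω x₀ R β e →
        (⨍⁻ x in Ω ∩ ball x₀ (ϱ * R), (‖Du x‖ₑ ^ (2 : ℝ) + ‖u x‖ₑ ^ γ) ∂volume) ≤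
          (N : ℝ≥0∞) *
              (⨍⁻ x in Ω ∩ ball x₀ R,
                (‖Du x‖ₑ ^ q + ‖u x‖ₑ ^ (γ * q / 2)) ∂volume) ^ (2 / q) +
            (N : ℝ≥0∞) *
              (⨍⁻ x in Ω ∩ ball x₀ R,
                (‖f x‖ₑ ^ (2 : ℝ) +
                  ‖|g x| ^ ((1 / 2) * (γ / (γ - 1)))‖ₑ ^ (2 : ℝ)) ∂volume) +
            (N : ℝ≥0∞) * ENNReal.ofReal (R ^ ((d : ℝ) * γ * (1 / γ - 1 / 2) + γ)) *
              (∫⁻ x in Ω ∩ ball x₀ R, ‖Du x‖ₑ ^ (2 : ℝ) ∂volume) ^ (γ / 2 - 1) *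
              (⨍⁻ x in Ω ∩ ball x₀ R, ‖Du x‖ₑ ^ (2 : ℝ) ∂volume) := by
  have hγ2 := hγ.two_lt
  have hγ0 : 0 < γ := by linarith
  have hd' : (2 : ℝ) ≤ d := by exact_mod_cast hd
  have hq1 : 1 ≤ q := by rw [hq, le_div_iff₀ (by linarith)]; linarith
  have hq0 : 0 < q := by linarith
  have hqd : q < d := by rw [hq, div_lt_iff₀ (by linarith)]; nlinarith
  have hqr : (2 : ℝ) = d * q / (d - q) := by
    have : (d : ℝ) - q = d ^ 2 / (d + 2) := by rw [hq]; field_simp; ring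
    rw [this, hq]
    field_simp
  have hγq : 1 ≤ γ * q / 2 := by
    have : 1 ≤ 2 * q / 2 := by linarith
    have h2 : 2 * q ≤ γ * q := by gcongr
    linarith
  have h2q : 2 / q = 1 + 2 / d := by rw [hq]; field_simp
  have hϱ0 : 0 < ϱ := by rw [hϱ]; positivity
  have hϱ1 : ϱ ≤ 1 := by
    rw [hϱ, div_le_one (by positivity)]
    nlinarith [sq_nonneg β]
  obtain ⟨C₂, hC₂⟩ := exists_sobolev_poincare_const hd hβ hq1 hqd hqr
  obtain ⟨Cγ, hCγ⟩ := exists_sobolev_poincare_gamma_const hd hγ hβ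
  obtain ⟨K, hK⟩ := exists_caccioppoli_const d hγ2 hμ hμ₁ hμ₂
  set A : ℝ≥0∞ := ENNReal.ofReal ((ϱ⁻¹ * (viewRadius β)⁻¹) ^ d) with hA
  set Cv : ℝ≥0∞ := ENNReal.ofReal ((viewRadius β)⁻¹ ^ d) with hCv
  set vol₁ : ℝ≥0∞ := volume (ball (0 : RSpace d) 1) with hvol₁
  set T : ℝ≥0∞ := 2 ^ (γ - 1) with hT
  have hTtop : T ≠ ⊤ := ENNReal.rpow_ne_top_of_nonneg (by linarith) (by simp)
  set N₁ : ℝ≥0∞ := ENNReal.ofReal (ϱ⁻¹ ^ 2) * C₂ * A * vol₁ ^ (2 / (d : ℝ)) with hN₁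
  set N₂ : ℝ≥0∞ := T * A * Cv ^ (2 / q) with hN₂
  set N₃ : ℝ≥0∞ := (1 + T) * Cγ * A with hN₃
  have hAtop : A ≠ ⊤ := ENNReal.ofReal_ne_top
  have hN₁top : N₁ ≠ ⊤ :=
    ENNReal.mul_ne_top (ENNReal.mul_ne_top (ENNReal.mul_ne_top ENNReal.ofReal_ne_top
      ENNReal.coe_ne_top) hAtop) (ENNReal.rpow_ne_top_of_nonneg (by positivity)
        measure_ball_lt_top.ne)
  have hN₂top : N₂ ≠ ⊤ := ENNReal.mul_ne_top (ENNReal.mul_ne_top hTtop hAtop)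
    (ENNReal.rpow_ne_top_of_nonneg (by positivity) ENNReal.ofReal_ne_top)
  have hN₃top : N₃ ≠ ⊤ := ENNReal.mul_ne_top (ENNReal.mul_ne_top (by simp [hTtop])
    ENNReal.coe_ne_top) hAtop
  -- The factor K serves |∇u|² through Caccioppoli; the additional 1 serves the term |u|^γ on the
  -- left.
  set N : ℝ≥0∞ := (K + 1) * (N₁ + N₂ + N₃ + A) with hN
  have hNtop : N ≠ ⊤ := ENNReal.mul_ne_top (by simp) (by
    simp only [ne_eq, ENNReal.add_eq_top, not_or]
    exact ⟨⟨⟨hN₁top, hN₂top⟩, hN₃top⟩, hAtop⟩)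
  refine ⟨N.toNNReal, fun Ω hΩ hΩb c f g hcar hell hf hg hgr u Du hsol huγ R x₀ e hR hx₀ h => ?_⟩
  rw [ENNReal.coe_toNNReal hNtop]
  have hs := hsol.sobolev
  have hfin : IsFiniteMeasure (volume.restrict Ω) :=
    ⟨by rw [Measure.restrict_apply_univ]; exact hΩb.measure_lt_top⟩
  set l := ϱ * R with hl
  have hl0 : 0 < l := mul_pos hϱ0 hR
  -- The value of ϱ is dictated by this identity: Caccioppoli's outer radius is the radius of the
  -- Sobolev–Poincaré inequality.
  have hl43 : 4 / 3 * l = R / (3 * (1 + β ^ 2)) := by rw [hl, hϱ]; field_simp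
  have hlR : 4 / 3 * l ≤ R := by
    rw [hl43, div_le_iff₀ (by positivity)]
    nlinarith [mul_nonneg hR.le (sq_nonneg β)]
  set k := viewAverage x₀ e R β u with hk
  set S := Ω ∩ ball x₀ (4 / 3 * l) with hS
  set ΩR := Ω ∩ ball x₀ R with hΩR
  have hSR : S ⊆ ΩR := inter_subset_inter_right _ (ball_subset_ball hlR)
  have hlS : Ω ∩ ball x₀ l ⊆ S := inter_subset_inter_right _ (ball_subset_ball (by linarith))
  have hSΩ : S ⊆ Ω := inter_subset_left
  set V := volume ΩR with hV
  set V' := volume (Ω ∩ ball x₀ l) with hV'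
  set W := volume (ball x₀ R) with hW
  have hW0 : W ≠ 0 := (measure_ball_pos _ _ hR).ne'
  have hWtop : W ≠ ⊤ := measure_ball_lt_top.ne
  have hWA : W ≤ A * V' := h.volume_ball_le hβ hR hx₀ hϱ0 hϱ1
  have hV'0 : V' ≠ 0 := fun h0 => hW0 (by simpa [h0] using hWA)
  have hVV' : V' ≤ V := measure_mono (hlS.trans hSR)
  have hVW : V ≤ W := measure_mono inter_subset_right
  have hVtop : V ≠ ⊤ := ne_top_of_le_ne_top hWtop hVW
  have hV'top : V' ≠ ⊤ := ne_top_of_le_ne_top hVtop hVV'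
  have hV0 : V ≠ 0 := fun h0 => hV'0 (le_antisymm (hVV'.trans h0.le) zero_le)
  have hWvol₁ : W = ENNReal.ofReal (R ^ d) * vol₁ := volume_ball_eq x₀ hR
  have hdiv : ∀ x : ℝ≥0∞, x / V' ≤ A * (x / V) := fun x =>
    ENNReal.div_le_mul_div_of_le_mul hV'0 hV'top hV0 hVtop (hVW.trans hWA)
  -- measurability
  have humS : AEMeasurable u (volume.restrict S) :=
    (hs.memLp.aestronglyMeasurable.mono_measure (Measure.restrict_mono_set _ hSΩ)).aemeasurable
  have hDumS : AEMeasurable Du (volume.restrict S) :=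
    (hs.memLp_grad.aestronglyMeasurable.mono_measure (Measure.restrict_mono_set _ hSΩ)).aemeasurable
  set G : RSpace d → ℝ≥0∞ := fun x => ‖f x‖ₑ ^ (2 : ℝ) +
    ‖|g x| ^ ((1 / 2) * (γ / (γ - 1)))‖ₑ ^ (2 : ℝ) with hG
  set Φ := ∫⁻ x in ΩR, G x with hΦ
  set D := ∫⁻ x in ΩR, ‖Du x‖ₑ ^ (2 : ℝ) with hD
  set Q := ∫⁻ x in ΩR, (‖Du x‖ₑ ^ q + ‖u x‖ₑ ^ (γ * q / 2)) with hQ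
  set ρ := ENNReal.ofReal (R ^ ((d : ℝ) * γ * (1 / γ - 1 / 2) + γ)) with hρ
  set I₂ := ∫⁻ x in S, ‖u x - k‖ₑ ^ (2 : ℝ) with hI₂
  set Iγ := ∫⁻ x in S, ‖u x - k‖ₑ ^ γ with hIγ
  set Iu := ∫⁻ x in S, ‖u x‖ₑ ^ γ with hIu
  have hI₂le : I₂ ≤ C₂ * Q ^ (2 / q) := by
    have := hC₂ Ω x₀ e R hΩ hΩb hR hx₀ h u Du hs
    rw [← hl43] at this
    refine this.trans ?_
    gcongr
    exact lintegral_mono fun x => le_self_add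
  have hIγle : Iγ ≤ Cγ * ρ * D ^ (γ / 2) := by
    have := hCγ Ω x₀ e R hΩ hΩb hR hx₀ h u Du hs
    rwa [← hl43] at this
  -- Jensen is applied with exponent γq/2 ≥ 1 rather than γ, which produces the lower power of u in
  -- the estimate.
  have hkle : ‖k‖ₑ ^ γ ≤ Cv ^ (2 / q) * (Q / V) ^ (2 / q) := by
    have h1 := h.enorm_viewAverage_rpow_le hβ hR hx₀ (hs.memLp.integrable one_le_two) hγq
    rw [setLAverage_eq] at h1
    calc ‖k‖ₑ ^ γ = (‖k‖ₑ ^ (γ * q / 2)) ^ (2 / q) := by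
          rw [← ENNReal.rpow_mul]
          congr 1
          field_simp
      _ ≤ (Cv * (Q / V)) ^ (2 / q) := by
          gcongr
          refine h1.trans ?_
          gcongr
          exact lintegral_mono fun x => le_add_self
      _ = _ := ENNReal.mul_rpow_of_nonneg _ _ (by positivity)
  have hIule : Iu ≤ T * (Iγ + ‖k‖ₑ ^ γ * W) := by
    calc Iu ≤ ∫⁻ x in S, T * (‖u x - k‖ₑ ^ γ + ‖k‖ₑ ^ γ) :=
          lintegral_mono fun x => enorm_rpow_le_enorm_sub_rpow_add (by linarith) _ _
      _ = T * (Iγ + ‖k‖ₑ ^ γ * volume S) := by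
          rw [lintegral_const_mul' _ _ hTtop, lintegral_add_right _ measurable_const,
            setLIntegral_const]
      _ ≤ _ := by
          gcongr
          exact (measure_mono hSR).trans hVW
  have hcacc : ∫⁻ x in Ω ∩ ball x₀ l, ‖Du x‖ₑ ^ (2 : ℝ) ≤
      K * (ENNReal.ofReal (1 / l) ^ (2 : ℝ) * I₂ + Iγ + Iu + Φ) := by
    refine (hK Ω hΩ hΩb c f g hcar hell hf hg hgr u Du hsol huγ x₀ l hl0 k).trans ?_
    have hm2 : AEMeasurable (fun x => ‖u x - k‖ₑ ^ (2 : ℝ)) (volume.restrict S) := by fun_prop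
    have hmγ : AEMeasurable (fun x => ‖u x - k‖ₑ ^ γ) (volume.restrict S) := by fun_prop
    have hmu : AEMeasurable (fun x => ‖u x‖ₑ ^ γ) (volume.restrict S) := by fun_prop
    have hm1 : AEMeasurable (fun x => ENNReal.ofReal (1 / l) ^ (2 : ℝ) * ‖u x - k‖ₑ ^ (2 : ℝ) +
        ‖u x - k‖ₑ ^ γ) (volume.restrict S) := (hm2.const_mul _).add hmγ
    have hm0 : AEMeasurable (fun x => ENNReal.ofReal (1 / l) ^ (2 : ℝ) * ‖u x - k‖ₑ ^ (2 : ℝ) +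
        ‖u x - k‖ₑ ^ γ + ‖u x‖ₑ ^ γ) (volume.restrict S) := hm1.add hmu
    rw [lintegral_add_left' hm0, lintegral_add_left' hm1, lintegral_add_left' (hm2.const_mul _),
      lintegral_const_mul' _ _ (ENNReal.rpow_ne_top_of_nonneg zero_le_two ENNReal.ofReal_ne_top)]
    gcongr
    exact lintegral_mono_set hSR
  have htotal : ∫⁻ x in Ω ∩ ball x₀ l, (‖Du x‖ₑ ^ (2 : ℝ) + ‖u x‖ₑ ^ γ) ≤
      (K + 1) * (ENNReal.ofReal (1 / l) ^ (2 : ℝ) * I₂ + Iγ + Iu + Φ) := by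
    rw [lintegral_add_left' ((hDumS.mono_measure (Measure.restrict_mono_set _ hlS)).enorm.pow_const _),
      add_mul, one_mul]
    refine add_le_add hcacc ?_
    calc _ ≤ Iu := lintegral_mono_set hlS
      _ ≤ ENNReal.ofReal (1 / l) ^ (2 : ℝ) * I₂ + Iγ + Iu := le_add_self
      _ ≤ _ := le_self_add
  -- division by the volume
  have d1 : ENNReal.ofReal (1 / l) ^ (2 : ℝ) * I₂ / V' ≤ N₁ * (Q / V) ^ (2 / q) := by
    have e1 : Q = V * (Q / V) := (ENNReal.mul_div_cancel hV0 hVtop).symm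
    have e2 : W ^ (2 / q) = W * (ENNReal.ofReal (R ^ 2) * vol₁ ^ (2 / (d : ℝ))) := by
      rw [h2q, ENNReal.rpow_add _ _ hW0 hWtop, ENNReal.rpow_one]
      congr 1
      rw [hWvol₁, ENNReal.mul_rpow_of_nonneg _ _ (by positivity),
        ENNReal.ofReal_rpow_of_pos (by positivity), ← Real.rpow_natCast, ← Real.rpow_mul hR.le,
        mul_div_cancel₀ _ (by positivity : (d : ℝ) ≠ 0), Real.rpow_two]
    have e3 : ENNReal.ofReal (1 / l) ^ (2 : ℝ) * ENNReal.ofReal (R ^ 2) =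
        ENNReal.ofReal (ϱ⁻¹ ^ 2) := by
      rw [ENNReal.rpow_two, ← ENNReal.ofReal_pow (by positivity),
        ← ENNReal.ofReal_mul (by positivity), hl]
      congr 1
      field_simp
    have e4 : W / V' ≤ A := ENNReal.div_le_of_le_mul hWA
    calc ENNReal.ofReal (1 / l) ^ (2 : ℝ) * I₂ / V'
        ≤ ENNReal.ofReal (1 / l) ^ (2 : ℝ) * (C₂ * (W ^ (2 / q) * (Q / V) ^ (2 / q))) / V' := by
          gcongr
          refine hI₂le.trans ?_
          rw [← ENNReal.mul_rpow_of_nonneg _ _ (by positivity)]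
          gcongr
          exact e1.le.trans (by gcongr)
      _ = (ENNReal.ofReal (1 / l) ^ (2 : ℝ) * ENNReal.ofReal (R ^ 2)) * C₂ * (W / V') *
            vol₁ ^ (2 / (d : ℝ)) * (Q / V) ^ (2 / q) := by
          rw [e2, div_eq_mul_inv, div_eq_mul_inv W]
          ring
      _ ≤ N₁ * (Q / V) ^ (2 / q) := by
          rw [e3, hN₁]
          gcongr
  have d2 : T * (‖k‖ₑ ^ γ * W) / V' ≤ N₂ * (Q / V) ^ (2 / q) := by
    have e4 : W / V' ≤ A := ENNReal.div_le_of_le_mul hWA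
    calc T * (‖k‖ₑ ^ γ * W) / V' = T * ‖k‖ₑ ^ γ * (W / V') := by
          rw [div_eq_mul_inv, div_eq_mul_inv]; ring
      _ ≤ T * (Cv ^ (2 / q) * (Q / V) ^ (2 / q)) * A := by gcongr
      _ = _ := by rw [hN₂]; ring
  -- One copy of D is averaged; the remaining power γ/2 − 1 stays as an unaveraged integral.
  have d3 : (1 + T) * Iγ / V' ≤ N₃ * (ρ * D ^ (γ / 2 - 1) * (D / V)) := by
    have e1 : D ^ (γ / 2) = D ^ (γ / 2 - 1) * D := by
      nth_rewrite 3 [← ENNReal.rpow_one D]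
      rw [← ENNReal.rpow_add_of_nonneg _ _ (by linarith) zero_le_one, sub_add_cancel]
    calc (1 + T) * Iγ / V' ≤ A * ((1 + T) * Iγ / V) := hdiv _
      _ ≤ A * ((1 + T) * (Cγ * ρ * (D ^ (γ / 2 - 1) * D)) / V) := by
          rw [← e1]; gcongr
      _ = _ := by simp only [hN₃, div_eq_mul_inv]; ring
  rw [setLAverage_eq, setLAverage_eq, setLAverage_eq, setLAverage_eq]
  calc (∫⁻ x in Ω ∩ ball x₀ l, (‖Du x‖ₑ ^ (2 : ℝ) + ‖u x‖ₑ ^ γ)) / V'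
      ≤ (K + 1) * (ENNReal.ofReal (1 / l) ^ (2 : ℝ) * I₂ + Iγ + T * (Iγ + ‖k‖ₑ ^ γ * W) + Φ) / V' := by
        gcongr
        refine htotal.trans ?_
        gcongr
    _ = (K + 1) * (ENNReal.ofReal (1 / l) ^ (2 : ℝ) * I₂ / V' + T * (‖k‖ₑ ^ γ * W) / V' +
          (1 + T) * Iγ / V' + Φ / V') := by
        simp only [div_eq_mul_inv]; ring
    _ ≤ (K + 1) * (N₁ * (Q / V) ^ (2 / q) + N₂ * (Q / V) ^ (2 / q) +
          N₃ * (ρ * D ^ (γ / 2 - 1) * (D / V)) + A * (Φ / V)) := by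
        gcongr
        exact hdiv Φ
    _ = (K + 1) * (N₁ + N₂) * (Q / V) ^ (2 / q) + (K + 1) * A * (Φ / V) +
          (K + 1) * N₃ * (ρ * D ^ (γ / 2 - 1) * (D / V)) := by ring
    _ ≤ N * (Q / V) ^ (2 / q) + N * (Φ / V) + N * (ρ * D ^ (γ / 2 - 1) * (D / V)) := by
        have m1 : (K + 1) * (N₁ + N₂) ≤ N := by
          exact mul_le_mul' le_rfl (le_self_add.trans le_self_add)
        have m2 : (K + 1) * A ≤ N := by
          exact mul_le_mul' le_rfl (le_add_self)
        have m3 : (K + 1) * N₃ ≤ N := by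
          exact mul_le_mul' le_rfl (le_add_self.trans le_self_add)
        gcongr
    _ = _ := by rw [mul_assoc N ρ, mul_assoc N]

end ReverseHolder

/-! ### Interior and boundary balls united by the cone condition. -/

theorem mainTheorem6 (d : ℕ) (hd : 2 ≤ d) (γ : ℝ) (hγ : IsGammaExponent d γ)
    (μ μ₁ μ₂ β : ℝ) (hμ : 0 < μ) (hμ' : μ ≤ 1) (hμ₁ : 0 < μ₁) (hμ₂ : 0 < μ₂) (hβ : 0 ≤ β)
    (q ϱ : ℝ) (hq : q = 2 * (d : ℝ) / ((d : ℝ) + 2)) (hϱ : ϱ = 1 / (4 * (1 + β ^ 2))) :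
    ∃ N : ℝ≥0,
      ∀ (Ω : Set (RSpace d)) (R₀ : ℝ), IsOpen Ω → Bornology.IsBounded Ω →
        0 < R₀ → R₀ ≤ 1 → LipschitzBoundary Ω β R₀ →
      ∀ (c : Coefficients d) (f g : RSpace d → ℝ),
        c.IsCaratheodory Ω → c.IsElliptic Ω μ →
        MemLp f 2 (volume.restrict Ω) →
        MemLp g (ENNReal.ofReal (γ / (γ - 1))) (volume.restrict Ω) →
        c.ControlledGrowth Ω γ μ₁ μ₂ f g →
      ∀ (u : RSpace d → ℝ) (Du : RSpace d → RSpace d), c.IsWeakSolution Ω u Du →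
      MemLp u (ENNReal.ofReal γ) (volume.restrict Ω) ∧
      ∀ (R : ℝ) (x₀ : RSpace d), 0 < R → R ≤ R₀ →
        (Metric.ball x₀ R ⊆ Ω ∨ x₀ ∈ frontier Ω) →
        (⨍⁻ x in Ω ∩ Metric.ball x₀ (ϱ * R), (‖Du x‖ₑ ^ (2 : ℝ) + ‖u x‖ₑ ^ γ) ∂volume) ≤
          (N : ℝ≥0∞) *
              (⨍⁻ x in Ω ∩ Metric.ball x₀ R,
                (‖Du x‖ₑ ^ q + ‖u x‖ₑ ^ (γ * q / 2)) ∂volume) ^ (2 / q) +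
            (N : ℝ≥0∞) *
              (⨍⁻ x in Ω ∩ Metric.ball x₀ R,
                (‖f x‖ₑ ^ (2 : ℝ) +
                  ‖|g x| ^ ((1 / 2) * (γ / (γ - 1)))‖ₑ ^ (2 : ℝ)) ∂volume) +
            (N : ℝ≥0∞) * ENNReal.ofReal (R ^ ((d : ℝ) * γ * (1 / γ - 1 / 2) + γ)) *
              (∫⁻ x in Ω ∩ Metric.ball x₀ R, ‖Du x‖ₑ ^ (2 : ℝ) ∂volume) ^ (γ / 2 - 1) *
              (⨍⁻ x in Ω ∩ Metric.ball x₀ R, ‖Du x‖ₑ ^ (2 : ℝ) ∂volume) := by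
  obtain ⟨N, hN⟩ := exists_reverse_holder_const hd hγ hμ hμ₁ hμ₂ hβ hq hϱ
  refine ⟨N, fun Ω R₀ hΩ hΩb hR₀ _ hL c f g hcar hell hf hg hgr u Du hsol => ?_⟩
  have huγ := hsol.sobolev.memLp_gamma hd hγ hβ hΩ hΩb hR₀ hL
  refine ⟨huγ, fun R x₀ hR hRR₀ hx₀ => ?_⟩
  obtain ⟨hcl, e, he⟩ : x₀ ∈ closure Ω ∧ ∃ e, ConeCondition Ω x₀ R β e := by
    rcases hx₀ with hball | hfr
    · exact ⟨subset_closure (hball (Metric.mem_ball_self hR)),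
        exists_coneCondition_of_ball_subset hd hball⟩
    · exact ⟨frontier_subset_closure hfr, hL.exists_coneCondition hfr hR hRR₀⟩
  exact hN Ω hΩ hΩb c f g hcar hell hf hg hgr u Du hsol huγ R x₀ e hR hcl he
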